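/- Let $\mathbb K$ be an algebraically closed field of characteristic zero and let $X$ be a smooth algebraic variety over $\mathbb K$ (an integral separated scheme of finite type, smooth over $\mathbb K$); points of $X$ are closed points, i.e. $\mathbb K$-points. For an open subset $U\subset X$, a *local spray of rank $r$ on $U$ with values in $X$* is a triple $(E,p,s)$ consisting of an algebraic vector bundle $p\colon E\to U$ of rank $r$ and a morphism of $\mathbb K$-varieties $s\colon E\to X$ such that $s|_Z=p|_Z$ on the zero section $Z\subset E$; for $U=X$ it is called a *spray on $X$*. It is *dominating at $x\in U$* if $s|_{E_x}\colon E_x\to X$, $E_x=p^{-1}(x)$, is dominant at the origin $0_x\in E_x$, i.e. $\mathrm d(s|_{E_x})\colon T_{0_x}E_x\to T_xX$ is surjective. The variety $X$ is *locally elliptic* if for every $x\in X$ there is a local spray with values in $X$ on some neighbourhood of $x$ which is dominating at $x$; it is *subelliptic* if there are finitely many sprays $(E_i,p_i,s_i)$, $i=1,\dots,m$, on $X$ with $T_xX=\sum_{i=1}^m \mathrm ds_i(T_{0_{i,x}}E_{i,x})$ for all $x\in X$. **Lemma.** (1) Let $U\subset X$ be a dense open subset and let $(E,p,s)$ be a local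 spray of rank $r$ on $U$ with values in $X$ which is dominating at a point $x\in U$. Then it extends, in the following sense, to a spray on $X$ that is dominating at $x$. There is a reduced effective Cartier divisor $D$ on $X$ (possibly $D=0$) such that $V:=X\setminus\operatorname{supp}D$ satisfies $x\in V\subset U$, and there is an $N\in\mathbb N$ such that for every $n\ge N$ there exists a spray $(\tilde E,\tilde p,\tilde s)$ on $X$, dominating at $x$, with the following properties: - $\tilde E\cong (X\times\mathbb A^r)\otimes\mathcal O_X(-nD)$, the direct sum of $r$ copies of $\mathcal O_X(-nD)$; let $\psi\colon\tilde E\to X\times\mathbb A^r$ be the homomorphism of vector bundles given by the direct sum of the canonical homomorphisms $\mathcal O_X(-nD)\to\mathcal O_X$, which is an isomorphism over $V$; - there is an isomorphism of vector bundles $\tau\colon V\times\mathbb A^r\to E|_V$ with $\tilde s|_{\tilde E|_V}=s\circ\tau\circ\psi|_{\tilde E|_V}$. (2) Consequently, if $X$ is locally elliptic, then $X$ is subelliptic. -/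

import Mathlib

open CategoryTheory CategoryTheory.Limits AlgebraicGeometry

universe u

noncomputable section

namespace Sprays

/-! ### Rational points and Zariski tangent spaces -/

section Tangent

variable {K : Type u} [Field K]

/-- The `K`-points of a `K`-scheme `π : X ⟶ Spec K`. For `K` algebraically closed and `X` of finite
type these are exactly the closed points of `X`. -/
abbrev KPoint {X : Scheme.{u}} (π : X ⟶ Spec (.of K)) : Type u :=
  {x : Spec (.of K) ⟶ X // x ≫ π = 𝟙 _}

/-- The point of the topological space of `X` underlying a morphism `Spec K ⟶ X`. -/
abbrev pt {X : Scheme.{u}} (x : Spec (.of K) ⟶ X) : X := x (IsLocalRing.closedPoint K)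

/-- Evaluation of germs of functions at `x : Spec K ⟶ X`. -/
def evalAt {X : Scheme.{u}} (x : Spec (.of K) ⟶ X) : X.presheaf.stalk (pt x) →+* K :=
  (Scheme.stalkClosedPointTo (R := .of K) x).hom

/-- The germs of constant functions: the structure map `K → 𝒪_{X, x}`. -/
def constGerm {X : Scheme.{u}} (π : X ⟶ Spec (.of K)) (x : X) : K →+* X.presheaf.stalk x :=
  ((Scheme.ΓSpecIso (.of K)).inv ≫ π.appTop ≫ X.presheaf.germ ⊤ x trivial).hom

/-- The Zariski tangent space `T_x X` at `x : Spec K ⟶ X`: the `K`-vector space of `K`-linear point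
derivations `𝒪_{X, x} → K`. -/
def tangentSpace {X : Scheme.{u}} (π : X ⟶ Spec (.of K)) (x : Spec (.of K) ⟶ X) :
    Submodule K (X.presheaf.stalk (pt x) → K) where
  carrier := {D | (∀ a b, D (a + b) = D a + D b) ∧
    (∀ a b, D (a * b) = evalAt x a * D b + evalAt x b * D a) ∧
    ∀ c, D (constGerm π (pt x) c) = 0}
  add_mem' := by
    rintro D D' ⟨h₁, h₂, h₃⟩ ⟨h₁', h₂', h₃'⟩
    refine ⟨fun a b => ?_, fun a b => ?_, fun c => ?_⟩
    · simp only [Pi.add_apply, h₁, h₁']; ring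
    · simp only [Pi.add_apply, h₂, h₂']; ring
    · simp only [Pi.add_apply, h₃, h₃', add_zero]
  zero_mem' := by
    refine ⟨fun a b => ?_, fun a b => ?_, fun c => ?_⟩ <;> simp
  smul_mem' := by
    rintro t D ⟨h₁, h₂, h₃⟩
    refine ⟨fun a b => ?_, fun a b => ?_, fun c => ?_⟩
    · simp only [Pi.smul_apply, smul_eq_mul, h₁]; ring
    · simp only [Pi.smul_apply, smul_eq_mul, h₂]; ring
    · simp only [Pi.smul_apply, smul_eq_mul, h₃, mul_zero]

/-- Pull-back of germs along `f : Y ⟶ X`, where `f` maps `y` to `x`. -/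
def germMap {X Y : Scheme.{u}} (f : Y ⟶ X) {y : Spec (.of K) ⟶ Y} {x : Spec (.of K) ⟶ X}
    (h : y ≫ f = x) : X.presheaf.stalk (pt x) →+* Y.presheaf.stalk (pt y) :=
  (X.presheaf.stalkSpecializes (specializes_of_eq (by rw [← h]; rfl)) ≫
    f.stalkMap (pt y)).hom

theorem germMap_rfl {X Y : Scheme.{u}} (f : Y ⟶ X) (y : Spec (.of K) ⟶ Y) :
    germMap f (rfl : y ≫ f = y ≫ f) = (f.stalkMap (pt y)).hom := by
  have e : X.presheaf.stalkSpecializes (specializes_of_eq (rfl : f (pt y) = f (pt y))) = 𝟙 _ :=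
    TopCat.Presheaf.stalkSpecializes_refl _ _
  exact congr(($e ≫ f.stalkMap (pt y)).hom).trans (by rw [Category.id_comp])

theorem evalAt_germMap {X Y : Scheme.{u}} (f : Y ⟶ X) {y : Spec (.of K) ⟶ Y}
    {x : Spec (.of K) ⟶ X} (h : y ≫ f = x) (a : X.presheaf.stalk (pt x)) :
    evalAt y (germMap f h a) = evalAt x a := by
  subst h
  rw [germMap_rfl]
  exact congr($(Scheme.stalkClosedPointTo_comp (R := .of K) y f).hom a).symm

theorem germMap_constGerm {X Y : Scheme.{u}} {π : X ⟶ Spec (.of K)} {π' : Y ⟶ Spec (.of K)}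
    (f : Y ⟶ X) (hf : f ≫ π = π') {y : Spec (.of K) ⟶ Y}
    {x : Spec (.of K) ⟶ X} (h : y ≫ f = x) (c : K) :
    germMap f h (constGerm π (pt x) c) = constGerm π' (pt y) c := by
  subst h hf
  have e : X.presheaf.germ ⊤ (f (pt y)) trivial ≫ f.stalkMap (pt y) =
      f.appTop ≫ Y.presheaf.germ ⊤ (pt y) trivial :=
    Scheme.Hom.germ_stalkMap f ⊤ (pt y) trivial
  have e' := congr((Scheme.ΓSpecIso (.of K)).inv ≫ π.appTop ≫ $e)
  rw [germMap_rfl]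
  simp only [constGerm, Scheme.Hom.comp_appTop, Category.assoc]
  exact congr($(e').hom c)

/-- The differential `T_y Y → T_x X` at `y` of a morphism `f : Y ⟶ X` of `K`-schemes mapping
`y` to `x`. -/
def tangentMap {X Y : Scheme.{u}} {π : X ⟶ Spec (.of K)} {π' : Y ⟶ Spec (.of K)}
    (f : Y ⟶ X) (hf : f ≫ π = π') {y : Spec (.of K) ⟶ Y} {x : Spec (.of K) ⟶ X}
    (h : y ≫ f = x) : tangentSpace π' y →ₗ[K] tangentSpace π x where
  toFun D := ⟨fun a => D.1 (germMap f h a), by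
    obtain ⟨D, h₁, h₂, h₃⟩ := D
    refine ⟨fun a b => ?_, fun a b => ?_, fun c => ?_⟩
    · simp only [map_add, h₁]
    · simp only [map_mul, h₂, evalAt_germMap]
    · simp only [germMap_constGerm f hf, h₃]⟩
  map_add' _ _ := rfl
  map_smul' _ _ := rfl

end Tangent

/-! ### Vector bundles as schemes over the base -/

/-- The functions `c k` on `p⁻¹(W)` are relative coordinates: together with `p` they give an
isomorphism of `p⁻¹(W)` onto the affine space `W × 𝔸ʳ` over `W`. -/
def IsCoord {E B : Scheme.{u}} (p : E ⟶ B) (W : B.Opens) {r : ℕ}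
    (c : Fin r → Γ(E, p ⁻¹ᵁ W)) : Prop :=
  IsIso (AffineSpace.homOfVector (n := ULift.{u} (Fin r)) (p ∣_ W)
    (fun k => (p ⁻¹ᵁ W).topIso.inv (c k.down)))

/-- Over `W ∩ W'` the functions `c'` are linear combinations of the functions `c` with
coefficients that are functions on the base `B`. -/
def IsLinearChange {E B : Scheme.{u}} (p : E ⟶ B) {W W' : B.Opens} {r : ℕ}
    (c : Fin r → Γ(E, p ⁻¹ᵁ W)) (c' : Fin r → Γ(E, p ⁻¹ᵁ W')) : Prop :=
  ∃ M : Matrix (Fin r) (Fin r) Γ(B, W ⊓ W'), ∀ k,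
    E.presheaf.map (homOfLE (p.preimage_mono inf_le_right)).op (c' k) =
      ∑ l, p.app (W ⊓ W') (M k l) *
        E.presheaf.map (homOfLE (p.preimage_mono inf_le_left)).op (c l)

/-- An algebraic vector bundle `p : E ⟶ B` of rank `r`, given by its total space and an atlas of
local trivializations with linear transition functions. The zero section is uniquely determined by
the atlas (it is the morphism on which all bundle coordinates vanish), and always exists. -/
structure VectorBundle (B : Scheme.{u}) (r : ℕ) where
  /-- the total space -/
  total : Scheme.{u}
  /-- the projection -/
  proj : total ⟶ B
  /-- the atlas: a chart over `W` is a system of `r` relative coordinates on `proj⁻¹(W)` -/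
  IsChart : (W : B.Opens) → (Fin r → Γ(total, proj ⁻¹ᵁ W)) → Prop
  isCoord : ∀ W c, IsChart W c → IsCoord proj W c
  exists_chart : ∀ b : B, ∃ W c, b ∈ W ∧ IsChart W c
  linear : ∀ W c W' c', IsChart W c → IsChart W' c' → IsLinearChange proj c c'
  /-- the zero section -/
  zero : B ⟶ total
  zero_proj : zero ≫ proj = 𝟙 B
  zero_coord : ∀ W c, IsChart W c → ∀ k, zero.app (proj ⁻¹ᵁ W) (c k) = 0

/-- A linear trivialization over `W` of the vector bundle `E` (not necessarily in the atlas): the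
dual coordinates of a frame of `E` over `W`. -/
def VectorBundle.IsTrivialization {B : Scheme.{u}} {r : ℕ} (E : VectorBundle B r) (W : B.Opens)
    (c : Fin r → Γ(E.total, E.proj ⁻¹ᵁ W)) : Prop :=
  IsCoord E.proj W c ∧ ∀ W' c', E.IsChart W' c' → IsLinearChange E.proj c' c

/-! ### Sprays -/

section Spray

variable {K : Type u} [Field K] {X : Scheme.{u}}

/-- A spray of rank `r` with values in the `K`-scheme `π : X ⟶ Spec K`, over a base `j : B ⟶ X`:
a vector bundle `p : E ⟶ B` of rank `r` and a morphism `s : E ⟶ X` of `K`-schemes which coincides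
with `p` (followed by `j`) on the zero section. For `B` an open subset of `X` and `j` the inclusion
this is a local spray on `B` with values in `X`. -/
structure Spray (π : X ⟶ Spec (.of K)) {B : Scheme.{u}} (j : B ⟶ X) (r : ℕ) extends
    VectorBundle B r where
  /-- the spray map `s` -/
  map : total ⟶ X
  map_over : map ≫ π = proj ≫ j ≫ π
  zero_map : zero ≫ map = j

/-- A local spray on the open subset `U` with values in `X`. -/
abbrev LocalSpray (π : X ⟶ Spec (.of K)) (U : X.Opens) (r : ℕ) := Spray π U.ι r

/-- A spray over (the whole of) `X`. -/
abbrev GlobalSpray (π : X ⟶ Spec (.of K)) (r : ℕ) := Spray π (𝟙 X) r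

namespace Spray

variable {π : X ⟶ Spec (.of K)} {B : Scheme.{u}} {j : B ⟶ X} {r : ℕ} (S : Spray π j r)

/-- The fibre `E_b` of the bundle of a spray, a scheme over `Spec K` by `pullback.snd`. -/
abbrev fiber (b : Spec (.of K) ⟶ B) : Scheme.{u} := pullback S.proj b

/-- The restriction `s|_{E_b}` of the spray map to a fibre. -/
def fiberMap (b : Spec (.of K) ⟶ B) : S.fiber b ⟶ X := pullback.fst S.proj b ≫ S.map

/-- The origin `0_b` of the fibre `E_b`. -/
def origin (b : Spec (.of K) ⟶ B) : Spec (.of K) ⟶ S.fiber b :=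
  pullback.lift (b ≫ S.zero) (𝟙 _) (by
    rw [Category.assoc, S.zero_proj, Category.comp_id, Category.id_comp])

theorem fiberMap_over (b : Spec (.of K) ⟶ B) (x : KPoint π) (h : b ≫ j = x.1) :
    S.fiberMap b ≫ π = pullback.snd S.proj b := by
  rw [fiberMap, Category.assoc, S.map_over, pullback.condition_assoc, reassoc_of% h, x.2,
    Category.comp_id]

theorem origin_fiberMap (b : Spec (.of K) ⟶ B) {x : Spec (.of K) ⟶ X} (h : b ≫ j = x) :
    S.origin b ≫ S.fiberMap b = x := by
  rw [fiberMap, origin, pullback.lift_fst_assoc, Category.assoc, S.zero_map, h]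

/-- The subspace `ds(T_{0_b} E_b)` of `T_x X`, where `b` is the point of the base `B` over `x`. -/
def tangentImage (b : Spec (.of K) ⟶ B) (x : KPoint π) (h : b ≫ j = x.1) :
    Submodule K (tangentSpace π x.1) :=
  LinearMap.range (tangentMap (S.fiberMap b) (S.fiberMap_over b x h) (S.origin_fiberMap b h))

/-- The spray is dominating at `x`: the point `x` lies in the base `B`, and the restriction
`s|_{E_x} : E_x ⟶ X` to the fibre over `x` is dominant at the origin `0_x`, i.e. its differential
`T_{0_x} E_x → T_x X` is surjective. -/
def DominatingAt (x : KPoint π) : Prop :=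
  ∃ (b : Spec (.of K) ⟶ B) (h : b ≫ j = x.1), S.tangentImage b x h = ⊤

end Spray

/-- `X` is locally elliptic: for every `x ∈ X` there is a local spray in a neighbourhood of `x` with
values in `X` which is dominating at `x`. -/
def LocallyElliptic (π : X ⟶ Spec (.of K)) : Prop :=
  ∀ x : KPoint π, ∃ (U : X.Opens) (r : ℕ) (S : LocalSpray π U r), pt x.1 ∈ U ∧ S.DominatingAt x

/-- `X` is subelliptic: there is a finite family of sprays `(E_i, p_i, s_i)` over `X`
with `T_x X = ∑ i, ds_i(T_{0_{i,x}} E_{i,x})` for all `x ∈ X`. -/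
def Subelliptic (π : X ⟶ Spec (.of K)) : Prop :=
  ∃ (m : ℕ) (r : Fin m → ℕ) (S : ∀ i, GlobalSpray π (r i)), ∀ x : KPoint π,
    ⨆ i, (S i).tangentImage x.1 x (Category.comp_id x.1) = ⊤

end Spray

/-! ### Effective divisors and twisted bundles -/

section Divisor

variable {X : Scheme.{u}}

/-- `D`, given by its ideal sheaf `𝒪_X(-D)`, is an effective Cartier divisor: it is locally defined
by one equation, which is not a zero divisor. -/
def IsEffectiveDivisor (D : X.IdealSheafData) : Prop :=
  ∀ y : X, ∃ W : X.affineOpens, y ∈ W.1 ∧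
    ∃ f ∈ nonZeroDivisors Γ(X, W), D.ideal W = Ideal.span {f}

/-- The complement of the support of `D`. -/
def compl (D : X.IdealSheafData) : X.Opens := D.support.compl

/-- The functions `ψ 1, …, ψ r` on the total space of the bundle `E` are the components of a
homomorphism of vector bundles `ψ : E → X × 𝔸ʳ` which identifies `E` with the direct sum of `r`
copies of the line bundle `𝒪_X(-nD)`, and `ψ` with the direct sum of `r` copies of the canonical
homomorphism `𝒪_X(-nD) → 𝒪_X`: wherever `D` has a local equation `f`, there is a linear
trivialization of `E` in which `ψ` is the multiplication by `f ^ n`. -/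
def IsTwist (D : X.IdealSheafData) (n : ℕ) {r : ℕ} (E : VectorBundle X r)
    (ψ : Fin r → Γ(E.total, ⊤)) : Prop :=
  ∀ (W : X.affineOpens) (f : Γ(X, W)), D.ideal W = Ideal.span {f} →
    ∃ c : Fin r → Γ(E.total, E.proj ⁻¹ᵁ W.1), E.IsTrivialization W.1 c ∧
      ∀ k, E.total.presheaf.map (homOfLE le_top).op (ψ k) = E.proj.app W.1 f ^ n * c k

variable {K : Type u} [Field K]

/-- The spray `T` over `X` extends the restriction to `V = X ∖ supp D` of the local spray `S`
on `U ⊇ V`, and its bundle is a trivial bundle twisted by `𝒪_X(-nD)`. That is: there are a linear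
trivialization `e` of the bundle of `S` over `V`, an isomorphism of the bundle of `T` with
the direct sum of `r` copies of `𝒪_X(-nD)`, with canonical homomorphism `ψ` to `X × 𝔸ʳ`, such that
the homomorphism `φ` over `V` from the bundle of `T` to the bundle of `S` given by `ψ` in terms
of the trivialization `e` carries the spray map of `S` to that of `T`. -/
def IsTwistedExtension {π : X ⟶ Spec (.of K)} {U : X.Opens} {r : ℕ} (S : LocalSpray π U r)
    (D : X.IdealSheafData) (n : ℕ) (T : GlobalSpray π r) : Prop :=
  ∃ (ψ : Fin r → Γ(T.total, ⊤))
    (e : Fin r → Γ(S.total, S.proj ⁻¹ᵁ (U.ι ⁻¹ᵁ compl D)))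
    (φ : (T.proj ⁻¹ᵁ compl D).toScheme ⟶ S.total),
    IsTwist D n T.toVectorBundle ψ ∧
    S.IsTrivialization (U.ι ⁻¹ᵁ compl D) e ∧
    φ ≫ S.proj ≫ U.ι = (T.proj ⁻¹ᵁ compl D).ι ≫ T.proj ∧
    (∀ k, φ.app _ (e k) = (T.proj ⁻¹ᵁ compl D).toScheme.presheaf.map (homOfLE le_top).op
      ((T.proj ⁻¹ᵁ compl D).ι.appTop (ψ k))) ∧
    φ ≫ S.map = (T.proj ⁻¹ᵁ compl D).ι ≫ T.map

end Divisor

end Sprays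

end

noncomputable section

/-! ### Factoriality of the local rings of smooth algebras -/

namespace MvPolynomial

variable {K R : Type*} [Field K] [CommRing R] [Algebra K R]

/-! Extension of a local spray. Shrink the base to an affine neighbourhood `V` of `x` inside `U`
over which the bundle is trivial. On a smooth variety the complement of an affine open subset is a
divisor: locally it has one equation `f`. Over `V` the spray is a map `V × 𝔸ʳ ⟶ X` in fibre
coordinates `t`, equal to the identity on `t = 0`, possibly with poles along `f = 0`. Substitute `t
= f ^ n * c`, where `c` are coordinates of the bundle twisted by `𝒪(-nD)`. A polynomial in `t` over
the functions on `f ≠ 0` differs from its constant term by monomials that contain some `t k`; for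
large `n` the substitution clears their denominators and leaves a factor `f` to spare.

Near the zero section the spray lands in a given affine chart `W`. There a function `a` on `W` pulls
back to a fraction `b / g ^ e` with `g = 1` on the zero section, and after the twist `b` becomes `a
+ f * q` and `g` becomes `1 + f * p`. Hence the twisted spray is defined where `1 + f * p ≠ 0`,
which contains the whole fibres over `f = 0`; where `f ≠ 0` it was defined already. Separatedness of
`X` glues these maps, and finite generation of the functions on `W` together with quasi-compactness
of `X` gives one `N` for everything (`exists_map_mul_eq_sub_of_substitution`,
`exists_twistMap_extension`, `exists_twistTotal_extension`). Over `V` the twist is an isomorphism of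
bundles, so the zero section and the differential at `x` are preserved
(`Spray.DominatingAt.of_isPullback`).

That the boundary is Cartier rests on factoriality (`uniqueFactorizationMonoid_of_smooth`), proved
by projecting. For `a ≠ 0` vanishing at a rational point, a general linear projection to affine
space of the dimension of the cotangent space is finite on `a = 0` and unramified at the point,
which is the only zero of `a` in its fibre. So modulo `a`, and up to units, elements of the local
ring are polynomials in the new coordinates; in particular `a` itself is a polynomial up to a unit.
Its irreducible factors stay prime in the local ring, because formal smoothness compares orders of
vanishing there with those in the polynomial ring. Given factoriality, the gcd `g` of the ideal `J`
of the boundary is a common denominator for all functions on the affine complement; since `J`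
generates the unit ideal there, a power of `g` lies in `J` locally, and `J`, being radical, is
locally `(g)` (`Ideal.exists_isPrincipal_near_of_map_eq_top`).

Subellipticity. The differential of a spray along the zero section is, over an affine chart, a
finite family of derivations, and the locus where derivations span the tangent space of a smooth
variety is open (`exists_forall_mem_span`). So each extended spray dominates on an open set, and
finitely many of these cover `X`. -/

theorem aeval_C_mul_X_of_isHomogeneous {ι : Type*} (x : ι → R) {d : ℕ} {G : MvPolynomial ι K}
    (hG : G.IsHomogeneous d) :
    aeval (fun i => Polynomial.C (x i) * Polynomial.X) G =
      Polynomial.C (aeval x G) * Polynomial.X ^ d := by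
  rw [aeval_def, aeval_def, eval₂_eq, eval₂_eq, map_sum, Finset.sum_mul]
  refine Finset.sum_congr rfl fun m hm => ?_
  have hd : d = ∑ i ∈ m.support, m i := hG.degree_eq_sum_deg_support hm
  have : ∏ i ∈ m.support, (Polynomial.X : Polynomial R) ^ m i = Polynomial.X ^ d := by
    rw [Finset.prod_pow_eq_pow_sum, ← hd]
  simp only [map_mul, map_pow, mul_pow, map_prod, Finset.prod_mul_distrib, this]
  rw [mul_assoc]; rfl

end MvPolynomial

section Homogeneous

variable {K R : Type*} [Field K] [CommRing R] [IsDomain R] [Algebra K R]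

open MvPolynomial in
/-- If `N` is larger than the transcendence degree of `R`, any `N` elements of `R` satisfy
a homogeneous relation modulo a given nonzero element. -/
theorem exists_isHomogeneous_aeval_mem_span {n N : ℕ} (hn : Algebra.trdeg K R ≤ n) (hN : n < N)
    (x : Fin N → R) {a : R} (ha : a ≠ 0) :
    ∃ (d : ℕ) (G : MvPolynomial (Fin N) K), G ≠ 0 ∧ G.IsHomogeneous d ∧
      aeval x G ∈ Ideal.span {a} := by
  -- The elements `a` and `x i * T` of `R[T]` are `N + 1` in number, while the transcendence degree
  -- of `R[T]` is at most `n + 1`. The variable `T` records the degree in the `x i`.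
  have hdep : ¬ AlgebraicIndependent K (fun i : Option (Fin N) =>
      i.elim (Polynomial.C a) fun i => Polynomial.C (x i) * Polynomial.X) := by
    intro h
    have h1 := h.lift_cardinalMk_le_trdeg
    have h2 : Algebra.trdeg K (Polynomial R) = Algebra.trdeg K R + 1 := by
      rw [← trdeg_add_eq K R (A := Polynomial R), Polynomial.trdeg_of_isDomain]
    rw [h2] at h1
    have h3 : Algebra.trdeg K R + 1 ≤ ((n + 1 : ℕ) : Cardinal) := by
      push_cast; gcongr
    have h4 : Cardinal.lift.{u_2} (Cardinal.mk (Option (Fin N))) = ((N + 1 : ℕ) : Cardinal) := by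
      simp
    rw [h4] at h1
    have h5 := h1.trans (Cardinal.lift_le.mpr h3)
    rw [Cardinal.lift_natCast, Nat.cast_le] at h5
    omega
  rw [algebraicIndependent_iff] at hdep
  push Not at hdep
  obtain ⟨F, hF, hF0⟩ := hdep
  set φ : MvPolynomial (Fin N) K →ₐ[K] Polynomial R :=
    aeval (fun i => Polynomial.C (x i) * Polynomial.X) with hφ
  have hev : ∀ F : MvPolynomial (Option (Fin N)) K,
      aeval (fun i : Option (Fin N) =>
        i.elim (Polynomial.C a) fun i => Polynomial.C (x i) * Polynomial.X) F =
      Polynomial.eval₂ φ.toRingHom (Polynomial.C a) (optionEquivLeft K (Fin N) F) := by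
    intro F
    induction F using MvPolynomial.induction_on with
    | C c => simp [optionEquivLeft_C, hφ]
    | add p q hp hq => simp only [map_add, hp, hq, Polynomial.eval₂_add]
    | mul_X p i hp =>
      simp only [map_mul, hp, Polynomial.eval₂_mul, aeval_X]
      cases i <;> simp [optionEquivLeft_X_none, optionEquivLeft_X_some, hφ]
  -- Read the relation as a polynomial in the variable that goes to `a` and divide by the largest
  -- possible power of that variable. Since `a ≠ 0` and `R[T]` is a domain, the quotient is still a
  -- relation.
  obtain ⟨P, hP0, hP⟩ : ∃ P : Polynomial (MvPolynomial (Fin N) K), P.coeff 0 ≠ 0 ∧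
      Polynomial.eval₂ φ.toRingHom (Polynomial.C a) P = 0 := by
    have hP : optionEquivLeft K (Fin N) F ≠ 0 := by simpa using hF0
    obtain ⟨Q, hQ, hQ'⟩ := Polynomial.exists_eq_pow_rootMultiplicity_mul_and_not_dvd _ hP 0
    refine ⟨Q, fun h => hQ' ?_, ?_⟩
    · rw [Polynomial.C_0, sub_zero]; exact Polynomial.X_dvd_iff.mpr h
    · rw [hev, hQ, Polynomial.eval₂_mul] at hF
      refine (mul_eq_zero.mp hF).resolve_left ?_
      simp [ha]
  obtain ⟨d, hd⟩ : ∃ d, homogeneousComponent d (P.coeff 0) ≠ 0 := by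
    by_contra! h
    exact hP0 (by rw [← sum_homogeneousComponent (P.coeff 0)]; simp [h])
  refine ⟨d, _, hd, homogeneousComponent_isHomogeneous d _, ?_⟩
  -- All other terms of the relation contain `a`. The coefficient of `T ^ d` then isolates the
  -- homogeneous component of degree `d`.
  have h1 : Polynomial.C a ∣ φ (P.coeff 0) := by
    rw [← Polynomial.divX_mul_X_add P, Polynomial.eval₂_add, Polynomial.eval₂_mul,
      Polynomial.eval₂_X, Polynomial.eval₂_C] at hP
    exact ⟨-Polynomial.eval₂ φ.toRingHom (Polynomial.C a) P.divX, by
      rw [mul_neg, mul_comm]; exact eq_neg_of_add_eq_zero_right hP⟩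
  have h2 := (Polynomial.C_dvd_iff_dvd_coeff _ _).mp h1 d
  rw [Ideal.mem_span_singleton]
  convert h2
  conv_rhs => rw [← sum_homogeneousComponent (P.coeff 0)]
  rw [map_sum, Polynomial.finsetSum_coeff]
  simp only [hφ, aeval_C_mul_X_of_isHomogeneous x (homogeneousComponent_isHomogeneous _ _),
    Polynomial.coeff_C_mul, Polynomial.coeff_X_pow]
  simp only [mul_ite, mul_one, mul_zero, Finset.sum_ite_eq, Finset.mem_range]
  split_ifs with h
  · rfl
  · rw [homogeneousComponent_eq_zero _ _ (by omega), map_zero]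

end Homogeneous

end

/-! ### The cotangent space at a rational point and the transcendence degree. -/

noncomputable section

section Cotangent

variable {K R : Type*} [Field K] [CommRing R] [Algebra K R]

theorem Ideal.sum_smul_toCotangent (I : Ideal R) {ι : Type*} [Fintype ι] (c : ι → K) (x : ι → I) :
    ∑ i, c i • I.toCotangent (x i) = I.toCotangent (∑ i, algebraMap K R (c i) • x i) := by
  rw [map_sum]
  refine Finset.sum_congr rfl fun i _ => ?_
  rw [map_smul, algebraMap_smul]

/-- The elements `x i` vanish at the rational point `ε` and span its cotangent space. -/
structure SpansCotangent {N : ℕ} (ε : R →ₐ[K] K) (x : Fin N → R) : Prop where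
  eval_eq_zero : ∀ i, ε (x i) = 0
  exists_sub_mem : ∀ u, ε u = 0 → ∃ c : Fin N → K, u - ∑ i, c i • x i ∈ RingHom.ker ε ^ 2

variable {ε : R →ₐ[K] K}

theorem SpansCotangent.span_toCotangent {N : ℕ} {x : Fin N → R} (h : SpansCotangent ε x) :
    ⊤ ≤ Submodule.span K (Set.range fun i =>
      (RingHom.ker ε).toCotangent ⟨x i, h.eval_eq_zero i⟩) := by
  rintro u -
  obtain ⟨⟨u, hu⟩, rfl⟩ := Ideal.toCotangent_surjective _ u
  obtain ⟨c, hc⟩ := h.exists_sub_mem u hu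
  have : (RingHom.ker ε).toCotangent ⟨u, hu⟩ =
      ∑ i, c i • (RingHom.ker ε).toCotangent ⟨x i, h.eval_eq_zero i⟩ := by
    rw [Ideal.sum_smul_toCotangent, Ideal.toCotangent_eq]
    simpa [Algebra.smul_def] using hc
  rw [this]
  exact Submodule.sum_mem _ fun i _ => Submodule.smul_mem _ _ (Submodule.subset_span ⟨i, rfl⟩)

/-- A family of cotangent vectors is dependent if it has more than `dim` members. -/
theorem exists_sum_smul_mem_ker_sq {N : ℕ} {x : Fin N → R} (h : ∀ i, ε (x i) = 0)
    [Module.Finite K (RingHom.ker ε).Cotangent]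
    (hN : Module.finrank K (RingHom.ker ε).Cotangent < N) :
    ∃ c : Fin N → K, c ≠ 0 ∧ ∑ i, c i • x i ∈ RingHom.ker ε ^ 2 := by
  have : ¬ LinearIndependent K fun i => (RingHom.ker ε).toCotangent ⟨x i, h i⟩ := fun h' => by
    have := h'.fintype_card_le_finrank
    simp at this; omega
  obtain ⟨c, hc, i, hi⟩ := Fintype.not_linearIndependent_iff.mp this
  refine ⟨c, fun h => hi (congrFun h i), ?_⟩
  rw [Ideal.sum_smul_toCotangent, Ideal.toCotangent_eq_zero] at hc
  simpa [Algebra.smul_def] using hc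

theorem SpansCotangent.eq_zero_of_sum_mem {x : Fin (Module.finrank K (RingHom.ker ε).Cotangent) → R}
    (h : SpansCotangent ε x) {c : _ → K} (hc : ∑ i, c i • x i ∈ RingHom.ker ε ^ 2) : c = 0 := by
  have := linearIndependent_of_top_le_span_of_card_eq_finrank h.span_toCotangent (by simp)
  rw [Fintype.linearIndependent_iff] at this
  refine funext (this c ?_)
  rw [Ideal.sum_smul_toCotangent, Ideal.toCotangent_eq_zero]
  simpa [Algebra.smul_def] using hc

theorem exists_spansCotangent [Module.Finite K (RingHom.ker ε).Cotangent] :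
    ∃ y : Fin (Module.finrank K (RingHom.ker ε).Cotangent) → R, SpansCotangent ε y := by
  let b := Module.finBasis K (RingHom.ker ε).Cotangent
  choose y hy using fun i => (RingHom.ker ε).toCotangent_surjective (b i)
  refine ⟨fun i => (y i).1, fun i => (y i).2, fun u hu => ?_⟩
  refine ⟨b.repr ((RingHom.ker ε).toCotangent ⟨u, hu⟩), ?_⟩
  have e := b.sum_repr ((RingHom.ker ε).toCotangent ⟨u, hu⟩)
  simp only [← hy] at e
  rw [Ideal.sum_smul_toCotangent, eq_comm, Ideal.toCotangent_eq] at e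
  simpa [Algebra.smul_def] using e

/-- The transcendence degree is bounded by the dimension of the Zariski cotangent space. -/
theorem SpansCotangent.trdeg_le [IsDomain R] [Algebra.FiniteType K R] {n : ℕ} {y : Fin n → R}
    (h : SpansCotangent ε y) : Algebra.trdeg K R ≤ n := by
  -- With `F` the subfield of `L` generated by the `y i`, it suffices that `Ω[L⁄F] = 0`: then `L` is
  -- separable, hence algebraic, over `F`, and the `y i` bound the transcendence degree.
  let L := FractionRing R
  let S : Set L := Set.range fun i => algebraMap R L (y i)
  let F := IntermediateField.adjoin K S
  let D := KaehlerDifferential.D F L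
  have hDy : ∀ i, D (algebraMap R L (y i)) = 0 := fun i =>
    D.map_algebraMap (⟨_, IntermediateField.subset_adjoin K S ⟨i, rfl⟩⟩ : F)
  have hDK : ∀ c : K, D (algebraMap R L (algebraMap K R c)) = 0 := fun c => by
    rw [← IsScalarTower.algebraMap_apply, IsScalarTower.algebraMap_apply K F L]
    exact D.map_algebraMap _
  let N : Submodule R (Ω[L⁄F]) := Submodule.span R (Set.range fun r => D (algebraMap R L r))
  have hNfg : N.FG := by
    have : N = (⊤ : Submodule R (Ω[R⁄K])).map (KaehlerDifferential.map K F R L) := by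
      rw [← KaehlerDifferential.span_range_derivation, Submodule.map_span,
        ← Set.range_comp]
      congr! 3 with r
      simp [D, KaehlerDifferential.map_D]
    rw [this]
    exact (Module.Finite.fg_top (R := R) (M := Ω[R⁄K])).map _
  -- Modulo the square of the maximal ideal every `r` is a constant plus a combination of the `y i`,
  -- all of which `D` kills, and `D` maps the square into `ker ε • N`. By Nakayama some `s` with `ε
  -- s = 1` annihilates `N`; as `s ≠ 0` acts invertibly on an `L`-vector space, `N = 0`.
  have hN : N ≤ RingHom.ker ε • N := by
    refine Submodule.span_le.mpr ?_
    rintro _ ⟨r, rfl⟩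
    obtain ⟨c, hc⟩ := h.exists_sub_mem (r - algebraMap K R (ε r)) (by simp)
    have key : ∀ v ∈ RingHom.ker ε ^ 2, D (algebraMap R L v) ∈ RingHom.ker ε • N := by
      intro v hv
      rw [pow_two] at hv
      refine Submodule.mul_induction_on hv (fun p hp q hq => ?_) fun p q hp hq => ?_
      · rw [map_mul, D.leibniz, algebraMap_smul, algebraMap_smul]
        exact Submodule.add_mem _
          (Submodule.smul_mem_smul hp (Submodule.subset_span ⟨q, rfl⟩))
          (Submodule.smul_mem_smul hq (Submodule.subset_span ⟨p, rfl⟩))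
      · rw [map_add, map_add]
        exact Submodule.add_mem _ hp hq
    have := key _ hc
    have e : D (algebraMap R L (r - algebraMap K R (ε r) - ∑ i, c i • y i)) =
        D (algebraMap R L r) := by
      simp only [map_sub, map_sum, Algebra.smul_def, map_mul, D.leibniz, hDy, hDK]
      simp
    rwa [e] at this
  obtain ⟨s, hs, hsN⟩ :=
    Submodule.exists_sub_one_mem_and_smul_eq_zero_of_fg_of_le_smul _ _ hNfg hN
  have hs0 : s ≠ 0 := by
    rintro rfl
    simp [RingHom.mem_ker] at hs
  have hDR : ∀ r, D (algebraMap R L r) = 0 := fun r => by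
    have := hsN _ (Submodule.subset_span ⟨r, rfl⟩)
    rw [← algebraMap_smul L] at this
    exact (smul_eq_zero.mp this).resolve_left (by simpa using hs0)
  have hDL : ∀ l, D l = 0 := fun l => by
    obtain ⟨a, b, hb, rfl⟩ := IsFractionRing.div_surjective (A := R) l
    have := hDR a
    have hb0 : algebraMap R L b ≠ 0 := by simpa using nonZeroDivisors.ne_zero hb
    conv at this => enter [1, 2]; rw [← div_mul_cancel₀ (algebraMap R L a) hb0]
    rw [D.leibniz, hDR b, smul_zero, zero_add] at this
    exact (smul_eq_zero.mp this).resolve_left hb0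
  have : Subsingleton (Ω[L⁄F]) := by
    rw [← Submodule.subsingleton_iff L, ← subsingleton_iff_bot_eq_top,
      ← KaehlerDifferential.span_range_derivation, eq_comm, Submodule.span_eq_bot]
    rintro _ ⟨l, rfl⟩
    exact hDL l
  have : Algebra.FormallyUnramified F L := ⟨this⟩
  have : Algebra.EssFiniteType R L := .of_isLocalization L (nonZeroDivisors R)
  have : Algebra.EssFiniteType K L := .comp K R L
  have : Algebra.EssFiniteType F L := .of_comp K F L
  have : Algebra.IsSeparable F L := Algebra.FormallyUnramified.isSeparable F L
  have : Algebra.IsAlgebraic (Algebra.adjoin K S) L :=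
    IntermediateField.isAlgebraic_adjoin_iff_top.mp inferInstance
  calc Algebra.trdeg K R ≤ Algebra.trdeg K L :=
        trdeg_le_of_injective (IsScalarTower.toAlgHom K R L) (IsFractionRing.injective R L)
    _ ≤ Cardinal.mk S := Algebra.IsAlgebraic.trdeg_le_cardinalMk K S
    _ ≤ n := by
      have := Cardinal.mk_range_le_lift (f := fun i => algebraMap R L (y i))
      simpa using this

end Cotangent

end

/-! ### Linear projections that are finite on a hypersurface. -/

noncomputable section

section Projection

variable {K : Type*} [Field K]

open MvPolynomial

/-- The substitution `X i = v i * T + X' i` with `X' j = 0`: the coordinates of the projection in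
the direction `v`. -/
def MvPolynomial.lineSubst {N : ℕ} (j : Fin (N + 1)) (v : Fin (N + 1) → K) :
    MvPolynomial (Fin (N + 1)) K →ₐ[K] Polynomial (MvPolynomial (Fin N) K) :=
  aeval fun i => Polynomial.C (C (v i)) * Polynomial.X + Polynomial.C
    (j.insertNth (α := fun _ => MvPolynomial (Fin N) K) 0 X i)

/-- Each variable becomes linear in `T` with leading coefficient `v i`, which gives the degree and
the top coefficient. Setting the remaining variables to zero leaves `G(v) * T ^ d`, so the lower
coefficients have no constant term. When `G(v) ≠ 0` this makes a relation `G` into an equation for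
`T` that is monic up to a scalar. -/
theorem MvPolynomial.lineSubst_of_isHomogeneous {N : ℕ} (j : Fin (N + 1)) (v : Fin (N + 1) → K)
    {d : ℕ} {G : MvPolynomial (Fin (N + 1)) K} (hG : G.IsHomogeneous d) :
    (lineSubst j v G).natDegree ≤ d ∧ (lineSubst j v G).coeff d = C (eval v G) ∧
      ∀ l < d, constantCoeff ((lineSubst j v G).coeff l) = 0 := by
  set ψ : Fin (N + 1) → Polynomial (MvPolynomial (Fin N) K) :=
    fun i => Polynomial.C (C (v i)) * Polynomial.X + Polynomial.C
      (j.insertNth (α := fun _ => MvPolynomial (Fin N) K) 0 X i) with hψ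
  set P := lineSubst j v G
  have hmon : ∀ m : Fin (N + 1) →₀ ℕ, (aeval ψ (monomial m (1 : K))).natDegree ≤ m.degree ∧
      (aeval ψ (monomial m (1 : K))).coeff m.degree = C (eval v (monomial m 1)) := by
    intro m
    induction m using Finsupp.induction_linear with
    | zero => simp
    | add f g hf hg =>
      have : monomial (f + g) (1 : K) = monomial f 1 * monomial g 1 := by
        rw [monomial_mul, one_mul]
      rw [this, map_mul, map_mul, map_mul, map_add]
      exact ⟨Polynomial.natDegree_mul_le.trans (add_le_add hf.1 hg.1), by
        rw [Polynomial.coeff_mul_add_eq_of_natDegree_le hf.1 hg.1, hf.2, hg.2]⟩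
    | single i k =>
      have : monomial (Finsupp.single i k) (1 : K) = X i ^ k := by rw [X_pow_eq_monomial]
      have h1 : (ψ i).natDegree ≤ 1 := Polynomial.natDegree_linear_le
      have h2 : (ψ i).coeff 1 = C (v i) := by simp [hψ]
      rw [this, map_pow, map_pow, aeval_X, eval_X, Finsupp.degree_single]
      refine ⟨Polynomial.natDegree_pow_le.trans (by nlinarith), ?_⟩
      have := Polynomial.coeff_pow_of_natDegree_le (m := k) h1
      rw [mul_one] at this
      rw [this, h2, map_pow]
  have hsum : P = ∑ m ∈ G.support, Polynomial.C (C (coeff m G)) * aeval ψ (monomial m (1 : K)) := by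
    conv_lhs => rw [show P = aeval ψ G from rfl, G.as_sum, map_sum]
    refine Finset.sum_congr rfl fun m _ => ?_
    rw [← mul_one (coeff m G), ← C_mul_monomial, map_mul, mul_one]
    simp [algHom_C]
  have hdeg : ∀ m ∈ G.support, m.degree = d := fun m hm => by
    rw [hG.degree_eq_sum_deg_support hm]; rfl
  refine ⟨?_, ?_, ?_⟩
  · rw [hsum]
    refine Polynomial.natDegree_sum_le_of_forall_le _ _ fun m hm => ?_
    exact (Polynomial.natDegree_C_mul_le _ _).trans ((hmon m).1.trans (hdeg m hm).le)
  · rw [hsum, Polynomial.finsetSum_coeff]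
    conv_rhs => rw [G.as_sum, map_sum, map_sum]
    refine Finset.sum_congr rfl fun m hm => ?_
    rw [Polynomial.coeff_C_mul, ← hdeg m hm, (hmon m).2, ← map_mul, ← eval_C (f := v) (coeff m G),
      ← map_mul, C_mul_monomial, mul_one]
    simp
  · intro l hl
    have h1 : P.map (constantCoeff (σ := Fin N) (R := K)) =
        Polynomial.C (aeval v G) * Polynomial.X ^ d := by
      rw [← aeval_C_mul_X_of_isHomogeneous v hG]
      have e : (Polynomial.mapRingHom (constantCoeff (σ := Fin N) (R := K))).comp
        (lineSubst j v).toRingHom = (aeval (R := K) fun i =>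
          Polynomial.C (v i) * Polynomial.X).toRingHom := by
        refine MvPolynomial.ringHom_ext (fun c => ?_) fun i => ?_
        · simp
        · have : constantCoeff (j.insertNth (α := fun _ => MvPolynomial (Fin N) K) 0 X i) = 0 := by
            cases i using j.succAboveCases <;> simp
          simp [lineSubst, this]
      exact congr($e G)
    rw [← Polynomial.coeff_map, h1, Polynomial.coeff_C_mul_X_pow, if_neg hl.ne]

/-- The values are chosen to undo the substitution: with `t = x j / v j` and `x' i = x i - v i * t`,
the point `v * t + x'` is `x`. -/
theorem MvPolynomial.eval₂_lineSubst {R : Type*} [CommRing R] [Algebra K R] {N : ℕ}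
    (j : Fin (N + 1)) (v : Fin (N + 1) → K) (hv : v j ≠ 0) (x : Fin (N + 1) → R)
    (G : MvPolynomial (Fin (N + 1)) K) :
    Polynomial.eval₂ (aeval (R := K) fun i => x (j.succAbove i) -
      v (j.succAbove i) • (v j)⁻¹ • x j).toRingHom ((v j)⁻¹ • x j) (lineSubst j v G) =
      aeval x G := by
  have e : (Polynomial.eval₂RingHom (aeval (R := K) fun i => x (j.succAbove i) -
      v (j.succAbove i) • (v j)⁻¹ • x j).toRingHom ((v j)⁻¹ • x j)).comp
        (lineSubst j v).toRingHom = (aeval (R := K) x).toRingHom := by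
    refine MvPolynomial.ringHom_ext (fun c => ?_) fun i => ?_
    · simp
    · cases i using j.succAboveCases with
      | x => simp [lineSubst, Algebra.smul_def, ← mul_assoc, ← map_mul, hv]
      | p i => simp [lineSubst, Algebra.smul_def]
  exact congr($e G)

variable {R : Type*} [CommRing R] [Algebra K R]

/-- Coordinates adapted to the zero set of `a` at the rational point `ε`: they define a projection
which is unramified at `ε` and finite on the zero set of `a`, and `ε` is the only zero of `a` in its
fibre. -/
structure IsAdapted {N : ℕ} (ε : R →ₐ[K] K) (a : R) (x : Fin N → R) : Prop extends
    SpansCotangent ε x where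
  isIntegral : ((Ideal.Quotient.mkₐ K (Ideal.span {a})).comp (aeval x)).toRingHom.IsIntegral
  ker_le_radical : RingHom.ker ε ≤ (Ideal.span (Set.range x) ⊔ Ideal.span {a}).radical

theorem MvPolynomial.aeval_mem_span_range {N : ℕ} (x : Fin N → R) {p : MvPolynomial (Fin N) K}
    (hp : constantCoeff p = 0) : aeval x p ∈ Ideal.span (Set.range x) := by
  have : p ∈ idealOfVars (Fin N) K := by
    rw [← pow_one (idealOfVars _ _), mem_pow_idealOfVars_iff']
    intro m hm
    have : m = 0 := by simpa [Finsupp.degree_eq_zero_iff] using hm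
    rw [this]; exact hp
  have h2 := Ideal.mem_map_of_mem (aeval (R := K) x) this
  rw [idealOfVars, Ideal.map_span, ← Set.range_comp] at h2
  simpa [Function.comp_def] using h2

/-- One projection step. There are more coordinates than `n`, so they satisfy a homogeneous relation
`G` modulo `a` and a linear relation `lam` modulo the square of the maximal ideal. Project along a
direction `v` on which neither vanishes. Then `G(v) ≠ 0` makes the lost coordinate `t` integral over
the others modulo `a`, and nilpotent modulo `a` and the others; and `∑ lam i * v i ≠ 0` makes it
redundant in the cotangent space. -/
theorem IsAdapted.exists_isAdapted_of_lt [IsDomain R] [Infinite K]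
    {ε : R →ₐ[K] K} [Module.Finite K (RingHom.ker ε).Cotangent]
    {a : R} (ha : a ≠ 0) {n N : ℕ} (hn : Algebra.trdeg K R ≤ n)
    (hn' : Module.finrank K (RingHom.ker ε).Cotangent ≤ n) (hN : n < N + 1)
    {x : Fin (N + 1) → R} (hx : IsAdapted ε a x) :
    ∃ x' : Fin N → R, IsAdapted ε a x' := by
  obtain ⟨d, G, hG0, hG, hGa⟩ := exists_isHomogeneous_aeval_mem_span hn hN x ha
  obtain ⟨lam, hlam0, hlam⟩ := exists_sum_smul_mem_ker_sq hx.eval_eq_zero (hn'.trans_lt hN)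
  -- Over an infinite field the product of two nonzero polynomials has a point where it does not
  -- vanish.
  obtain ⟨v, hvG, hvl⟩ : ∃ v, eval v G ≠ 0 ∧ ∑ i, lam i * v i ≠ 0 := by
    by_contra! h
    have h1 : G * ∑ i, C (lam i) * X i = 0 := MvPolynomial.funext fun v => by
      by_cases hv : eval v G = 0
      · simp [hv]
      · simp [h v hv]
    refine hlam0 (_root_.funext fun i => ?_)
    have h2 := (mul_eq_zero.mp h1).resolve_left hG0
    have h3 := congr(eval (Pi.single i 1) $h2)
    simpa [Pi.single_apply] using h3
  obtain ⟨j, hj⟩ : ∃ j, v j ≠ 0 := by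
    by_contra! h
    exact hvl (by simp [h])
  set t := (v j)⁻¹ • x j with ht
  set x' : Fin N → R := fun i => x (j.succAbove i) - v (j.succAbove i) • t with hx'
  obtain ⟨hP1, hP2, hP3⟩ := lineSubst_of_isHomogeneous j v hG
  have hPt := eval₂_lineSubst j v hj x G
  rw [← ht, ← hx'] at hPt
  set P := lineSubst j v G
  have hxt : ∀ i, x i = v i • t + j.insertNth (α := fun _ => R) 0 x' i := fun i => by
    cases i using j.succAboveCases with
    | x => simp [ht, smul_smul, hj]
    | p i => simp [hx']
  have hεt : ε t = 0 := by simp [ht, hx.eval_eq_zero]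
  have hεx' : ∀ i, ε (x' i) = 0 := fun i => by simp [hx', hx.eval_eq_zero, hεt]
  refine ⟨x', ⟨hεx', fun u hu => ?_⟩, ?_, ?_⟩
  · obtain ⟨c, hc⟩ := hx.exists_sub_mem u hu
    -- Subtracting `e` times the linear relation `lam` cancels the coefficient of `t`.
    set e := (∑ i, c i * v i) / ∑ i, lam i * v i with he
    refine ⟨fun i => c (j.succAbove i) - e * lam (j.succAbove i), ?_⟩
    have h1 := Ideal.add_mem _ hc ((RingHom.ker ε ^ 2).mul_mem_left (algebraMap K R e) hlam)
    convert h1 using 1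
    have h2 : ∀ c : Fin (N + 1) → K, ∑ i, c i • x i =
        (∑ i, c i * v i) • t + ∑ i, c (j.succAbove i) • x' i := by
      intro c
      rw [Fin.sum_univ_succAbove (fun i => c i • x i) j, Fin.sum_univ_succAbove _ j]
      simp only [hxt j, hxt (j.succAbove _), Fin.insertNth_apply_same,
        Fin.insertNth_apply_succAbove, add_zero, smul_add, Finset.sum_add_distrib, add_smul,
        smul_smul, ← Finset.sum_smul]
      ring
    rw [h2 c, h2 lam]
    simp only [sub_smul, Finset.sum_sub_distrib, mul_smul, ← Finset.smul_sum, ← Algebra.smul_def,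
      smul_add]
    rw [smul_smul e, he, div_mul_cancel₀ _ hvl]
    abel
  · set q := Ideal.Quotient.mkₐ K (Ideal.span {a})
    set f := (q.comp (aeval x')).toRingHom with hf
    have hft : f.IsIntegralElem (q t) := by
      refine ⟨Polynomial.C (C (eval v G)⁻¹) * P,
        Polynomial.monic_of_natDegree_le_of_coeff_eq_one d
          ((Polynomial.natDegree_C_mul_le _ _).trans hP1) ?_, ?_⟩
      · rw [Polynomial.coeff_C_mul, hP2, ← map_mul, inv_mul_cancel₀ hvG, map_one]
      · have : Polynomial.eval₂ f (q t) P = 0 := by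
          have := Polynomial.hom_eval₂ P (aeval (R := K) x').toRingHom q.toRingHom t
          rw [hPt] at this
          exact this.symm.trans (Ideal.Quotient.eq_zero_iff_mem.mpr hGa)
        rw [Polynomial.eval₂_mul, this, mul_zero]
    have hfx : ∀ i, f.IsIntegralElem (q (x i)) := fun i => by
      rw [hxt, map_add, map_smul]
      refine RingHom.IsIntegralElem.add _ ?_ ?_
      · have : (v i) • q t = f (C (v i)) * q t := by simp [hf, Algebra.smul_def, algHom_C]
        rw [this]
        exact RingHom.IsIntegralElem.mul _ (RingHom.isIntegralElem_map _) hft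
      · cases i using j.succAboveCases with
        | x => simpa using RingHom.isIntegralElem_zero _
        | p i => simpa [hf] using RingHom.isIntegralElem_map f (x := X i)
    intro s
    algebraize [f]
    -- Polynomials in the old coordinates take values in the integral closure `U`, so an element
    -- integral over them is integral over `U`, and transitivity applies.
    let U := integralClosure (MvPolynomial (Fin N) K) (R ⧸ Ideal.span {a})
    let ψ : MvPolynomial (Fin (N + 1)) K →+* U :=
      eval₂Hom ((algebraMap (MvPolynomial (Fin N) K) U).comp C) fun i => ⟨q (x i), hfx i⟩
    have hψ : (algebraMap U (R ⧸ Ideal.span {a})).comp ψ = (q.comp (aeval x)).toRingHom := by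
      refine MvPolynomial.ringHom_ext (fun c => ?_) fun i => ?_
      · have : algebraMap (MvPolynomial (Fin N) K) (R ⧸ Ideal.span {a}) (C c) = f (C c) := rfl
        simp [ψ, ← IsScalarTower.algebraMap_apply, this, hf, algHom_C]
      · simp [ψ]
    obtain ⟨p, hp, hp'⟩ := hx.isIntegral s
    refine isIntegral_trans (A := U) s ⟨p.map ψ, hp.map ψ, ?_⟩
    rw [Polynomial.eval₂_map, hψ]
    exact hp'
  -- In `G(x) = ∑ P_l * t ^ l` the coefficients with `l < d` lie in the ideal of the `x' i`, and
  -- `G(x)` lies in `(a)`; what remains is `G(v) * t ^ d`.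
  · have hJ : t ^ d ∈ Ideal.span (Set.range x') ⊔ Ideal.span {a} := by
      have h1 : aeval x G - eval v G • t ^ d ∈ Ideal.span (Set.range x') := by
        rw [← hPt, Polynomial.eval₂_eq_sum_range' _ (Nat.lt_succ_of_le hP1), Finset.sum_range_succ,
          hP2]
        simp only [AlgHom.toRingHom_eq_coe, RingHom.coe_coe, algHom_C, ← Algebra.smul_def,
          add_sub_cancel_right]
        exact Ideal.sum_mem _ fun l hl => Ideal.mul_mem_right _ _
          (aeval_mem_span_range x' (hP3 l (Finset.mem_range.mp hl)))
      have h2 := Ideal.sub_mem _ (Submodule.mem_sup_right (S := Ideal.span (Set.range x')) hGa)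
        (Submodule.mem_sup_left (T := Ideal.span {a}) h1)
      rw [sub_sub_cancel, Algebra.smul_def] at h2
      have h3 := Ideal.mul_mem_left _ (algebraMap K R (eval v G)⁻¹) h2
      rwa [← mul_assoc, ← map_mul, inv_mul_cancel₀ hvG, map_one, one_mul] at h3
    have ht' : t ∈ (Ideal.span (Set.range x') ⊔ Ideal.span {a}).radical := ⟨d, hJ⟩
    refine hx.ker_le_radical.trans (Ideal.radical_le_radical_iff.mpr (sup_le ?_
      (le_sup_right.trans Ideal.le_radical)))
    rw [Ideal.span_le]
    rintro _ ⟨i, rfl⟩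
    rw [hxt, Algebra.smul_def]
    refine Ideal.add_mem _ (Ideal.mul_mem_left _ _ ht') (Ideal.le_radical ?_)
    refine Ideal.mem_sup_left ?_
    cases i using j.succAboveCases with
    | x => simp
    | p i => simpa using Ideal.subset_span (Set.mem_range_self i)

/-- Taylor expansion to first order at the origin: `p * X i` agrees with `p(0) * X i` modulo the
square of the maximal ideal. -/
theorem SpansCotangent.of_surjective {N : ℕ} {ε : R →ₐ[K] K} {x : Fin N → R}
    (hx : ∀ i, ε (x i) = 0) (hsurj : Function.Surjective (aeval (R := K) x)) :
    SpansCotangent ε x := by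
  have hε : ∀ p : MvPolynomial (Fin N) K, ε (aeval x p) = constantCoeff p := fun p => by
    have : ε.comp (aeval x) = aeval 0 := MvPolynomial.algHom_ext fun i => by simp [hx]
    rw [← AlgHom.comp_apply, this]
    exact aeval_zero p
  have key : ∀ p : MvPolynomial (Fin N) K, ∃ c : Fin N → K,
      aeval x p - algebraMap K R (constantCoeff p) - ∑ i, c i • x i ∈ RingHom.ker ε ^ 2 := by
    intro p
    induction p using MvPolynomial.induction_on with
    | C c => exact ⟨0, by simp⟩
    | add p q hp hq =>
      obtain ⟨c, hc⟩ := hp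
      obtain ⟨c', hc'⟩ := hq
      refine ⟨c + c', ?_⟩
      convert Ideal.add_mem _ hc hc' using 1
      simp only [map_add, Pi.add_apply, add_smul, Finset.sum_add_distrib]
      abel
    | mul_X p i hp =>
      refine ⟨Pi.single i (constantCoeff p), ?_⟩
      have : aeval x (p * X i) - algebraMap K R (constantCoeff (p * X i)) -
          ∑ l, (Pi.single i (constantCoeff p) : Fin N → K) l • x l =
          (aeval x p - algebraMap K R (constantCoeff p)) * x i := by
        simp [Pi.single_apply, sub_mul, ite_smul, ← Algebra.smul_def]
      rw [this, pow_two]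
      exact Ideal.mul_mem_mul (by simp [RingHom.mem_ker, hε]) (hx i)
  refine ⟨hx, fun u hu => ?_⟩
  obtain ⟨p, rfl⟩ := hsurj u
  obtain ⟨c, hc⟩ := key p
  rw [hε] at hu
  exact ⟨c, by simpa [hu] using hc⟩

theorem exists_isAdapted_of_finiteType [Algebra.FiniteType K R] (ε : R →ₐ[K] K) (a : R) :
    ∃ (N : ℕ) (x : Fin N → R), IsAdapted ε a x := by
  obtain ⟨N, f, hf⟩ := Algebra.FiniteType.iff_quotient_mvPolynomial''.mp
    (inferInstance : Algebra.FiniteType K R)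
  let x : Fin N → R := fun i => f (X i) - algebraMap K R (ε (f (X i)))
  have hx : ∀ i, ε (x i) = 0 := fun i => by simp [x]
  have hsurj : Function.Surjective (aeval (R := K) x) := by
    intro r
    obtain ⟨p, rfl⟩ := hf r
    refine ⟨aeval (fun i => X i + C (ε (f (X i)))) p, ?_⟩
    have : (aeval (R := K) x).comp (aeval fun i => X i + C (ε (f (X i)))) = f :=
      MvPolynomial.algHom_ext fun i => by simp [x, algHom_C]
    exact congr($this p)
  refine ⟨N, x, SpansCotangent.of_surjective hx hsurj, ?_, ?_⟩
  · exact RingHom.isIntegral_of_surjective _ (Ideal.Quotient.mk_surjective.comp hsurj)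
  · intro u hu
    obtain ⟨p, rfl⟩ := hsurj u
    refine Ideal.le_radical (Ideal.mem_sup_left (aeval_mem_span_range x ?_))
    have : ε.comp (aeval x) = aeval 0 := MvPolynomial.algHom_ext fun i => by simp [hx]
    rw [RingHom.mem_ker, ← AlgHom.comp_apply, this] at hu
    exact (aeval_zero p).symm.trans hu

/-- Start with translated generators of the algebra and project until their number is the dimension
of the cotangent space. That dimension also bounds the transcendence degree, so both relations
needed for a projection exist at every stage. -/
theorem exists_isAdapted [IsDomain R] [Infinite K] [Algebra.FiniteType K R]
    (ε : R →ₐ[K] K) {a : R} (ha : a ≠ 0) :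
    ∃ x : Fin (Module.finrank K (RingHom.ker ε).Cotangent) → R, IsAdapted ε a x := by
  obtain ⟨N, x, hx⟩ := exists_isAdapted_of_finiteType ε a
  have : Module.Finite K (RingHom.ker ε).Cotangent :=
    ⟨top_le_iff.mp hx.span_toCotangent ▸ Submodule.fg_span (Set.finite_range _)⟩
  obtain ⟨y, hy⟩ := exists_spansCotangent (ε := ε)
  have hn := hy.trdeg_le
  have hN : Module.finrank K (RingHom.ker ε).Cotangent ≤ N := by
    have h := finrank_range_le_card (R := K)
      (b := fun i => (RingHom.ker ε).toCotangent ⟨x i, hx.eval_eq_zero i⟩)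
    rwa [Set.finrank, top_le_iff.mp hx.span_toCotangent, finrank_top, Fintype.card_fin] at h
  obtain ⟨m, rfl⟩ := Nat.exists_eq_add_of_le hN
  induction m with
  | zero => exact ⟨x, hx⟩
  | succ m ih =>
    obtain ⟨x', hx'⟩ := hx.exists_isAdapted_of_lt ha hn le_rfl
      (Nat.lt_succ_of_le (Nat.le_add_right _ _))
    exact ih x' hx' (Nat.le_add_right _ _)

/-- Near the point, `a = 0` embeds in the affine space of the coordinates. Indeed `R ⧸ (a)` is a
finite module over the polynomial ring, and its fibre over the origin is the single reduced point
`ε`; by Nakayama it is generated by `1` after inverting a polynomial `b'` with constant term `1`. -/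
theorem IsAdapted.exists_mul_sub_mem [Algebra.FiniteType K R] {ε : R →ₐ[K] K} {a : R}
    {N : ℕ} {x : Fin N → R} (hx : IsAdapted ε a x) (r : R) :
    ∃ b b' : MvPolynomial (Fin N) K, constantCoeff b' = 1 ∧
      aeval x b' * r - aeval x b ∈ Ideal.span {a} := by
  have hfin := hx.isIntegral
  set f := ((Ideal.Quotient.mkₐ K (Ideal.span {a})).comp (aeval x)).toRingHom
  have : IsNoetherianRing R := Algebra.FiniteType.isNoetherianRing K R
  -- The fibre is reduced. Since `ker ε` lies in the ideal of the coordinates plus its own square,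
  -- it lies in that ideal plus any of its powers; and some power lies in the ideal of the
  -- coordinates and `a`.
  have hker : RingHom.ker ε ≤ Ideal.span (Set.range x) ⊔ Ideal.span {a} := by
    obtain ⟨k, hk⟩ := Ideal.exists_pow_le_of_le_radical_of_fg hx.ker_le_radical
      (IsNoetherian.noetherian _)
    have : ∀ k, RingHom.ker ε ≤ Ideal.span (Set.range x) ⊔ RingHom.ker ε ^ (k + 1) := by
      intro k
      induction k with
      | zero => simp
      | succ k ih =>
        intro u hu
        obtain ⟨c, hc⟩ := hx.exists_sub_mem u hu
        have h1 : RingHom.ker ε ^ 2 ≤ Ideal.span (Set.range x) ⊔ RingHom.ker ε ^ (k + 1 + 1) := by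
          rw [pow_two]
          refine (Ideal.mul_mono_right ih).trans ?_
          rw [Ideal.mul_sup, ← pow_succ']
          exact sup_le_sup_right Ideal.mul_le_right _
        rw [← sub_add_cancel u (∑ i, c i • x i)]
        refine Ideal.add_mem _ (h1 hc) (Ideal.mem_sup_left (Ideal.sum_mem _ fun i _ => ?_))
        rw [Algebra.smul_def]
        exact Ideal.mul_mem_left _ _ (Ideal.subset_span (Set.mem_range_self i))
    refine (this k).trans (sup_le le_sup_left ((Ideal.pow_le_pow_right (by omega)).trans hk))
  algebraize [f]
  have : Module.Finite (MvPolynomial (Fin N) K) (R ⧸ Ideal.span {a}) := by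
    have : Algebra.FiniteType (MvPolynomial (Fin N) K) (R ⧸ Ideal.span {a}) := by
      have : IsScalarTower K (MvPolynomial (Fin N) K) (R ⧸ Ideal.span {a}) :=
        .of_algebraMap_eq' (by ext c; change _ = f (C c); simp [f, algHom_C])
      exact Algebra.FiniteType.of_restrictScalars_finiteType K _ _
    have : Algebra.IsIntegral (MvPolynomial (Fin N) K) (R ⧸ Ideal.span {a}) := ⟨hfin⟩
    exact Algebra.IsIntegral.finite
  have hX : ∀ i, f (X i) = Ideal.Quotient.mk _ (x i) := fun i => by simp [f]
  -- The cokernel of the polynomial ring in `R ⧸ (a)`; Nakayama is applied to it at the origin.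
  let Q := (R ⧸ Ideal.span {a}) ⧸ Submodule.span (MvPolynomial (Fin N) K) {(1 : R ⧸ Ideal.span {a})}
  let π : R → Q := fun r => Submodule.Quotient.mk (Ideal.Quotient.mk _ r)
  have hle : (⊤ : Submodule (MvPolynomial (Fin N) K) Q) ≤
      RingHom.ker (constantCoeff (σ := Fin N) (R := K)) • ⊤ := by
    rintro q -
    obtain ⟨q, rfl⟩ := Submodule.Quotient.mk_surjective _ q
    obtain ⟨r, rfl⟩ := Ideal.Quotient.mk_surjective q
    obtain ⟨v, hv, w, hw, hvw⟩ := Submodule.mem_sup.mp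
      (hker (show r - algebraMap K R (ε r) ∈ RingHom.ker ε by simp [RingHom.mem_ker]))
    have hr : π r = π v := by
      refine (Submodule.Quotient.eq _).mpr (Submodule.mem_span_singleton.mpr ⟨C (ε r), ?_⟩)
      rw [Algebra.smul_def, mul_one, ← map_sub]
      have : r - v = algebraMap K R (ε r) + w := by
        linear_combination -hvw
      rw [this, map_add, Ideal.Quotient.eq_zero_iff_mem.mpr hw, add_zero]
      change f (C _) = _
      simp [f, algHom_C]
    change π r ∈ _
    rw [hr]
    obtain ⟨w, rfl⟩ := (Ideal.mem_span_range_iff_exists_fun).mp hv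
    have h1 : π (∑ i, w i * x i) = ∑ i, (X i : MvPolynomial (Fin N) K) • π (w i) := by
      have h2 : ∀ i, (X i : MvPolynomial (Fin N) K) • π (w i) =
          Submodule.Quotient.mk (Ideal.Quotient.mk _ (w i * x i)) := fun i => by
        change Submodule.Quotient.mk (_ • _) = _
        rw [Algebra.smul_def, map_mul, mul_comm]
        exact congrArg (fun z => Submodule.Quotient.mk (_ * z)) (hX i)
      simp only [h2, π, map_sum]
      exact map_sum (Submodule.mkQ _) _ _
    rw [h1]
    exact Submodule.sum_mem _ fun i _ =>
      Submodule.smul_mem_smul (by simp [RingHom.mem_ker]) trivial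
  obtain ⟨b', hb', h⟩ :=
    Submodule.exists_sub_one_mem_and_smul_eq_zero_of_fg_of_le_smul _ _ Module.Finite.fg_top hle
  have h1 : b' • Submodule.Quotient.mk (Ideal.Quotient.mk _ r) = (0 : Q) := h (π r) trivial
  rw [← Submodule.Quotient.mk_smul, Submodule.Quotient.mk_eq_zero,
    Submodule.mem_span_singleton] at h1
  obtain ⟨b, hb⟩ := h1
  refine ⟨b, b', ?_, ?_⟩
  · rwa [RingHom.mem_ker, map_sub, map_one, sub_eq_zero] at hb'
  · rw [← Ideal.Quotient.eq_zero_iff_mem, map_sub, map_mul, sub_eq_zero]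
    rw [Algebra.smul_def, Algebra.smul_def, mul_one] at hb
    exact hb.symm

end Projection

end

/-! ### Orders of vanishing in a smooth algebra and in the polynomial ring. -/

noncomputable section

section Factorial

variable {K : Type*} [Field K] {R : Type*} [CommRing R] [Algebra K R] {ε : R →ₐ[K] K}

open MvPolynomial

theorem MvPolynomial.ker_constantCoeff {σ : Type*} :
    RingHom.ker (constantCoeff (σ := σ) (R := K)) = idealOfVars σ K := by
  ext p
  rw [← pow_one (idealOfVars _ _), mem_pow_idealOfVars_iff', RingHom.mem_ker]
  refine ⟨fun h m hm => ?_, fun h => h 0 (by simp)⟩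
  have : m = 0 := by simpa [Finsupp.degree_eq_zero_iff] using hm
  rw [this]; exact h

theorem MvPolynomial.eval_point_aeval {n : ℕ} {x : Fin n → R} (hx : ∀ i, ε (x i) = 0)
    (p : MvPolynomial (Fin n) K) : ε (aeval x p) = constantCoeff p := by
  have : ε.comp (aeval x) = aeval 0 := MvPolynomial.algHom_ext fun i => by simp [hx]
  rw [← AlgHom.comp_apply, this]
  exact aeval_zero p

/-- As many spanning vectors as the dimension form a basis, so the linear part of `b` can only
vanish in the cotangent space if all its coefficients are zero. -/
theorem SpansCotangent.mem_sq_of_aeval_mem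
    {x : Fin (Module.finrank K (RingHom.ker ε).Cotangent) → R} (hx : SpansCotangent ε x)
    {b : MvPolynomial (Fin (Module.finrank K (RingHom.ker ε).Cotangent)) K}
    (hb : aeval x b ∈ RingHom.ker ε ^ 2) : b ∈ idealOfVars _ K ^ 2 := by
  classical
  have h0 : constantCoeff b = 0 := by
    rw [← eval_point_aeval hx.eval_eq_zero]
    exact Ideal.pow_le_self two_ne_zero hb
  have h1 : b - ∑ i, C (coeff (Finsupp.single i 1) b) * X i ∈ idealOfVars _ K ^ 2 := by
    rw [mem_pow_idealOfVars_iff']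
    intro m hm
    obtain hm | hm : m.degree = 0 ∨ m.degree = 1 := by omega
    · rw [Finsupp.degree_eq_zero_iff] at hm
      subst hm
      rw [coeff_sub, coeff_sum, ← constantCoeff_eq, h0]
      simp [constantCoeff_eq]
    · obtain ⟨i, rfl⟩ : ∃ i, m = Finsupp.single i 1 := by
        simpa using (Finsupp.sum_eq_one_iff m).mp hm
      rw [coeff_sub, coeff_sum]
      simp [coeff_C_mul, coeff_X, Finsupp.single_left_inj]
  have h2 : aeval x (b - ∑ i, C (coeff (Finsupp.single i 1) b) * X i) ∈ RingHom.ker ε ^ 2 := by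
    have := Ideal.mem_map_of_mem (aeval (R := K) x) h1
    rw [Ideal.map_pow] at this
    refine Ideal.pow_right_mono ?_ 2 this
    rw [Ideal.map_le_iff_le_comap, ← ker_constantCoeff]
    intro p hp
    rw [Ideal.mem_comap, RingHom.mem_ker, eval_point_aeval hx.eval_eq_zero]
    exact hp
  have h3 := Ideal.sub_mem _ hb h2
  rw [map_sub, sub_sub_cancel, map_sum] at h3
  have h4 := hx.eq_zero_of_sum_mem (c := fun i => coeff (Finsupp.single i 1) b)
    (by simpa [Algebra.smul_def, algHom_C] using h3)
  have h5 : ∀ i, coeff (Finsupp.single i 1) b = 0 := congrFun h4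
  simpa [h5] using h1

/-- Formal smoothness lifts `R → R ⧸ 𝔪²` to a map `σ` into the polynomial ring modulo `n ^ (k + 2)`.
Composed with the coordinates, `σ` is the identity to first order, hence on every quotient `n ^ d /
n ^ (d + 1)`. It kills `𝔪 ^ (k + 2)` and sends `s` to a unit, so it kills `b`, which then climbs
through the powers of `n`. The exponent is at least `2` so that the truncated polynomial ring maps
to `R ⧸ 𝔪²`. -/
theorem SpansCotangent.mem_pow_of_mul_aeval_mem [Algebra.FormallySmooth K R]
    {x : Fin (Module.finrank K (RingHom.ker ε).Cotangent) → R} (hx : SpansCotangent ε x) {k : ℕ}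
    {b : MvPolynomial (Fin (Module.finrank K (RingHom.ker ε).Cotangent)) K} {s : R} (hs : ε s ≠ 0)
    (hb : s * aeval x b ∈ RingHom.ker ε ^ (k + 2)) : b ∈ idealOfVars _ K ^ (k + 2) := by
  set n := idealOfVars (Fin (Module.finrank K (RingHom.ker ε).Cotangent)) K with hn
  let g₀ := (Ideal.Quotient.mkₐ K (RingHom.ker ε ^ 2)).comp (aeval x)
  have hg₀ : ∀ b, g₀ b = Ideal.Quotient.mk _ (aeval x b) := fun _ => rfl
  have hker : ∀ b, g₀ b = 0 → b ∈ n ^ 2 := fun b hb =>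
    hx.mem_sq_of_aeval_mem (Ideal.Quotient.eq_zero_iff_mem.mp hb)
  have hnm : n.map (aeval (R := K) x) ≤ RingHom.ker ε := by
    rw [Ideal.map_le_iff_le_comap, hn, ← ker_constantCoeff]
    intro p hp
    rw [Ideal.mem_comap, RingHom.mem_ker, eval_point_aeval hx.eval_eq_zero]
    exact hp
  have hg₀' : ∀ b ∈ n ^ (k + 2), g₀ b = 0 := fun b hb => by
    rw [hg₀, Ideal.Quotient.eq_zero_iff_mem]
    have := Ideal.mem_map_of_mem (aeval (R := K) x) hb
    rw [Ideal.map_pow] at this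
    exact Ideal.pow_le_pow_right (by omega) (Ideal.pow_right_mono hnm _ this)
  have hsurj₀ : Function.Surjective g₀ := by
    intro r
    obtain ⟨r, rfl⟩ := Ideal.Quotient.mk_surjective r
    obtain ⟨c, hc⟩ := hx.exists_sub_mem (r - algebraMap K R (ε r)) (by simp)
    refine ⟨C (ε r) + ∑ i, C (c i) * X i, ?_⟩
    rw [hg₀, eq_comm, Ideal.Quotient.eq]
    simpa [algHom_C, Algebra.smul_def, sub_sub] using hc
  let T := MvPolynomial (Fin (Module.finrank K (RingHom.ker ε).Cotangent)) K ⧸ n ^ (k + 2)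
  let mk : MvPolynomial (Fin (Module.finrank K (RingHom.ker ε).Cotangent)) K →ₐ[K] T :=
    Ideal.Quotient.mkₐ K _
  have hmk : Function.Surjective mk := Ideal.Quotient.mk_surjective
  let g : T →ₐ[K] R ⧸ RingHom.ker ε ^ 2 := Ideal.Quotient.liftₐ _ g₀ hg₀'
  have hg : ∀ b, g (mk b) = g₀ b := fun b => rfl
  have hsurj : Function.Surjective g := fun r => by
    obtain ⟨b, hb⟩ := hsurj₀ r
    exact ⟨mk b, hb⟩
  have hnil : (n.map mk) ^ (k + 2) = ⊥ := by
    rw [← Ideal.map_pow]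
    exact Ideal.map_quotient_self _
  have hgnil : IsNilpotent (RingHom.ker (g : T →+* R ⧸ RingHom.ker ε ^ 2)) := by
    refine ⟨k + 2, ?_⟩
    rw [Ideal.zero_eq_bot, ← le_bot_iff, ← hnil]
    refine Ideal.pow_right_mono ?_ _
    intro t ht
    obtain ⟨b, rfl⟩ := hmk t
    exact Ideal.mem_map_of_mem _ (Ideal.pow_le_self two_ne_zero (hker b ht))
  let σ : R →ₐ[K] T := Algebra.FormallySmooth.liftOfSurjective (AlgHom.id K _ |>.comp
    (Ideal.Quotient.mkₐ K (RingHom.ker ε ^ 2))) g hsurj hgnil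
  have hσ : ∀ r, g (σ r) = Ideal.Quotient.mk _ r := fun r =>
    Algebra.FormallySmooth.liftOfSurjective_apply _ g hsurj hgnil r
  have hσ' : ∀ r b, σ r = mk b → constantCoeff b = ε r := fun r b hb => by
    have h := hσ r
    rw [hb, hg, hg₀, Ideal.Quotient.eq] at h
    have := Ideal.pow_le_self two_ne_zero h
    rwa [RingHom.mem_ker, map_sub, eval_point_aeval hx.eval_eq_zero, sub_eq_zero] at this
  have hσm : (RingHom.ker ε).map σ ≤ n.map mk := by
    rw [Ideal.map_le_iff_le_comap]
    intro u hu
    obtain ⟨b, hb⟩ := hmk (σ u)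
    rw [Ideal.mem_comap, ← hb]
    refine Ideal.mem_map_of_mem _ ?_
    rw [hn, ← ker_constantCoeff, RingHom.mem_ker, hσ' u b hb.symm]
    exact hu
  set τ : MvPolynomial (Fin (Module.finrank K (RingHom.ker ε).Cotangent)) K →ₐ[K] T :=
    σ.comp (aeval x)
  have hτX : ∀ i, τ (X i) - mk (X i) ∈ (n ^ 2).map mk := fun i => by
    obtain ⟨b, hb⟩ := hmk (σ (x i))
    have : τ (X i) = mk b := by simp [τ, hb]
    rw [this, ← map_sub]
    refine Ideal.mem_map_of_mem _ (hker _ ?_)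
    have h := hσ (x i)
    rw [← hb, hg] at h
    rw [map_sub, h, hg₀, aeval_X, sub_self]
  have hτn : n.map τ ≤ n.map mk := by
    rw [Ideal.map_le_iff_le_comap]
    intro b hb
    exact hσm (Ideal.mem_map_of_mem σ (hnm (Ideal.mem_map_of_mem _ hb)))
  have hτ0 : ∀ b, τ b - mk b ∈ n.map mk := fun b => by
    obtain ⟨b', hb'⟩ := hmk (τ b)
    rw [← hb', ← map_sub]
    refine Ideal.mem_map_of_mem _ ?_
    rw [hn, ← ker_constantCoeff, RingHom.mem_ker, map_sub, hσ' (aeval x b) b' hb'.symm,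
      eval_point_aeval hx.eval_eq_zero, sub_self]
  have hτ1 : ∀ u ∈ n, τ u - mk u ∈ (n ^ 2).map mk := by
    intro u hu
    refine Submodule.span_induction ?_ ?_ ?_ ?_ hu
    · rintro _ ⟨i, rfl⟩
      exact hτX i
    · simp
    · intro p q _ _ hp hq
      rw [map_add, map_add, add_sub_add_comm]
      exact Ideal.add_mem _ hp hq
    · intro w p hp h
      have : τ (w • p) - mk (w • p) = τ w * (τ p - mk p) + (τ w - mk w) * mk p := by
        simp only [smul_eq_mul, map_mul]; ring
      rw [this]
      refine Ideal.add_mem _ (Ideal.mul_mem_left _ _ h) ?_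
      rw [Ideal.map_pow, pow_two]
      exact Ideal.mul_mem_mul (hτ0 w) (Ideal.mem_map_of_mem _ hp)
  -- Write `τ(pq) - pq = τ p (τ q - q) + (τ p - p) q` with `p ∈ n` and `q ∈ n ^ d`: the first term
  -- gains an order from `q`, the second from `p`.
  have hτ : ∀ d, ∀ b ∈ n ^ d, τ b - mk b ∈ (n ^ (d + 1)).map mk := by
    intro d
    induction d with
    | zero => intro b _; simpa using hτ0 b
    | succ d ih =>
      intro b hb
      rw [pow_succ'] at hb
      refine Submodule.mul_induction_on hb (fun p hp q hq => ?_) fun p q hp hq => ?_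
      · have e₁ : (n ^ (d + 1 + 1)).map mk = n.map mk * (n ^ (d + 1)).map mk := by
          rw [← Ideal.map_mul, ← pow_succ']
        have e₂ : (n ^ (d + 1 + 1)).map mk = (n ^ 2).map mk * (n ^ d).map mk := by
          rw [← Ideal.map_mul, ← pow_add, add_comm 2 d]
        have : τ (p * q) - mk (p * q) = τ p * (τ q - mk q) + (τ p - mk p) * mk q := by
          simp only [map_mul]; ring
        rw [this]
        refine Ideal.add_mem _ ?_ ?_
        · rw [e₁]
          exact Ideal.mul_mem_mul (hτn (Ideal.mem_map_of_mem _ hp)) (ih q hq)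
        · rw [e₂]
          exact Ideal.mul_mem_mul (hτ1 p hp) (Ideal.mem_map_of_mem _ hq)
      · rw [map_add, map_add, add_sub_add_comm]
        exact Ideal.add_mem _ hp hq
  have hσs : IsUnit (σ s) := by
    obtain ⟨b, hb⟩ := hmk (σ s)
    have h1 : IsNilpotent (mk (b - C (ε s))) := by
      refine ⟨k + 2, ?_⟩
      have : mk (b - C (ε s)) ∈ n.map mk := Ideal.mem_map_of_mem _ (by
        rw [hn, ← ker_constantCoeff, RingHom.mem_ker, map_sub, hσ' s b hb.symm]; simp)
      have := Ideal.pow_mem_pow this (k + 2)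
      rwa [hnil] at this
    have h2 : IsUnit (mk (C (ε s))) := (hs.isUnit.map C).map mk
    rw [← hb, ← sub_add_cancel b (C (ε s)), map_add]
    exact h1.isUnit_add_right_of_commute h2 (Commute.all _ _)
  have hτb : τ b = 0 := by
    refine hσs.mul_right_eq_zero.mp ?_
    have := Ideal.pow_right_mono hσm (k + 2) (by
      rw [← Ideal.map_pow]; exact Ideal.mem_map_of_mem σ hb)
    rw [hnil, Ideal.mem_bot, map_mul] at this
    exact this
  have : ∀ d ≤ k + 2, b ∈ n ^ d := by
    intro d
    induction d with
    | zero => simp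
    | succ d ih =>
      intro hd
      have h := hτ d b (ih (by omega))
      rw [hτb, zero_sub, neg_mem_iff] at h
      obtain ⟨c, hc, hcb⟩ := (Ideal.mem_map_iff_of_surjective _ hmk).mp h
      rw [← sub_sub_cancel c b]
      exact Ideal.sub_mem _ hc (Ideal.pow_le_pow_right hd (Ideal.Quotient.eq.mp hcb))
  exact this _ le_rfl

end Factorial

end

/-! ### Weierstrass preparation and factoriality. -/

noncomputable section

section Factorial

variable {K : Type*} [Field K] {R : Type*} [CommRing R] [Algebra K R] {ε : R →ₐ[K] K}

open MvPolynomial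

variable {A : Type*} [CommRing A] [Algebra R A] [(RingHom.ker ε).IsPrime]
  [IsLocalization.AtPrime A (RingHom.ker ε)]

theorem isUnit_algebraMap_of_eval_ne_zero (ε : R →ₐ[K] K) [(RingHom.ker ε).IsPrime]
    [IsLocalization.AtPrime A (RingHom.ker ε)] {s : R} (hs : ε s ≠ 0) :
    IsUnit (algebraMap R A s) :=
  IsLocalization.map_units A (⟨s, hs⟩ : (RingHom.ker ε).primeCompl)

/-- Nakayama: generators modulo the square of the maximal ideal generate it in the local ring. -/
theorem SpansCotangent.map_ker_eq [IsNoetherianRing R] {N : ℕ} {x : Fin N → R}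
    (hx : SpansCotangent ε x) :
    (RingHom.ker ε).map (algebraMap R A) = Ideal.span (Set.range fun i => algebraMap R A (x i)) := by
  have hA : IsLocalRing A := IsLocalization.AtPrime.isLocalRing A (RingHom.ker ε)
  have hm : (RingHom.ker ε).map (algebraMap R A) = IsLocalRing.maximalIdeal A :=
    IsLocalization.AtPrime.map_eq_maximalIdeal (RingHom.ker ε) A
  have hspan : Ideal.span (Set.range fun i => algebraMap R A (x i)) =
      (Ideal.span (Set.range x)).map (algebraMap R A) := by
    rw [Ideal.map_span, ← Set.range_comp]; rfl
  rw [hspan]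
  refine le_antisymm ?_ (Ideal.map_mono ?_)
  · refine Submodule.le_of_le_smul_of_le_jacobson_bot (I := (RingHom.ker ε).map (algebraMap R A))
      (Ideal.FG.map (IsNoetherian.noetherian (RingHom.ker ε)) _) ?_ ?_
    · rw [IsLocalRing.jacobson_eq_maximalIdeal _ bot_ne_top, hm]
    · rw [smul_eq_mul, ← Ideal.map_mul, ← Ideal.map_sup]
      refine Ideal.map_mono fun u hu => ?_
      obtain ⟨c, hc⟩ := hx.exists_sub_mem u hu
      rw [← add_sub_cancel (∑ i, c i • x i) u]
      refine Submodule.add_mem_sup (Ideal.sum_mem _ fun i _ => ?_) (by rwa [← pow_two])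
      rw [Algebra.smul_def]
      exact Ideal.mul_mem_left _ _ (Ideal.subset_span (Set.mem_range_self i))
  · rw [Ideal.span_le]
    rintro _ ⟨i, rfl⟩
    exact hx.eval_eq_zero i

/-- The residue field is `K` and the coordinates generate the maximal ideal, so subtracting the
value and dividing by coordinates can be repeated. -/
theorem SpansCotangent.exists_sub_aeval_mem_pow [IsNoetherianRing R] {N : ℕ} {x : Fin N → R}
    (hx : SpansCotangent ε x) (k : ℕ) (w : A) :
    ∃ c : MvPolynomial (Fin N) K,
      w - algebraMap R A (aeval x c) ∈ (RingHom.ker ε).map (algebraMap R A) ^ k := by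
  induction k generalizing w with
  | zero => exact ⟨0, by simp⟩
  | succ k ih =>
    obtain ⟨κ, hκ⟩ : ∃ κ : K, w - algebraMap R A (algebraMap K R κ) ∈
        (RingHom.ker ε).map (algebraMap R A) := by
      obtain ⟨r, s, rfl⟩ := IsLocalization.exists_mk'_eq (RingHom.ker ε).primeCompl w
      have hs : ε s.1 ≠ 0 := s.2
      refine ⟨ε r / ε s, ?_⟩
      rw [← Ideal.unit_mul_mem_iff_mem _ (isUnit_algebraMap_of_eval_ne_zero (A := A) ε hs), mul_sub,
        mul_comm, IsLocalization.mk'_spec, ← map_mul, ← map_sub]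
      refine Ideal.mem_map_of_mem _ ?_
      simp [RingHom.mem_ker, mul_div_cancel₀ _ hs]
    rw [hx.map_ker_eq, Ideal.mem_span_range_iff_exists_fun] at hκ
    obtain ⟨w', hw'⟩ := hκ
    choose c hc using fun i => ih (w' i)
    refine ⟨C κ + ∑ i, X i * c i, ?_⟩
    have : w - algebraMap R A (aeval x (C κ + ∑ i, X i * c i)) =
        ∑ i, algebraMap R A (x i) * (w' i - algebraMap R A (aeval x (c i))) := by
      rw [eq_add_of_sub_eq hw'.symm]
      simp only [map_add, map_sum, map_mul, aeval_X, algHom_C, mul_sub, Finset.sum_sub_distrib,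
        mul_comm (w' _)]
      abel
    rw [this, pow_succ']
    refine Ideal.sum_mem _ fun i _ => Ideal.mul_mem_mul (Ideal.mem_map_of_mem _ ?_) (hc i)
    exact hx.eval_eq_zero i

/-- Approximate the quotient by a polynomial `c` to high order; comparing orders of vanishing puts
`b - l * c` in a high power of `n`. So `b` is in `(l) + n ^ k` for every `k`, and Krull's
intersection theorem in the domain of polynomials modulo `l` concludes. The condition `l(0) = 0`
keeps the image of `n` proper there. -/
theorem SpansCotangent.dvd_of_dvd [IsNoetherianRing R] [Algebra.FormallySmooth K R]
    {x : Fin (Module.finrank K (RingHom.ker ε).Cotangent) → R} (hx : SpansCotangent ε x)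
    {l b : MvPolynomial (Fin (Module.finrank K (RingHom.ker ε).Cotangent)) K} (hl : Prime l)
    (hl0 : constantCoeff l = 0)
    (h : algebraMap R A (aeval x l) ∣ algebraMap R A (aeval x b)) : l ∣ b := by
  obtain ⟨w, hw⟩ := h
  set n := idealOfVars (Fin (Module.finrank K (RingHom.ker ε).Cotangent)) K with hn
  have key : ∀ k, b ∈ Ideal.span {l} ⊔ n ^ k := by
    intro k
    obtain ⟨c, hc⟩ := hx.exists_sub_aeval_mem_pow (k + 2) w
    have h1 := Ideal.mul_mem_left _ (algebraMap R A (aeval x l)) hc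
    rw [mul_sub, ← hw, ← map_mul, ← map_mul, ← map_sub, ← map_sub, ← Ideal.map_pow,
      IsLocalization.algebraMap_mem_map_algebraMap_iff (RingHom.ker ε).primeCompl] at h1
    obtain ⟨s, hs, h1⟩ := h1
    have h2 := hx.mem_pow_of_mul_aeval_mem (s := s) hs h1
    rw [← add_sub_cancel (l * c) b]
    exact Submodule.add_mem_sup (Ideal.mul_mem_right _ _ (Ideal.mem_span_singleton_self l))
      (Ideal.pow_le_pow_right (by omega) h2)
  have : (Ideal.span {l}).IsPrime := (Ideal.span_singleton_prime hl.ne_zero).mpr hl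
  have hne : n.map (Ideal.Quotient.mk (Ideal.span {l})) ≠ ⊤ := by
    rw [hn, ← ker_constantCoeff]
    intro h
    have h2 := congr(($h).comap (Ideal.Quotient.mk (Ideal.span {l})))
    rw [Ideal.comap_map_of_surjective _ Ideal.Quotient.mk_surjective, Ideal.comap_top,
      ← RingHom.ker_eq_comap_bot, Ideal.mk_ker, sup_eq_left.mpr] at h2
    · exact RingHom.ker_ne_top _ h2
    · rwa [Ideal.span_singleton_le_iff_mem]
  have h3 := Ideal.iInf_pow_eq_bot_of_isDomain _ hne
  rw [← Ideal.mem_span_singleton, ← Ideal.Quotient.eq_zero_iff_mem, ← Ideal.mem_bot, ← h3,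
    Ideal.mem_iInf]
  intro k
  obtain ⟨p, hp, q, hq, hpq⟩ := Submodule.mem_sup.mp (key k)
  rw [← hpq, map_add, Ideal.Quotient.eq_zero_iff_mem.mpr hp, zero_add, ← Ideal.map_pow]
  exact Ideal.mem_map_of_mem _ hq

/-- Numerator and denominator of `u` are both polynomials modulo `a`, up to factors with constant
term `1`. The polynomial `d` replacing the denominator has nonzero constant term because `ε a = 0`.
-/
theorem IsAdapted.exists_mul_eq_add [Algebra.FiniteType K R] {a : R} (ha : ε a = 0) {N : ℕ}
    {x : Fin N → R} (hx : IsAdapted ε a x) (u : A) :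
    ∃ (b b' : MvPolynomial (Fin N) K) (w : A), constantCoeff b' ≠ 0 ∧
      algebraMap R A (aeval x b') * u = algebraMap R A (aeval x b) + algebraMap R A a * w := by
  obtain ⟨r, s, rfl⟩ := IsLocalization.exists_mk'_eq (RingHom.ker ε).primeCompl u
  have hs : ε s.1 ≠ 0 := s.2
  obtain ⟨b, b', hb', h⟩ := hx.exists_mul_sub_mem r
  obtain ⟨d, d', hd', h'⟩ := hx.exists_mul_sub_mem s.1
  obtain ⟨w, hw⟩ := Ideal.mem_span_singleton.mp h
  obtain ⟨w', hw'⟩ := Ideal.mem_span_singleton.mp h'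
  have hd : constantCoeff d ≠ 0 := by
    rw [← eval_point_aeval hx.eval_eq_zero, ← sub_sub_cancel (aeval x d' * s.1) (aeval x d), hw']
    simpa [ha, eval_point_aeval hx.eval_eq_zero, hd'] using hs
  have e := IsLocalization.mk'_spec' A r s
  have hw := congr(algebraMap R A $hw)
  have hw' := congr(algebraMap R A $hw')
  simp only [map_sub, map_mul] at hw hw'
  refine ⟨b * d', b' * d, algebraMap R A (aeval x d') * algebraMap R A w -
    algebraMap R A (aeval x b') * algebraMap R A w' * IsLocalization.mk' A r s, ?_, ?_⟩
  · rw [map_mul, hb', one_mul]; exact hd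
  · simp only [map_mul]
    linear_combination algebraMap R A (aeval x d') * hw -
      algebraMap R A (aeval x b') * IsLocalization.mk' A r s * hw' +
      algebraMap R A (aeval x d') * algebraMap R A (aeval x b') * e

/-- A Weierstrass preparation theorem: up to a unit of the local ring, `a` is a polynomial in
adapted coordinates. -/
theorem IsAdapted.exists_mul_isUnit_eq [Algebra.FiniteType K R] {a : R} (ha : ε a = 0)
    {N : ℕ} {x : Fin N → R} (hx : IsAdapted ε a x) :
    ∃ (b : MvPolynomial (Fin N) K) (v : A), IsUnit v ∧
      algebraMap R A a * v = algebraMap R A (aeval x b) := by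
  have : IsNoetherianRing R := Algebra.FiniteType.isNoetherianRing K R
  have hA : IsLocalRing A := IsLocalization.AtPrime.isLocalRing A (RingHom.ker ε)
  have hm : (RingHom.ker ε).map (algebraMap R A) = IsLocalRing.maximalIdeal A :=
    IsLocalization.AtPrime.map_eq_maximalIdeal (RingHom.ker ε) A
  have ha' := Ideal.mem_map_of_mem (algebraMap R A) (show a ∈ RingHom.ker ε from ha)
  rw [hx.map_ker_eq, Ideal.mem_span_range_iff_exists_fun] at ha'
  obtain ⟨u, hu⟩ := ha'
  -- In `a = ∑ u i * x i` every `u i` is replaced by a polynomial `b i`, up to the factor `b' i` and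
  -- a multiple of `a`. The multiples of `a` so produced have coefficients in the maximal ideal;
  -- moved to the other side, they change the unit `∏ b' j` into another unit.
  choose b b' w hb' hw using fun i => hx.exists_mul_eq_add ha (u i)
  have hβ : ∀ i, (∏ j, b' j) = (∏ j ∈ Finset.univ.erase i, b' j) * b' i := fun i =>
    (Finset.prod_erase_mul _ _ (Finset.mem_univ i)).symm
  refine ⟨∑ i, X i * (∏ j ∈ Finset.univ.erase i, b' j) * b i,
    algebraMap R A (aeval x (∏ j, b' j)) - ∑ i, algebraMap R A (x i) *
      algebraMap R A (aeval x (∏ j ∈ Finset.univ.erase i, b' j)) * w i, ?_, ?_⟩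
  · have h1 : IsUnit (algebraMap R A (aeval x (∏ j, b' j))) := by
      refine isUnit_algebraMap_of_eval_ne_zero ε ?_
      rw [eval_point_aeval hx.eval_eq_zero, map_prod]
      exact Finset.prod_ne_zero_iff.mpr fun i _ => hb' i
    have h2 : ∑ i, algebraMap R A (x i) *
        algebraMap R A (aeval x (∏ j ∈ Finset.univ.erase i, b' j)) * w i ∈
        IsLocalRing.maximalIdeal A := by
      rw [← hm]
      refine Ideal.sum_mem _ fun i _ => Ideal.mul_mem_right _ _ (Ideal.mul_mem_right _ _
        (Ideal.mem_map_of_mem _ (hx.eval_eq_zero i)))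
    by_contra h
    rw [← mem_nonunits_iff, ← IsLocalRing.mem_maximalIdeal] at h
    have := Ideal.add_mem _ h h2
    rw [sub_add_cancel] at this
    exact this h1
  · have h3 : algebraMap R A a * algebraMap R A (aeval x (∏ j, b' j)) =
        ∑ i, algebraMap R A (x i) * algebraMap R A (aeval x (∏ j ∈ Finset.univ.erase i, b' j)) *
          (algebraMap R A (aeval x (b i)) + algebraMap R A a * w i) := by
      conv_lhs => enter [1]; rw [← hu]
      rw [Finset.sum_mul]
      refine Finset.sum_congr rfl fun i _ => ?_
      rw [← hw i, hβ i, map_mul, map_mul]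
      ring
    rw [mul_sub, h3, map_sum, map_sum, Finset.mul_sum, ← Finset.sum_sub_distrib]
    refine Finset.sum_congr rfl fun i _ => ?_
    simp only [map_mul, aeval_X]
    ring

/-- The local ring of a smooth variety at a rational point is factorial. -/
theorem uniqueFactorizationMonoid_of_smooth [Infinite K] [IsDomain R] [Algebra.Smooth K R]
    (ε : R →ₐ[K] K) [(RingHom.ker ε).IsPrime] [IsLocalization.AtPrime A (RingHom.ker ε)]
    [IsDomain A] : UniqueFactorizationMonoid A := by
  have : Algebra.FiniteType K R := inferInstance
  have : IsNoetherianRing R := Algebra.FiniteType.isNoetherianRing K R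
  have hA : IsLocalRing A := IsLocalization.AtPrime.isLocalRing A (RingHom.ker ε)
  have hm : (RingHom.ker ε).map (algebraMap R A) = IsLocalRing.maximalIdeal A :=
    IsLocalization.AtPrime.map_eq_maximalIdeal (RingHom.ker ε) A
  -- Kaplansky's criterion: each nonzero prime ideal must contain a prime element. It will be an
  -- irreducible factor of the polynomial equivalent to some `a` in the ideal.
  rw [UniqueFactorizationMonoid.iff_exists_prime_mem_of_isPrime]
  intro I hI0 hI
  obtain ⟨u, hu, hu0⟩ := Submodule.exists_mem_ne_zero_of_ne_bot hI0
  obtain ⟨a, s, rfl⟩ := IsLocalization.exists_mk'_eq (RingHom.ker ε).primeCompl u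
  have haI : algebraMap R A a ∈ I := by
    rw [← IsLocalization.mk'_spec A a s]
    exact I.mul_mem_right _ hu
  have ha0 : algebraMap R A a ≠ 0 := fun h => hu0 (by
    have := IsLocalization.mk'_spec A a s
    rw [h] at this
    exact (mul_eq_zero.mp this).resolve_right (IsLocalization.map_units A s).ne_zero)
  have hε : ∀ r, algebraMap R A r ∈ I → ε r = 0 := fun r hr => by
    by_contra h
    exact hI.ne_top (I.eq_top_of_isUnit_mem hr (isUnit_algebraMap_of_eval_ne_zero ε h))
  have ha : ε a = 0 := hε a haI
  obtain ⟨x, hx⟩ := exists_isAdapted ε (a := a) (fun h => ha0 (by rw [h, map_zero]))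
  obtain ⟨b, v, hv, hb⟩ := hx.exists_mul_isUnit_eq (A := A) ha
  have hb0 : algebraMap R A (aeval x b) ≠ 0 := by
    rw [← hb]; exact mul_ne_zero ha0 hv.ne_zero
  let φ : MvPolynomial (Fin (Module.finrank K (RingHom.ker ε).Cotangent)) K →+* A :=
    (algebraMap R A).comp (aeval (R := K) x).toRingHom
  have hφ : ∀ p, φ p = algebraMap R A (aeval x p) := fun _ => rfl
  have hbI : b ∈ I.comap φ := by
    rw [Ideal.mem_comap, hφ, ← hb]
    exact I.mul_mem_right _ haI
  have hbne : b ≠ 0 := fun h => hb0 (by rw [h, map_zero, map_zero])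
  obtain ⟨l, hl, hlb, hlI⟩ : ∃ l, Prime l ∧ l ∣ b ∧ l ∈ I.comap φ := by
    obtain ⟨f, hf, e⟩ := UniqueFactorizationMonoid.exists_prime_factors b hbne
    have : f.prod ∈ I.comap φ := by
      obtain ⟨u, hu⟩ := e.symm
      rw [← hu]
      exact Ideal.mul_mem_right _ _ hbI
    obtain ⟨l, hl, hlI⟩ := (Ideal.IsPrime.multiset_prod_mem_iff_exists_mem inferInstance f).mp this
    exact ⟨l, hf l hl, (Multiset.dvd_prod hl).trans e.dvd, hlI⟩
  have hl0 : constantCoeff l = 0 := by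
    rw [← eval_point_aeval hx.eval_eq_zero]
    exact hε _ hlI
  have hla : φ l ∣ algebraMap R A a := by
    rw [← hv.dvd_mul_right, hb, ← hφ]
    exact map_dvd φ hlb
  refine ⟨φ l, hlI, fun h => hb0 ?_, fun h => hI.ne_top (I.eq_top_of_isUnit_mem hlI h), ?_⟩
  · rw [← hφ]
    exact zero_dvd_iff.mp (h ▸ map_dvd φ hlb)
  -- Up to units and multiples of `a`, which `l` divides, both factors are polynomials; so the
  -- question is one about the prime `l` of the polynomial ring.
  · intro y z hyz
    obtain ⟨d, d', w, hd', hw⟩ := hx.exists_mul_eq_add (A := A) ha y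
    obtain ⟨e, e', w', he', hw'⟩ := hx.exists_mul_eq_add (A := A) ha z
    have h1 : φ l ∣ φ (d * e) := by
      have : φ (d * e) = φ d' * φ e' * (y * z) - algebraMap R A a *
          (w * φ e' * z + φ d * w') := by
        simp only [← hφ] at hw hw'
        rw [map_mul]
        linear_combination φ e' * z * (-hw) - φ d * hw'
      rw [this]
      exact dvd_sub (hyz.mul_left _) (hla.mul_right _)
    have h2 : ∀ (d d' : MvPolynomial _ K) (w y : A), constantCoeff d' ≠ 0 →
        algebraMap R A (aeval x d') * y = algebraMap R A (aeval x d) + algebraMap R A a * w →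
        l ∣ d → φ l ∣ y := by
      intro d d' w y hd' hw hld
      have hu : IsUnit (algebraMap R A (aeval x d')) := by
        refine isUnit_algebraMap_of_eval_ne_zero ε ?_
        rwa [eval_point_aeval hx.eval_eq_zero]
      rw [← hu.dvd_mul_left, hw]
      exact dvd_add (map_dvd φ hld) (hla.mul_right _)
    rcases hl.dvd_or_dvd (hx.toSpansCotangent.dvd_of_dvd hl hl0 h1) with h | h
    · exact .inl (h2 d d' w y hd' hw h)
    · exact .inr (h2 e e' w' z he' hw' h)

end Factorial

end

/-! ### Complements of affine open subsets are locally principal. -/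

noncomputable section

section Purity

theorem UniqueFactorizationMonoid.exists_gcd {A : Type*} [CommRing A] [IsDomain A]
    [UniqueFactorizationMonoid A] (s : Finset A) :
    ∃ g : A, (∀ j ∈ s, g ∣ j) ∧ ∀ d, (∀ j ∈ s, d ∣ j) → d ∣ g := by
  classical
  have := UniqueFactorizationMonoid.toGCDMonoid A
  induction s using Finset.induction_on with
  | empty => exact ⟨0, by simp, by simp⟩
  | insert a s _ ih =>
    obtain ⟨g, h1, h2⟩ := ih
    refine ⟨gcd a g, ?_, fun d hd => dvd_gcd (hd a (by simp)) (h2 d fun j hj => hd j (by simp [hj]))⟩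
    intro j hj
    rcases Finset.mem_insert.mp hj with rfl | hj
    · exact gcd_dvd_left _ _
    · exact (gcd_dvd_right _ _).trans (h1 j hj)

theorem UniqueFactorizationMonoid.exists_dvd_pow {A : Type*} [CommRing A] [IsDomain A]
    [UniqueFactorizationMonoid A] {g v : A} (hv : v ≠ 0) (h : ∀ l, Prime l → l ∣ v → l ∣ g) :
    ∃ k, v ∣ g ^ k := by
  induction v using UniqueFactorizationMonoid.induction_on_prime with
  | h₁ => exact absurd rfl hv
  | h₂ x hx => exact ⟨0, hx.dvd⟩
  | h₃ a p ha hp ih =>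
    obtain ⟨k, hk⟩ := ih ha fun l hl hla => h l hl (hla.mul_left _)
    exact ⟨k + 1, by rw [pow_succ']; exact mul_dvd_mul (h p hp (dvd_mul_right _ _)) hk⟩

/-- If the complement of the zero locus of a radical ideal `J` is affine, with coordinate ring `B`,
then `J` is principal near every point at which the local ring is factorial. -/
theorem Ideal.exists_isPrincipal_near_of_map_eq_top {R A B : Type*} [CommRing R] [IsDomain R]
    [CommRing A] [Algebra R A] [IsDomain A] [UniqueFactorizationMonoid A] [CommRing B] [IsDomain B] [Algebra R B]
    (m : Ideal R) [m.IsPrime] [IsLocalization.AtPrime A m] {J : Ideal R} (hfg : J.FG)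
    (hrad : J.IsRadical) (hJ0 : J ≠ ⊥) (hinj : Function.Injective (algebraMap R B))
    (hB : ∀ j ∈ J, ∀ b : B, ∃ e r, algebraMap R B j ^ e * b = algebraMap R B r)
    (htop : J.map (algebraMap R B) = ⊤) :
    ∃ s ∉ m, ∃ g ≠ 0, s * g ∈ J ∧ ∀ j ∈ J, g ∣ s * j := by
  classical
  have hA : Function.Injective (algebraMap R A) :=
    IsLocalization.injective A m.primeCompl_le_nonZeroDivisors
  obtain ⟨t, rfl⟩ := hfg
  obtain ⟨f, hf, hf0⟩ := Submodule.exists_mem_ne_zero_of_ne_bot hJ0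
  -- The greatest common divisor of the generators in the factorial ring `A`; up to a unit it comes
  -- from an element `g` of `R`.
  obtain ⟨g₀, hg₀, hg₀'⟩ := UniqueFactorizationMonoid.exists_gcd (t.image (algebraMap R A))
  obtain ⟨g, s₀, rfl⟩ := IsLocalization.exists_mk'_eq m.primeCompl g₀
  have hs₀ : IsUnit (algebraMap R A s₀) := IsLocalization.map_units A s₀
  have hgs := IsLocalization.mk'_spec A g s₀
  have hdvd : ∀ j ∈ Ideal.span (t : Set R), algebraMap R A g ∣ algebraMap R A j := by
    have : Ideal.span (t : Set R) ≤ (Ideal.span {algebraMap R A g}).comap (algebraMap R A) := by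
      rw [Ideal.span_le]
      intro j hj
      rw [SetLike.mem_coe, Ideal.mem_comap, Ideal.mem_span_singleton, ← hgs, hs₀.mul_right_dvd]
      exact hg₀ _ (Finset.mem_image_of_mem _ hj)
    exact fun j hj => Ideal.mem_span_singleton.mp (this hj)
  have hgcd : ∀ d, (∀ j ∈ Ideal.span (t : Set R), d ∣ algebraMap R A j) → d ∣ algebraMap R A g := by
    intro d hd
    rw [← hgs, hs₀.dvd_mul_right]
    refine hg₀' d fun j hj => ?_
    obtain ⟨i, hi, rfl⟩ := Finset.mem_image.mp hj
    exact hd i (Ideal.subset_span hi)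
  have hg0 : g ≠ 0 := by
    rintro rfl
    have := hdvd f hf
    rw [map_zero, zero_dvd_iff] at this
    exact hf0 (hA (by rw [this, map_zero]))
  -- every function on the complement has a power of `g` as denominator
  have hden : ∀ b : B, ∃ s ∉ m, ∃ k r, algebraMap R B (s * g ^ k) * b = algebraMap R B r := by
    intro b
    obtain ⟨k, r, hr⟩ := hB f hf b
    have hfk : algebraMap R A (f ^ k) ≠ 0 := by
      rw [Ne, map_eq_zero_iff _ hA]; exact pow_ne_zero _ hf0
    obtain ⟨v, w, c, hcop, hv, hw⟩ :=
      UniqueFactorizationMonoid.exists_reduced_factors (algebraMap R A (f ^ k)) hfk (algebraMap R A r)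
    have hc0 : c ≠ 0 := by rintro rfl; rw [zero_mul] at hv; exact hfk hv.symm
    have hv0 : v ≠ 0 := by rintro rfl; rw [mul_zero] at hv; exact hfk hv.symm
    -- Let `w / v` be `b` in lowest terms over `A`. Each `j ∈ J` provides another denominator `j ^
    -- e` of `b`, so `v` divides `j ^ e`. Every prime factor of `v` therefore divides all of `J`,
    -- hence `g`, and `v` divides a power of `g`.
    have hvj : ∀ j ∈ Ideal.span (t : Set R), ∃ e, v ∣ algebraMap R A j ^ e := by
      intro j hj
      obtain ⟨e, r', hr'⟩ := hB j hj b
      refine ⟨e, hcop.dvd_of_dvd_mul_right ⟨algebraMap R A r', ?_⟩⟩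
      have h1 : j ^ e * r = r' * f ^ k := hinj (by
        simp only [map_mul, map_pow, ← hr, ← hr']; ring)
      apply mul_left_cancel₀ hc0
      have := congr(algebraMap R A $h1)
      rw [map_mul, map_mul, ← hv, ← hw, map_pow] at this
      linear_combination this
    obtain ⟨M, hM⟩ := UniqueFactorizationMonoid.exists_dvd_pow (g := algebraMap R A g) hv0
      fun l hl hlv => hgcd l fun j hj => by
        obtain ⟨e, he⟩ := hvj j hj
        exact hl.dvd_of_dvd_pow (hlv.trans he)
    obtain ⟨q, hq⟩ := hM
    obtain ⟨a, s, ha⟩ := IsLocalization.exists_mk'_eq m.primeCompl (q * w)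
    refine ⟨s, s.2, M, a, ?_⟩
    have h2 := IsLocalization.mk'_spec A a s
    have h3 : s * g ^ M * r = a * f ^ k := hA (by
      simp only [map_mul, map_pow] at hv hw ⊢
      rw [← h2, ha, hq, ← hv, ← hw]; ring)
    have hreg : algebraMap R B f ^ k ≠ 0 := by
      rw [← map_pow, Ne, map_eq_zero_iff _ hinj]; exact pow_ne_zero _ hf0
    apply mul_left_cancel₀ hreg
    rw [mul_left_comm, hr, ← map_mul, h3, map_mul, map_pow]
    ring
  -- so `g` lies in the radical of the localization of `J`
  have hmem : ∃ s ∉ m, s * g ∈ Ideal.span (t : Set R) := by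
    have key : ∀ y ∈ Ideal.map (algebraMap R B) (Ideal.span (t : Set R)), ∃ s ∉ m, ∃ k,
        ∃ r ∈ Ideal.span (t : Set R), algebraMap R B (s * g ^ k) * y = algebraMap R B r := by
      intro y hy
      induction hy using Submodule.span_induction with
      | mem y hy =>
        obtain ⟨j, hj, rfl⟩ := hy
        exact ⟨1, fun h => Ideal.IsPrime.ne_top inferInstance ((Ideal.eq_top_iff_one m).mpr h), 0, j,
          hj, by simp⟩
      | zero => exact ⟨1, fun h => Ideal.IsPrime.ne_top inferInstance
          ((Ideal.eq_top_iff_one m).mpr h), 0, 0, zero_mem _, by simp⟩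
      | add y z _ _ hy hz =>
        obtain ⟨s, hs, k, r, hr, h⟩ := hy
        obtain ⟨s', hs', k', r', hr', h'⟩ := hz
        refine ⟨s * s', fun H => (Ideal.IsPrime.mem_or_mem inferInstance H).elim hs hs', k + k',
          s' * g ^ k' * r + s * g ^ k * r', Ideal.add_mem _ (Ideal.mul_mem_left _ _ hr)
            (Ideal.mul_mem_left _ _ hr'), ?_⟩
        simp only [map_mul, map_pow, map_add, ← h, ← h'] at h h' ⊢
        ring
      | smul b y _ hy =>
        obtain ⟨s, hs, k, r, hr, h⟩ := hy
        obtain ⟨s', hs', k', r', h'⟩ := hden b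
        refine ⟨s * s', fun H => (Ideal.IsPrime.mem_or_mem inferInstance H).elim hs hs', k + k',
          r' * r, Ideal.mul_mem_left _ _ hr, ?_⟩
        simp only [map_mul, map_pow, ← h, ← h', smul_eq_mul]
        ring
    -- Since `J` generates the unit ideal of `B`, the claim applies to `1` and gives `s * g ^ k ∈
    -- J`; radicality removes the exponent.
    obtain ⟨s, hs, k, r, hr, h⟩ := key 1 (htop ▸ trivial)
    rw [mul_one] at h
    obtain rfl := hinj h
    refine ⟨s, hs, hrad ⟨k + 1, ?_⟩⟩
    rw [mul_pow, show s ^ (k + 1) * g ^ (k + 1) = (s ^ k * g) * (s * g ^ k) by ring]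
    exact Ideal.mul_mem_left _ _ hr
  obtain ⟨s, hs, hsg⟩ := hmem
  -- The quotients of the finitely many generators by `g` exist in `A`; the product of their
  -- denominators clears them all.
  have key : ∃ s' ∉ m, ∀ j ∈ t, g ∣ s' * j := by
    have : ∀ j ∈ t, ∃ s' ∉ m, g ∣ s' * j := fun j hj => by
      obtain ⟨w, hw⟩ := hdvd j (Ideal.subset_span hj)
      obtain ⟨a, s, rfl⟩ := IsLocalization.exists_mk'_eq m.primeCompl w
      refine ⟨s, s.2, a, hA ?_⟩
      rw [map_mul, hw, map_mul, ← IsLocalization.mk'_spec A a s]; ring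
    choose! σ h1 h2 using this
    refine ⟨∏ j ∈ t, σ j, fun H => ?_, fun j hj => ?_⟩
    · obtain ⟨j, hj, h⟩ := (Ideal.IsPrime.prod_mem_iff (p := m)).mp H
      exact h1 j hj h
    · rw [← Finset.mul_prod_erase t σ hj, mul_right_comm]
      exact (h2 j hj).mul_right _
  obtain ⟨s', hs', h'⟩ := key
  refine ⟨s * s', fun H => (Ideal.IsPrime.mem_or_mem inferInstance H).elim hs hs', g, hg0, ?_, ?_⟩
  · rw [mul_right_comm]; exact Ideal.mul_mem_right _ _ hsg
  · have : Ideal.span (t : Set R) ≤ (Ideal.span {g}).colon {s'} := by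
      rw [Ideal.span_le]
      intro j hj
      rw [SetLike.mem_coe, Submodule.mem_colon_singleton, smul_eq_mul, mul_comm, Ideal.mem_span_singleton]
      exact h' j hj
    intro j hj
    have := this hj
    rw [Submodule.mem_colon_singleton, smul_eq_mul, mul_comm, Ideal.mem_span_singleton] at this
    rw [mul_assoc]
    exact this.mul_left _

end Purity

end

noncomputable section

/-! ### The complement of an affine open subset -/

theorem exists_algHom_ker_eq {K R : Type*} [Field K] [IsAlgClosed K] [CommRing R] [Algebra K R]
    [Algebra.FiniteType K R] (m : Ideal R) [hm : m.IsMaximal] :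
    ∃ ε : R →ₐ[K] K, RingHom.ker ε = m := by
  let _ := Ideal.Quotient.field m
  have : Module.Finite K (R ⧸ m) := finite_of_finite_type_of_isJacobsonRing _ _
  let e := AlgEquiv.ofBijective (Algebra.ofId K (R ⧸ m))
    (IsAlgClosed.algebraMap_bijective_of_isIntegral (k := K) (K := R ⧸ m))
  refine ⟨e.symm.toAlgHom.comp (Ideal.Quotient.mkₐ K m), ?_⟩
  ext r
  simp [RingHom.mem_ker, Ideal.Quotient.eq_zero_iff_mem]

theorem uniqueFactorizationMonoid_localization_of_smooth {K R : Type*} [Field K] [IsAlgClosed K]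
    [CommRing R] [IsDomain R] [Algebra K R] [Algebra.Smooth K R] (m : Ideal R) [hm : m.IsMaximal] :
    UniqueFactorizationMonoid (Localization.AtPrime m) := by
  have : Infinite K := IsAlgClosed.instInfinite
  obtain ⟨ε, rfl⟩ := exists_algHom_ker_eq (K := K) m
  have : IsDomain (Localization.AtPrime (RingHom.ker ε)) :=
    IsLocalization.isDomain_localization (Ideal.primeCompl_le_nonZeroDivisors _)
  exact uniqueFactorizationMonoid_of_smooth ε

namespace Sprays

variable {K : Type u} [Field K] {X : Scheme.{u}} (π : X ⟶ Spec (.of K))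

/-- The structure map from `K` to the functions on an open subset. -/
def const (W : X.Opens) : K →+* Γ(X, W) :=
  ((Scheme.ΓSpecIso (.of K)).inv ≫ π.appLE ⊤ W le_top).hom

theorem smooth_const [Smooth π] {W : X.Opens} (hW : IsAffineOpen W) : (const π W).Smooth := by
  rw [const, CommRingCat.hom_comp]
  exact .comp (.of_bijective (ConcreteCategory.bijective_of_isIso (Scheme.ΓSpecIso (.of K)).inv))
    (π.smooth_appLE (isAffineOpen_top _) hW le_top)

theorem finiteType_const [LocallyOfFiniteType π] {W : X.Opens} (hW : IsAffineOpen W) :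
    (const π W).FiniteType := by
  rw [const, CommRingCat.hom_comp]
  exact .comp (LocallyOfFiniteType.finiteType_appLE π (isAffineOpen_top _) hW le_top)
    (.of_surjective _ (ConcreteCategory.bijective_of_isIso (Scheme.ΓSpecIso (.of K)).inv).2)

theorem isSeparated_scheme {Y S : Scheme.{u}} [IsAffine S] (f : Y ⟶ S) [IsSeparated f] :
    Y.IsSeparated := by
  have : terminal.from Y = f ≫ terminal.from S := Subsingleton.elim _ _
  exact ⟨this ▸ inferInstance⟩

/-- A subset of a scheme of finite type containing a neighbourhood of every closed point
is everything. -/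
theorem eq_top_of_closedPoints_subset [LocallyOfFiniteType π] {U : X.Opens}
    (h : ∀ x : X, IsClosed {x} → x ∈ U) : U = ⊤ := by
  have : JacobsonSpace X := LocallyOfFiniteType.jacobsonSpace π
  by_contra hU
  obtain ⟨x, hx, hx'⟩ := nonempty_inter_closedPoints (Z := (U : Set X)ᶜ) (by
    rw [Set.nonempty_compl]; exact fun h => hU (TopologicalSpace.Opens.ext h))
    U.isOpen.isClosed_compl.isLocallyClosed
  exact hx (h x hx')

/-- The complement of an open subset as a reduced closed subscheme. -/
def boundary (V : X.Opens) : X.IdealSheafData := .vanishingIdeal V.compl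

theorem compl_boundary (V : X.Opens) : compl (boundary V) = V := by
  ext x
  simp [compl, boundary]

theorem radical_boundary (V : X.Opens) : (boundary V).radical = boundary V := by
  rw [← Scheme.IdealSheafData.vanishingIdeal_support]
  exact congr_arg _ (SetLike.coe_injective (by simp [boundary]))

theorem mem_compl_iff {D : X.IdealSheafData} {W : X.affineOpens} {x : X} (hx : x ∈ W.1) :
    x ∈ compl D ↔ ∃ f ∈ D.ideal W, x ∈ X.basicOpen f := by
  change x ∉ D.support ↔ _
  simp [Scheme.IdealSheafData.mem_support_iff_of_mem hx, Scheme.mem_zeroLocus_iff]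

theorem basicOpen_le_compl {D : X.IdealSheafData} {W : X.affineOpens} {f : Γ(X, W)}
    (hf : f ∈ D.ideal W) : X.basicOpen f ≤ compl D := fun _ hx =>
  (mem_compl_iff (X.basicOpen_le f hx)).mpr ⟨f, hf, hx⟩

theorem ideal_eq_top {D : X.IdealSheafData} {W : X.affineOpens} (hW : W.1 ≤ compl D) :
    D.ideal W = ⊤ := by
  rw [← (D.ideal W).span_eq, ← IsAffineOpen.self_le_iSup_basicOpen_iff W.2]
  intro x hx
  obtain ⟨f, hf, h⟩ := (mem_compl_iff hx).mp (hW hx)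
  exact TopologicalSpace.Opens.mem_iSup.mpr ⟨⟨f, hf⟩, h⟩

/-- On the basic open subset of `s` the factor `s` is a unit, and the two hypotheses become the two
inclusions. -/
theorem ideal_affineBasicOpen_eq_span {D : X.IdealSheafData} {W : X.affineOpens} {s g : Γ(X, W)}
    (hsg : s * g ∈ D.ideal W) (hg : ∀ j ∈ D.ideal W, g ∣ s * j) :
    D.ideal (X.affineBasicOpen s) =
      Ideal.span {X.presheaf.map (homOfLE (X.basicOpen_le s)).op g} := by
  let ρ := (X.presheaf.map (homOfLE (X.basicOpen_le s)).op).hom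
  have hu : IsUnit (ρ s) := RingedSpace.isUnit_res_basicOpen X.toRingedSpace s
  rw [← Scheme.IdealSheafData.map_ideal_basicOpen]
  apply le_antisymm
  · refine Ideal.map_le_iff_le_comap.mpr fun j hj => ?_
    refine Ideal.mem_comap.mpr ((Ideal.unit_mul_mem_iff_mem _ hu).mp ?_)
    exact Ideal.mem_span_singleton.mpr ((map_mul ρ s j) ▸ map_dvd ρ (hg j hj))
  · refine (Ideal.span_singleton_le_iff_mem _).mpr ((Ideal.unit_mul_mem_iff_mem _ hu).mp ?_)
    exact (map_mul ρ s g) ▸ Ideal.mem_map_of_mem ρ hsg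

/-- Having a local equation is an open condition, so closed points suffice. There smoothness makes
the local ring factorial, and in an affine neighbourhood `W` the trace `V ⊓ W` is affine because `X`
is separated, so the ideal of the boundary is principal nearby. -/
theorem isEffectiveDivisor_boundary [IsAlgClosed K] [IsIntegral X] [IsSeparated π] [Smooth π]
    {V : X.Opens} (hV : IsAffineOpen V) (hne : (V : Set X).Nonempty) :
    IsEffectiveDivisor (boundary V) := by
  have hX : X.IsSeparated := isSeparated_scheme π
  have : IsLocallyNoetherian X := LocallyOfFiniteType.isLocallyNoetherian π
  let U : X.Opens := ⟨{y | ∃ W : X.affineOpens, y ∈ W.1 ∧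
    ∃ f ∈ nonZeroDivisors Γ(X, W), (boundary V).ideal W = Ideal.span {f}}, by
      rw [isOpen_iff_forall_mem_open]
      rintro y ⟨W, hy, h⟩
      exact ⟨W.1, fun z hz => ⟨W, hz, h⟩, W.1.isOpen, hy⟩⟩
  suffices U = ⊤ from fun y => (this ▸ trivial : y ∈ U)
  refine eq_top_of_closedPoints_subset π fun y hy => ?_
  obtain ⟨_, ⟨W, hW, rfl⟩, hyW, -⟩ :=
    X.isBasis_affineOpens.exists_subset_of_mem_open (Set.mem_univ y) isOpen_univ
  have hW' : Nonempty W := ⟨⟨y, hyW⟩⟩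
  obtain ⟨z, hzW, hzV⟩ : ((W : Set X) ∩ V).Nonempty :=
    nonempty_preirreducible_inter W.isOpen V.isOpen ⟨y, hyW⟩ hne
  have hVW : Nonempty (V ⊓ W : X.Opens) := ⟨⟨z, hzV, hzW⟩⟩
  let J := (boundary V).ideal ⟨W, hW⟩
  let m := (hW.primeIdealOf ⟨y, hyW⟩).asIdeal
  have hm : m.IsMaximal := hW.primeIdealOf_isMaximal_of_isClosed ⟨y, hyW⟩ hy
  algebraize [const π W]
  have : Algebra.Smooth K Γ(X, W) := smooth_const π hW
  have hU := uniqueFactorizationMonoid_localization_of_smooth (K := K) m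
  have : IsDomain (Localization.AtPrime m) :=
    IsLocalization.isDomain_localization (Ideal.primeCompl_le_nonZeroDivisors _)
  have : IsNoetherianRing Γ(X, W) := IsLocallyNoetherian.component_noetherian ⟨W, hW⟩
  let ρ : Γ(X, W) ⟶ Γ(X, V ⊓ W) := X.presheaf.map (homOfLE inf_le_right).op
  let _ : Algebra Γ(X, W) Γ(X, V ⊓ W) := ρ.hom.toAlgebra
  have hinj : Function.Injective ρ := map_injective_of_isIntegral X (homOfLE inf_le_right)
  have hJ0 : J ≠ ⊥ := by
    obtain ⟨f, hf, hz⟩ := (mem_compl_iff (D := boundary V) (W := ⟨W, hW⟩) hzW).mp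
      (by rwa [compl_boundary])
    intro h
    obtain rfl : f = 0 := by simpa [J, h] using (show f ∈ J from hf)
    simp at hz
  obtain ⟨s, hs, g, hg0, hsg, hgJ⟩ := Ideal.exists_isPrincipal_near_of_map_eq_top m (J := J)
    (A := Localization.AtPrime m) (B := Γ(X, V ⊓ W)) (IsNoetherian.noetherian J)
    (by
      rw [← Ideal.radical_eq_iff]
      exact congr(($(radical_boundary V)).ideal ⟨W, hW⟩)) hJ0 hinj (by
      -- An element `j` of the ideal vanishes outside of `V`, so its basic open subset lies in `V ⊓
      -- W` and functions on `V ⊓ W` become fractions with denominator a power of `j`.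
      intro j hj b
      have hle : X.basicOpen j ≤ V := by
        simpa [compl_boundary] using basicOpen_le_compl (D := boundary V) (W := ⟨W, hW⟩) hj
      have hle' : X.basicOpen j ≤ V ⊓ W := le_inf hle (X.basicOpen_le j)
      by_cases hj0 : j = 0
      · exact ⟨1, 0, by simp [hj0]⟩
      have hne : Nonempty (X.basicOpen j) := by
        rcases (X.basicOpen j : Set X).eq_empty_or_nonempty with h | ⟨z, hz⟩
        · exact absurd ((basicOpen_eq_bot_iff j).mp (TopologicalSpace.Opens.ext h)) hj0
        · exact ⟨⟨z, hz⟩⟩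
      have := hW.isLocalization_basicOpen j
      obtain ⟨e, r, h⟩ := IsLocalization.Away.surj j
        (X.presheaf.map (homOfLE hle').op b : Γ(X, X.basicOpen j))
      refine ⟨e, r, map_injective_of_isIntegral X (homOfLE hle') ?_⟩
      rw [mul_comm]
      simp only [RingHom.algebraMap_toAlgebra, map_mul, map_pow] at h ⊢
      have hρ : ∀ a, X.presheaf.map (homOfLE hle').op (ρ a) =
          X.presheaf.map (homOfLE (X.basicOpen_le j)).op a := fun a => by
        simp only [ρ, ← CommRingCat.comp_apply, ← Functor.map_comp]; rfl
      erw [hρ, hρ]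
      exact h) (by
      -- The ideal of the boundary restricts to the unit ideal on the affine open subset `V ⊓ W`,
      -- which does not meet the boundary.
      refine ((boundary V).map_ideal (U := ⟨V ⊓ W, hV.inf hW⟩) (V := ⟨W, hW⟩)
        (inf_le_right : V ⊓ W ≤ W)).trans (ideal_eq_top ?_)
      simp [compl_boundary])
  have hys : y ∈ X.basicOpen s := by
    by_contra h
    refine hs ?_
    rw [Scheme.mem_basicOpen _ _ _ hyW] at h
    exact congr(s ∈ PrimeSpectrum.asIdeal
      $(IsAffineOpen.primeIdealOf_eq_map_closedPoint hW ⟨y, hyW⟩)).mpr h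
  have hne : Nonempty (X.basicOpen s) := ⟨⟨y, hys⟩⟩
  refine ⟨X.affineBasicOpen (U := ⟨W, hW⟩) s, hys, _, ?_,
    ideal_affineBasicOpen_eq_span (W := ⟨W, hW⟩) hsg hgJ⟩
  refine mem_nonZeroDivisors_of_ne_zero (M₀ := Γ(X, X.basicOpen s)) fun h => hg0 ?_
  exact map_injective_of_isIntegral X (homOfLE (X.basicOpen_le s)) (h.trans (map_zero _).symm)

end Sprays
end

noncomputable section

/-! ### The cover by the affine open subsets on which a divisor is principal -/

namespace Sprays

variable {X : Scheme.{u}}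

theorem map_mem_nonZeroDivisors [IsIntegral X] {W W' : X.Opens} (h : W' ≤ W) {f : Γ(X, W)}
    (hf : f ∈ nonZeroDivisors Γ(X, W)) :
    X.presheaf.map (homOfLE h).op f ∈ nonZeroDivisors Γ(X, W') := by
  rcases (W' : Set X).eq_empty_or_nonempty with h' | ⟨z, hz⟩
  · obtain rfl : W' = ⊥ := TopologicalSpace.Opens.ext h'
    exact mem_nonZeroDivisors_iff.mpr ⟨fun x _ => Subsingleton.elim _ _, fun x _ => Subsingleton.elim _ _⟩
  · have : Nonempty W := ⟨⟨z, h hz⟩⟩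
    have : Nonempty W' := ⟨⟨z, hz⟩⟩
    refine mem_nonZeroDivisors_of_ne_zero fun h0 => nonZeroDivisors.ne_zero hf ?_
    exact map_injective_of_isIntegral X (homOfLE h) (h0.trans (map_zero _).symm)

/-- The affine open subsets on which the divisor `D` has an equation. -/
def PrincipalOpens (D : X.IdealSheafData) : Type u :=
  {W : X.affineOpens // ∃ f ∈ nonZeroDivisors Γ(X, W), D.ideal W = Ideal.span {f}}

namespace PrincipalOpens

variable {D : X.IdealSheafData}

instance : Preorder (PrincipalOpens D) := inferInstanceAs (Preorder (Subtype _))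

/-- The underlying open subset. -/
abbrev opens (i : PrincipalOpens D) : X.Opens := i.1.1

/-- A local equation of `D`, which is `1` outside of the support of `D`. -/
def eqn (i : PrincipalOpens D) : Γ(X, i.opens) :=
  open Classical in if D.ideal i.1 = ⊤ then 1 else i.2.choose

theorem eqn_eq_one {i : PrincipalOpens D} (h : D.ideal i.1 = ⊤) : i.eqn = 1 := if_pos h

theorem eqn_mem (i : PrincipalOpens D) : i.eqn ∈ nonZeroDivisors Γ(X, i.opens) := by
  rw [eqn]
  split_ifs with h
  · exact one_mem _
  · exact i.2.choose_spec.1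

theorem ideal_eq (i : PrincipalOpens D) : D.ideal i.1 = Ideal.span {i.eqn} := by
  by_cases h : D.ideal i.1 = ⊤
  · rw [eqn_eq_one h, h, Ideal.span_singleton_one]
  · rw [eqn, if_neg h]; exact i.2.choose_spec.2

theorem ideal_eq_of_le (i : PrincipalOpens D) {W : X.affineOpens} (h : W ≤ i.1) :
    D.ideal W = Ideal.span {X.presheaf.map (homOfLE h).op i.eqn} := by
  rw [← D.map_ideal h, i.ideal_eq, Ideal.map_span, Set.image_singleton]

/-- An affine open subset of a principal open subset. -/
def ofLE [IsIntegral X] (i : PrincipalOpens D) (W : X.affineOpens) (h : W ≤ i.1) :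
    PrincipalOpens D :=
  ⟨W, _, map_mem_nonZeroDivisors h i.eqn_mem, i.ideal_eq_of_le h⟩

theorem exists_unit {W : X.affineOpens} {f g : Γ(X, W)}
    (hf : f ∈ nonZeroDivisors Γ(X, W)) (h : Ideal.span {f} = Ideal.span {g}) :
    ∃ v : Γ(X, W)ˣ, g = v * f := by
  obtain ⟨a, ha⟩ := Ideal.mem_span_singleton.mp (h ▸ Ideal.mem_span_singleton_self g : g ∈ Ideal.span {f})
  obtain ⟨b, hb⟩ := Ideal.mem_span_singleton.mp (h ▸ Ideal.mem_span_singleton_self f : f ∈ Ideal.span {g})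
  have : b * a = 1 := by
    have h1 : (b * a - 1) * f = 0 := by linear_combination (-1 : Γ(X, W)) * hb - b * ha
    exact sub_eq_zero.mp (hf.2 _ h1)
  exact ⟨⟨a, b, by rw [mul_comm, this], this⟩, by rw [ha, mul_comm]⟩

theorem opens_le {i j : PrincipalOpens D} (h : i ≤ j) : i.opens ≤ j.opens := h

theorem exists_ratio {i j : PrincipalOpens D} (h : i ≤ j) :
    ∃ v : Γ(X, i.opens)ˣ, X.presheaf.map (homOfLE (opens_le h)).op j.eqn = (v : Γ(X, i.opens)) * i.eqn :=
  exists_unit i.eqn_mem (i.ideal_eq.symm.trans (j.ideal_eq_of_le h))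

/-- The quotient of the equations of `D` on two principal open subsets. -/
def ratio {i j : PrincipalOpens D} (h : i ≤ j) : Γ(X, i.opens)ˣ := (exists_ratio h).choose

theorem ratio_mul {i j : PrincipalOpens D} (h : i ≤ j) :
    (ratio h : Γ(X, i.opens)) * i.eqn = X.presheaf.map (homOfLE (opens_le h)).op j.eqn := (exists_ratio h).choose_spec.symm

theorem eq_ratio {i j : PrincipalOpens D} (h : i ≤ j) {a : Γ(X, i.opens)}
    (ha : a * i.eqn = X.presheaf.map (homOfLE (opens_le h)).op j.eqn) : a = ratio h := by
  refine sub_eq_zero.mp (i.eqn_mem.2 _ ?_)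
  rw [sub_mul, ha, ratio_mul, sub_self]

theorem ratio_self (i : PrincipalOpens D) : (ratio (le_refl i) : Γ(X, i.opens)) = 1 := by
  refine (eq_ratio _ ?_).symm
  rw [one_mul]
  exact congr($(X.presheaf.map_id _) _).symm

theorem ratio_trans {i j k : PrincipalOpens D} (h : i ≤ j) (h' : j ≤ k) :
    (ratio (h.trans h') : Γ(X, i.opens)) = (ratio h : Γ(X, i.opens)) *
      X.presheaf.map (homOfLE (opens_le h)).op (ratio h' : Γ(X, j.opens)) := by
  refine (eq_ratio _ ?_).symm
  rw [mul_right_comm, ratio_mul, ← map_mul, mul_comm, ratio_mul, ← CommRingCat.comp_apply,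
    ← Functor.map_comp]
  rfl

/-- The factor by which the coordinates of the twisted bundle change. -/
def factor (n : ℕ) {i j : PrincipalOpens D} (h : i ≤ j) : Γ(X, i.opens) :=
  -- The exponent is negative because `f ^ n * c` must not depend on the chart: `f_i ^ n * c_i = f_j
  -- ^ n * c_j` gives `c_j = (f_j / f_i) ^ (-n) * c_i`.
  ((ratio h)⁻¹ ^ n : Γ(X, i.opens)ˣ)

theorem isUnit_factor (n : ℕ) {i j : PrincipalOpens D} (h : i ≤ j) : IsUnit (factor n h) :=
  Units.isUnit _

theorem factor_self (n : ℕ) (i : PrincipalOpens D) : factor n (le_refl i) = 1 := by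
  have : ratio (le_refl i) = 1 := Units.ext (ratio_self i)
  simp [factor, this]

theorem factor_trans (n : ℕ) {i j k : PrincipalOpens D} (h : i ≤ j) (h' : j ≤ k) :
    factor n (h.trans h') = factor n h * X.presheaf.map (homOfLE (opens_le h)).op (factor n h') := by
  have : ratio (h.trans h') = ratio h *
      Units.map (X.presheaf.map (homOfLE (opens_le h)).op).hom.toMonoidHom (ratio h') :=
    Units.ext (ratio_trans h h')
  rw [factor, this, mul_inv_rev, mul_pow, mul_comm, Units.val_mul, ← map_inv, ← map_pow]
  rfl

theorem map_eqn_pow (n : ℕ) {i j : PrincipalOpens D} (h : i ≤ j) :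
    X.presheaf.map (homOfLE (opens_le h)).op j.eqn ^ n * factor n h = i.eqn ^ n := by
  rw [← ratio_mul h, mul_pow, factor, mul_right_comm, ← Units.val_pow_eq_pow_val, ← Units.val_mul,
    ← mul_pow, mul_inv_cancel, one_pow, Units.val_one, one_mul]

/-- Being principal passes to smaller affine open subsets. A basis indexed by a preorder can be
glued along inclusions alone, without a cocycle condition on triple overlaps. -/
theorem isBasis [IsIntegral X] (hD : IsEffectiveDivisor D) :
    TopologicalSpace.Opens.IsBasis (Set.range fun i : PrincipalOpens D => i.opens) := by
  rw [TopologicalSpace.Opens.isBasis_iff_nbhd]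
  intro U x hx
  obtain ⟨W, hxW, h⟩ := hD x
  obtain ⟨_, ⟨W', hW', rfl⟩, hxW', hle⟩ := X.isBasis_affineOpens.exists_subset_of_mem_open
    (show x ∈ (U ⊓ W.1 : X.Opens) from ⟨hx, hxW⟩) (U ⊓ W.1).isOpen
  exact ⟨W', ⟨ofLE ⟨W, h⟩ ⟨W', hW'⟩ fun _ h => (hle h).2, rfl⟩, hxW', fun _ h => (hle h).1⟩

end PrincipalOpens

open PrincipalOpens

variable {D : X.IdealSheafData}

/-- The cover by the open subsets on which `D` is principal. -/
def principalCover [IsIntegral X] (hD : IsEffectiveDivisor D) : X.OpenCover where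
  I₀ := PrincipalOpens D
  X i := i.opens
  f i := i.opens.ι
  mem₀ := by
    rw [Scheme.presieve₀_mem_precoverage_iff]
    refine ⟨fun x ↦ ?_, inferInstance⟩
    obtain ⟨W, h, h'⟩ := hD x
    exact ⟨⟨W, h'⟩, by simpa using h⟩

theorem opensRange_principalCover [IsIntegral X] (hD : IsEffectiveDivisor D)
    (i : (principalCover hD).I₀) :
    ((principalCover hD).f i).opensRange = PrincipalOpens.opens i :=
  Scheme.Opens.opensRange_ι _

instance [IsIntegral X] (hD : IsEffectiveDivisor D) : Preorder (principalCover hD).I₀ :=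
  inferInstanceAs (Preorder (PrincipalOpens D))

instance [IsIntegral X] (hD : IsEffectiveDivisor D) : (principalCover hD).LocallyDirected :=
  .ofIsBasisOpensRange
    (fun {i j} => by
      rw [opensRange_principalCover, opensRange_principalCover]
      exact Iff.rfl) <| by
    convert! PrincipalOpens.isBasis hD using 2
    exact funext (opensRange_principalCover hD)

end Sprays

/-! ### The twisted bundle -/

namespace Sprays

open AffineSpace

section Scale

variable {n : Type u} {S : Scheme.{u}}

/-- Multiplication of the coordinates of an affine space with a function on the base. -/
def scale (n : Type u) (v : Γ(S, ⊤)) : 𝔸(n; S) ⟶ 𝔸(n; S) :=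
  homOfVector (𝔸(n; S) ↘ S) fun k => (𝔸(n; S) ↘ S).appTop v * coord S k

@[simp]
theorem scale_over (v : Γ(S, ⊤)) : scale n v ≫ 𝔸(n; S) ↘ S = 𝔸(n; S) ↘ S :=
  homOfVector_over _ _

@[simp]
theorem scale_appTop_coord (v : Γ(S, ⊤)) (k : n) :
    (scale n v).appTop (coord S k) = (𝔸(n; S) ↘ S).appTop v * coord S k :=
  homOfVector_appTop_coord _ _ _

theorem appTop_comp_apply {P Q R : Scheme.{u}} (f : P ⟶ Q) (g : Q ⟶ R) (a : Γ(R, ⊤)) :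
    f.appTop (g.appTop a) = (f ≫ g).appTop a := by
  rw [Scheme.Hom.comp_appTop]; rfl

theorem scale_comp_scale (v w : Γ(S, ⊤)) : scale n v ≫ scale n w = scale n (v * w) := by
  ext k
  · simp
  · rw [← appTop_comp_apply, scale_appTop_coord, map_mul, scale_appTop_coord, scale_appTop_coord,
      appTop_comp_apply, scale_over, map_mul]
    ring

theorem scale_one : scale n (1 : Γ(S, ⊤)) = 𝟙 _ := by
  ext k
  · simp
  · rw [scale_appTop_coord, map_one, one_mul]; simp

theorem isIso_scale {v : Γ(S, ⊤)} (hv : IsUnit v) : IsIso (scale n v) := by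
  obtain ⟨w, hw⟩ := hv.exists_right_inv
  exact ⟨scale n w, by rw [scale_comp_scale, hw, scale_one],
    by rw [scale_comp_scale, mul_comm, hw, scale_one]⟩

end Scale

variable {X : Scheme.{u}} {D : X.IdealSheafData}

open PrincipalOpens

/-- The pull-back of a function on the open subset `W` to an affine space over `W`. -/
def pull (n : Type u) (W : X.Opens) : Γ(X, W) →+* Γ(𝔸(n; W), ⊤) :=
  (W.topIso.inv ≫ (𝔸(n; W) ↘ W.toScheme).appTop).hom

theorem pull_apply (n : Type u) {W : X.Opens} (a : Γ(X, W)) :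
    pull n W a = (𝔸(n; W) ↘ W.toScheme).appTop (W.topIso.inv a) := rfl

theorem homOfLE_appTop_topIso_inv {W W' : X.Opens} (h : W ≤ W') (a : Γ(X, W')) :
    (X.homOfLE h).appTop (W'.topIso.inv a) = W.topIso.inv (X.presheaf.map (homOfLE h).op a) := by
  have e : W'.topIso.inv ≫ (X.homOfLE h).appTop =
      X.presheaf.map (homOfLE h).op ≫ W.topIso.inv := by
    rw [Scheme.homOfLE_appTop, Scheme.Opens.topIso_inv, Scheme.Opens.topIso_inv]
    exact (X.presheaf.map_comp _ _).symm.trans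
      (X.presheaf.map_comp (homOfLE h).op (eqToHom (by simp)).op)
  exact congr($(e).hom a)

theorem appTop_pull {n m : Type u} {W W' : X.Opens} (h : W ≤ W') {f : 𝔸(n; W) ⟶ 𝔸(m; W')}
    (hf : f ≫ 𝔸(m; W') ↘ W'.toScheme = 𝔸(n; W) ↘ W.toScheme ≫ X.homOfLE h) (a : Γ(X, W')) :
    f.appTop (pull m W' a) = pull n W (X.presheaf.map (homOfLE h).op a) := by
  rw [pull_apply, pull_apply, appTop_comp_apply, hf, ← appTop_comp_apply, homOfLE_appTop_topIso_inv]

/-- The transition maps of the twisted bundle. -/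
def twistMap (n : ℕ) (r : ℕ) {i j : PrincipalOpens D} (h : i ≤ j) :
    𝔸(ULift.{u} (Fin r); i.opens) ⟶ 𝔸(ULift.{u} (Fin r); j.opens) :=
  scale _ (i.opens.topIso.inv (factor n h)) ≫ map _ (X.homOfLE (opens_le h))

variable (n : ℕ) (r : ℕ) {i j k : PrincipalOpens D}

theorem twistMap_over (h : i ≤ j) :
    twistMap n r h ≫ 𝔸(ULift.{u} (Fin r); j.opens) ↘ j.opens.toScheme =
      𝔸(ULift.{u} (Fin r); i.opens) ↘ i.opens.toScheme ≫ X.homOfLE (opens_le h) := by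
  simp [twistMap]

theorem twistMap_coord (h : i ≤ j) (l) :
    (twistMap n r h).appTop (coord _ l) = pull _ _ (factor n h) * coord _ l := by
  rw [twistMap, ← appTop_comp_apply, map_appTop_coord, scale_appTop_coord, pull_apply]

theorem twistMap_self : twistMap n r (le_refl i) = 𝟙 _ := by
  ext l
  · rw [twistMap_over]; simp
  · rw [twistMap_coord, factor_self, map_one, one_mul]; simp

theorem twistMap_comp (h : i ≤ j) (h' : j ≤ k) :
    twistMap n r h ≫ twistMap n r h' = twistMap n r (h.trans h') := by
  ext l
  · rw [Category.assoc, twistMap_over, reassoc_of% (@twistMap_over), twistMap_over, Scheme.homOfLE_homOfLE]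
  · rw [← appTop_comp_apply, twistMap_coord, map_mul, twistMap_coord,
      appTop_pull (opens_le h) (twistMap_over n r h), twistMap_coord, factor_trans n h h', map_mul]
    ring

/-- Rescaling by a unit is an isomorphism over the base, so the twist does not disturb base change
of affine space. This is the condition that lets the charts glue over `X`. -/
theorem isPullback_twistMap (h : i ≤ j) :
    IsPullback (twistMap n r h) (𝔸(ULift.{u} (Fin r); i.opens) ↘ i.opens.toScheme)
      (𝔸(ULift.{u} (Fin r); j.opens) ↘ j.opens.toScheme) (X.homOfLE (opens_le h)) := by
  have := isIso_scale (n := ULift.{u} (Fin r))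
    ((isUnit_factor n h).map i.opens.topIso.inv.hom)
  have h1 : IsPullback (scale (ULift.{u} (Fin r)) (i.opens.topIso.inv (factor n h)))
      (𝔸(ULift.{u} (Fin r); i.opens) ↘ i.opens.toScheme)
      (𝔸(ULift.{u} (Fin r); i.opens) ↘ i.opens.toScheme) (𝟙 _) :=
    IsPullback.of_horiz_isIso ⟨by simp⟩
  have := h1.paste_horiz (isPullback_map (X.homOfLE (opens_le h)))
  rwa [Category.id_comp] at this

/-- The gluing datum of the twisted bundle. -/
def twistData [IsIntegral X] (hD : IsEffectiveDivisor D) :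
    (principalCover hD).RelativeGluingData where
  functor :=
    { obj i := 𝔸(ULift.{u} (Fin r); PrincipalOpens.opens i)
      map h := twistMap n r (leOfHom h)
      map_id _ := twistMap_self n r
      map_comp _ _ := (twistMap_comp n r _ _).symm }
  natTrans :=
    { app i := 𝔸(ULift.{u} (Fin r); PrincipalOpens.opens i) ↘ (PrincipalOpens.opens i).toScheme
      naturality _ _ h := twistMap_over n r (leOfHom h) }
  equifibered _ _ h := isPullback_twistMap n r (leOfHom h)

variable [IsIntegral X] (hD : IsEffectiveDivisor D)

/-- The total space of the twisted bundle. -/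
def twistTotal : Scheme.{u} := (twistData n r hD).glued

/-- The projection of the twisted bundle. -/
def twistProj : twistTotal n r hD ⟶ X := (twistData n r hD).toBase

/-- The local frames of the twisted bundle. -/
def twistFrame (i : PrincipalOpens D) :
    𝔸(ULift.{u} (Fin r); i.opens) ⟶ twistTotal n r hD :=
  colimit.ι (twistData n r hD).functor i

theorem twistFrame_proj (i : PrincipalOpens D) :
    twistFrame n r hD i ≫ twistProj n r hD =
      𝔸(ULift.{u} (Fin r); i.opens) ↘ i.opens.toScheme ≫ i.opens.ι :=
  (twistData n r hD).ι_toBase i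

theorem twistMap_frame (h : i ≤ j) :
    twistMap n r h ≫ twistFrame n r hD j = twistFrame n r hD i :=
  colimit.w (twistData n r hD).functor (homOfLE h)

theorem isPullback_twistFrame (i : PrincipalOpens D) :
    IsPullback (𝔸(ULift.{u} (Fin r); i.opens) ↘ i.opens.toScheme) (twistFrame n r hD i) i.opens.ι
      (twistProj n r hD) :=
  (twistData n r hD).isPullback_natTrans_ι_toBase i

/-- Morphisms from the total space of the twisted bundle are glued from morphisms on the local
trivializations. -/
def twistDesc {Y : Scheme.{u}} (g : ∀ i : PrincipalOpens D, 𝔸(ULift.{u} (Fin r); i.opens) ⟶ Y)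
    (hg : ∀ {i j : PrincipalOpens D} (h : i ≤ j), twistMap n r h ≫ g j = g i) :
    twistTotal n r hD ⟶ Y :=
  colimit.desc (twistData n r hD).functor
    { pt := Y
      ι := { app := g
             naturality := fun _ _ h => (hg (leOfHom h)).trans (Category.comp_id _).symm } }

theorem twistFrame_desc {Y : Scheme.{u}}
    (g : ∀ i : PrincipalOpens D, 𝔸(ULift.{u} (Fin r); i.opens) ⟶ Y)
    (hg : ∀ {i j : PrincipalOpens D} (h : i ≤ j), twistMap n r h ≫ g j = g i)
    (i : PrincipalOpens D) :
    twistFrame n r hD i ≫ twistDesc n r hD g hg = g i :=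
  colimit.ι_desc _ _

end Sprays

namespace Sprays

open AffineSpace

/-! ### Frames and coordinates -/

section Frame

theorem appLE_map_apply {P E : Scheme.{u}} (g : P ⟶ E) {O O' : E.Opens} {U : P.Opens} (h : O' ≤ O)
    (e : U ≤ g ⁻¹ᵁ O') (c : Γ(E, O)) :
    g.appLE O' U e (E.presheaf.map (homOfLE h).op c) =
      g.appLE O U (e.trans (g.preimage_mono h)) c := by
  rw [← CommRingCat.comp_apply, Scheme.Hom.map_appLE]

theorem comp_appLE_apply {P Q E : Scheme.{u}} (q : P ⟶ Q) (g : Q ⟶ E) {O : E.Opens}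
    (e : ⊤ ≤ g ⁻¹ᵁ O) (e' : ⊤ ≤ (q ≫ g) ⁻¹ᵁ O) (c : Γ(E, O)) :
    (q ≫ g).appLE O ⊤ e' c = q.appTop (g.appLE O ⊤ e c) := by
  have h := Scheme.Hom.appLE_comp_appLE q g O ⊤ ⊤ e le_top
  rw [show q.appLE ⊤ ⊤ le_top = q.appTop from Scheme.Hom.appLE_eq_app q] at h
  exact congr(($h).hom c).symm

theorem appLE_app_apply {P E B : Scheme.{u}} (g : P ⟶ E) (p : E ⟶ B) {O : B.Opens}
    (e : ⊤ ≤ g ⁻¹ᵁ p ⁻¹ᵁ O) (a : Γ(B, O)) :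
    g.appLE (p ⁻¹ᵁ O) ⊤ e (p.app O a) = (g ≫ p).appLE O ⊤ e a := by
  rw [← CommRingCat.comp_apply, Scheme.Hom.app_eq_appLE, Scheme.Hom.appLE_comp_appLE]

theorem ι_appLE_self {B : Scheme.{u}} (W : B.Opens) (e : ⊤ ≤ W.ι ⁻¹ᵁ W) :
    W.ι.appLE W ⊤ e = W.topIso.inv := by
  rw [Scheme.Opens.ι_appLE, Scheme.Opens.topIso_inv]
  rfl

theorem appLE_top_apply {P E : Scheme.{u}} (g : P ⟶ E) (c : Γ(E, ⊤)) :
    g.appLE ⊤ ⊤ le_top c = g.appTop c := by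
  rw [Scheme.Hom.appTop, Scheme.Hom.app_eq_appLE]; rfl

theorem ι_appLE_injective {B : Scheme.{u}} {W O : B.Opens} (h : O = W) (e : ⊤ ≤ W.ι ⁻¹ᵁ O) :
    Function.Injective (W.ι.appLE O ⊤ e) := by
  subst h
  rw [ι_appLE_self]
  exact (ConcreteCategory.bijective_of_isIso _).1

variable {E B : Scheme.{u}} {p : E ⟶ B} {W : B.Opens} {n : Type u}

/-- A frame of `p` over `W` identifies the restriction of `p` to `W` with an affine space. -/
abbrev IsFrame (p : E ⟶ B) (W : B.Opens) (F : 𝔸(n; W) ⟶ E) : Prop :=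
  IsPullback (𝔸(n; W) ↘ W.toScheme) F W.ι p

namespace IsFrame

variable {F : 𝔸(n; W) ⟶ E} (hF : IsFrame p W F)

include hF

theorem le : ⊤ ≤ F ⁻¹ᵁ p ⁻¹ᵁ W := by
  rw [← Scheme.Hom.comp_preimage, ← hF.w, Scheme.Hom.comp_preimage, Scheme.Opens.ι_preimage_self]
  rfl

theorem exists_iso : ∃ κ : 𝔸(n; W) ≅ (p ⁻¹ᵁ W).toScheme,
    κ.hom ≫ (p ⁻¹ᵁ W).ι = F ∧ κ.hom ≫ p ∣_ W = 𝔸(n; W) ↘ W.toScheme := by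
  have h := isPullback_morphismRestrict p W
  exact ⟨hF.isoIsPullback _ _ h, hF.isoIsPullback_hom_snd _ _ h, hF.isoIsPullback_hom_fst _ _ h⟩

theorem appLE_app (a : Γ(B, W)) : F.appLE (p ⁻¹ᵁ W) ⊤ hF.le (p.app W a) = pull n W a := by
  rw [appLE_app_apply]
  simp only [← hF.w]
  rw [comp_appLE_apply _ _ (Scheme.Opens.ι_preimage_self W).ge, ι_appLE_self]
  rfl

theorem appLE_eq {κ : 𝔸(n; W) ≅ (p ⁻¹ᵁ W).toScheme} (hκ : κ.hom ≫ (p ⁻¹ᵁ W).ι = F) :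
    F.appLE (p ⁻¹ᵁ W) ⊤ hF.le = (p ⁻¹ᵁ W).topIso.inv ≫ κ.hom.appTop := by
  ext c
  subst hκ
  rw [comp_appLE_apply _ _ (Scheme.Opens.ι_preimage_self _).ge, ι_appLE_self]
  rfl

theorem bijective : Function.Bijective (F.appLE (p ⁻¹ᵁ W) ⊤ hF.le) := by
  obtain ⟨κ, h, -⟩ := hF.exists_iso
  rw [hF.appLE_eq h]
  have : IsIso κ.hom.appTop := inferInstanceAs (IsIso (κ.hom.app ⊤))
  exact (ConcreteCategory.bijective_of_isIso κ.hom.appTop).comp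
    (ConcreteCategory.bijective_of_isIso (p ⁻¹ᵁ W).topIso.inv)

end IsFrame

variable {r : ℕ}

theorem IsFrame.isCoord_iff {F : 𝔸(ULift.{u} (Fin r); W) ⟶ E} (hF : IsFrame p W F)
    (c : Fin r → Γ(E, p ⁻¹ᵁ W)) :
    IsCoord p W c ↔ IsIso (homOfVector (𝔸(ULift.{u} (Fin r); W) ↘ W.toScheme)
      fun k : ULift.{u} (Fin r) => F.appLE (p ⁻¹ᵁ W) ⊤ hF.le (c k.down)) := by
  obtain ⟨κ, h, h'⟩ := hF.exists_iso
  rw [hF.appLE_eq h, ← h', IsCoord]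
  have := comp_homOfVector (fun k : ULift.{u} (Fin r) => (p ⁻¹ᵁ W).topIso.inv (c k.down))
    κ.hom (p ∣_ W)
  refine Iff.trans ?_ (iff_of_eq congr(IsIso $this))
  exact (isIso_comp_left_iff κ.hom _).symm

theorem IsFrame.isCoord {F : 𝔸(ULift.{u} (Fin r); W) ⟶ E} (hF : IsFrame p W F) {a : Γ(B, W)}
    (ha : IsUnit a) {c : Fin r → Γ(E, p ⁻¹ᵁ W)}
    (hc : ∀ k, F.appLE (p ⁻¹ᵁ W) ⊤ hF.le (c k) = pull _ W a * coord _ ⟨k⟩) : IsCoord p W c := by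
  rw [hF.isCoord_iff]
  simp only [hc]
  exact isIso_scale (ha.map W.topIso.inv.hom)

/-- The frame defined by a system of coordinates. -/
theorem IsCoord.exists_isFrame {c : Fin r → Γ(E, p ⁻¹ᵁ W)} (hc : IsCoord p W c) :
    ∃ (F : 𝔸(ULift.{u} (Fin r); W) ⟶ E) (hF : IsFrame p W F),
      ∀ k, F.appLE (p ⁻¹ᵁ W) ⊤ hF.le (c k) = coord _ ⟨k⟩ := by
  have : IsIso _ := hc
  set η := AffineSpace.homOfVector (n := ULift.{u} (Fin r)) (p ∣_ W)
    (fun k => (p ⁻¹ᵁ W).topIso.inv (c k.down)) with hη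
  have hF : IsFrame p W (inv η ≫ (p ⁻¹ᵁ W).ι) := by
    refine (isPullback_morphismRestrict p W).of_iso' (asIso η).symm (Iso.refl _) (Iso.refl _)
      (Iso.refl _) ?_ ?_ ?_ ?_
    · simp [hη]
    · simp
    · simp
    · simp
  refine ⟨_, hF, fun k => ?_⟩
  rw [comp_appLE_apply _ _ (Scheme.Opens.ι_preimage_self _).ge, ι_appLE_self]
  rw [← homOfVector_appTop_coord (p ∣_ W)
    (fun k : ULift.{u} (Fin r) => (p ⁻¹ᵁ W).topIso.inv (c k.down)) ⟨k⟩, ← hη, appTop_comp_apply, IsIso.inv_hom_id]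
  simp

end Frame

end Sprays

/-! ### Zero section, linear structure and canonical homomorphism of the twisted bundle. -/

namespace Sprays

open AffineSpace PrincipalOpens

section ZeroSection

variable {n : Type u}

/-- The zero section of an affine space. -/
def zeroSec (n : Type u) (S : Scheme.{u}) : S ⟶ 𝔸(n; S) := homOfVector (𝟙 S) 0

@[simp]
theorem zeroSec_over (S : Scheme.{u}) : zeroSec n S ≫ 𝔸(n; S) ↘ S = 𝟙 S := homOfVector_over _ _

@[simp]
theorem zeroSec_appTop_coord (S : Scheme.{u}) (k : n) : (zeroSec n S).appTop (coord S k) = 0 :=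
  homOfVector_appTop_coord _ _ _

end ZeroSection

variable {X : Scheme.{u}} {D : X.IdealSheafData} (n r : ℕ) {i j k : PrincipalOpens D}

theorem zeroSec_twistMap (h : i ≤ j) :
    zeroSec _ _ ≫ twistMap n r h = X.homOfLE (opens_le h) ≫ zeroSec _ _ := by
  ext l
  · rw [Category.assoc, twistMap_over, reassoc_of% (@zeroSec_over), Category.assoc, zeroSec_over,
      Category.comp_id]
  · rw [← appTop_comp_apply, twistMap_coord, map_mul, zeroSec_appTop_coord, mul_zero,
      ← appTop_comp_apply, zeroSec_appTop_coord, map_zero]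

variable [IsIntegral X] (hD : IsEffectiveDivisor D)

theorem zeroSec_twistFrame (h : i ≤ j) :
    X.homOfLE (opens_le h) ≫ zeroSec _ _ ≫ twistFrame n r hD j =
      zeroSec _ _ ≫ twistFrame n r hD i := by
  rw [← Category.assoc, ← zeroSec_twistMap n r h, Category.assoc, twistMap_frame]

theorem isFrame_twistFrame (i : PrincipalOpens D) :
    IsFrame (twistProj n r hD) i.opens (twistFrame n r hD i) :=
  isPullback_twistFrame n r hD i

/-- The zero section of the twisted bundle. -/
def twistZero : X ⟶ twistTotal n r hD :=
  (principalCover hD).glueMorphismsOfLocallyDirected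
    (fun i : PrincipalOpens D => zeroSec _ _ ≫ twistFrame n r hD i) (fun {i j} h =>
      zeroSec_twistFrame n r hD (i := i) (j := j) (leOfHom h))

theorem ι_twistZero (i : PrincipalOpens D) :
    i.opens.ι ≫ twistZero n r hD = zeroSec _ _ ≫ twistFrame n r hD i :=
  (principalCover hD).map_glueMorphismsOfLocallyDirected
    (fun i : PrincipalOpens D => zeroSec _ _ ≫ twistFrame n r hD i) (fun {i j} h =>
      zeroSec_twistFrame n r hD (i := i) (j := j) (leOfHom h)) i

include hD in
theorem hom_ext_principalCover {Y : Scheme.{u}} {f g : X ⟶ Y}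
    (h : ∀ i : PrincipalOpens D, i.opens.ι ≫ f = i.opens.ι ≫ g) : f = g :=
  (principalCover hD).hom_ext _ _ h

theorem twistZero_proj : twistZero n r hD ≫ twistProj n r hD = 𝟙 X := by
  refine hom_ext_principalCover hD fun i => ?_
  rw [reassoc_of% (@ι_twistZero), twistFrame_proj, reassoc_of% (@zeroSec_over), Category.comp_id]

/-- The value of a function on the bundle in a local frame. -/
def twistVal (i : PrincipalOpens D) :
    Γ(twistTotal n r hD, twistProj n r hD ⁻¹ᵁ i.opens) →+*
      Γ(𝔸(ULift.{u} (Fin r); i.opens), ⊤) :=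
  ((twistFrame n r hD i).appLE _ ⊤ (isFrame_twistFrame n r hD i).le).hom

theorem twistVal_bijective (i : PrincipalOpens D) : Function.Bijective (twistVal n r hD i) :=
  (isFrame_twistFrame n r hD i).bijective

theorem twistVal_app (i : PrincipalOpens D) (a : Γ(X, i.opens)) :
    twistVal n r hD i ((twistProj n r hD).app i.opens a) = pull _ _ a :=
  (isFrame_twistFrame n r hD i).appLE_app a

theorem twistVal_map (h : i ≤ j) (c : Γ(twistTotal n r hD, twistProj n r hD ⁻¹ᵁ j.opens)) :
    twistVal n r hD i ((twistTotal n r hD).presheaf.map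
      (homOfLE ((twistProj n r hD).preimage_mono (opens_le h))).op c) =
      (twistMap n r h).appTop (twistVal n r hD j c) := by
  refine (appLE_map_apply (twistFrame n r hD i) _ _ _).trans ?_
  refine Eq.trans ?_ (comp_appLE_apply (twistMap n r h) (twistFrame n r hD j)
    (isFrame_twistFrame n r hD j).le (by
      rw [twistMap_frame]
      exact (isFrame_twistFrame n r hD i).le.trans
        ((twistFrame n r hD i).preimage_mono
          ((twistProj n r hD).preimage_mono (opens_le h)))) c)
  simp only [twistMap_frame]

theorem isLinearChange_of_eq_mul {E B : Scheme.{u}} {p : E ⟶ B} {W W' : B.Opens} {r : ℕ}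
    {c : Fin r → Γ(E, p ⁻¹ᵁ W)} {c' : Fin r → Γ(E, p ⁻¹ᵁ W')} (a : Γ(B, W ⊓ W'))
    (h : ∀ k, E.presheaf.map (homOfLE (p.preimage_mono inf_le_right)).op (c' k) =
      p.app (W ⊓ W') a * E.presheaf.map (homOfLE (p.preimage_mono inf_le_left)).op (c k)) :
    IsLinearChange p c c' := by
  refine ⟨Matrix.diagonal fun _ => a, fun l => ?_⟩
  rw [h, Finset.sum_eq_single l (fun m _ hm => by rw [Matrix.diagonal_apply_ne' _ hm]; simp)
    (by simp), Matrix.diagonal_apply_eq]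

/-- The overlap is affine as `X` is separated, so it is itself an index `k` of the cover. In its
frame both systems are multiples of the standard coordinates, the first by a unit with inverse `w`;
the transition matrix is the scalar `t * w`. -/
theorem isLinearChange_of_twistVal [X.IsSeparated] {i j : PrincipalOpens D} {a : Γ(X, i.opens)}
    {b : Γ(X, j.opens)} (ha : IsUnit a)
    {c : Fin r → Γ(twistTotal n r hD, twistProj n r hD ⁻¹ᵁ i.opens)}
    {c' : Fin r → Γ(twistTotal n r hD, twistProj n r hD ⁻¹ᵁ j.opens)}
    (hc : ∀ k, twistVal n r hD i (c k) = pull _ _ a * coord _ ⟨k⟩)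
    (hc' : ∀ k, twistVal n r hD j (c' k) = pull _ _ b * coord _ ⟨k⟩) :
    IsLinearChange (twistProj n r hD) c c' := by
  let k : PrincipalOpens D := ofLE i ⟨i.opens ⊓ j.opens, i.1.2.inf j.1.2⟩
    (inf_le_left : i.opens ⊓ j.opens ≤ i.opens)
  have hi : k ≤ i := (inf_le_left : i.opens ⊓ j.opens ≤ i.opens)
  have hj : k ≤ j := (inf_le_right : i.opens ⊓ j.opens ≤ j.opens)
  have hu : IsUnit (X.presheaf.map (homOfLE (opens_le hi)).op a * factor n hi) :=
    (ha.map (X.presheaf.map (homOfLE (opens_le hi)).op).hom).mul (isUnit_factor n hi)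
  obtain ⟨w, hw⟩ := hu.exists_right_inv
  let t : Γ(X, k.opens) := X.presheaf.map (homOfLE (opens_le hj)).op b * factor n hj
  refine isLinearChange_of_eq_mul (t * w) fun l => (twistVal_bijective n r hD k).1 ?_
  refine (twistVal_map n r hD hj (c' l)).trans ?_
  refine Eq.trans ?_ ((map_mul (twistVal n r hD k) _ _).trans
    (congr_arg₂ _ (twistVal_app n r hD k (t * w)) (twistVal_map n r hD hi (c l)))).symm
  have key : ∀ {j : PrincipalOpens D} (h : k ≤ j) (b : Γ(X, j.opens)),
      (twistMap n r h).appTop (pull _ _ b * coord _ ⟨l⟩) =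
        pull _ _ (X.presheaf.map (homOfLE (opens_le h)).op b * factor n h) * coord _ ⟨l⟩ := by
    intro j h b
    rw [map_mul, twistMap_coord, appTop_pull (opens_le h) (twistMap_over n r h), map_mul, mul_assoc]
  rw [hc, hc', key, key, ← mul_assoc, ← map_mul, mul_assoc t, mul_comm w, hw, mul_one]

theorem twistZero_app_eq_zero {i : PrincipalOpens D} {a : Γ(X, i.opens)} {l : Fin r}
    {c : Γ(twistTotal n r hD, twistProj n r hD ⁻¹ᵁ i.opens)}
    (hc : twistVal n r hD i c = pull _ _ a * coord _ ⟨l⟩) :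
    (twistZero n r hD).app _ c = 0 := by
  have e : twistZero n r hD ⁻¹ᵁ twistProj n r hD ⁻¹ᵁ i.opens = i.opens := by
    rw [← Scheme.Hom.comp_preimage, twistZero_proj]; rfl
  have le : ⊤ ≤ i.opens.ι ⁻¹ᵁ twistZero n r hD ⁻¹ᵁ twistProj n r hD ⁻¹ᵁ i.opens := by
    rw [e, Scheme.Opens.ι_preimage_self]
  refine ι_appLE_injective e le ?_
  rw [map_zero, appLE_app_apply]
  simp only [ι_twistZero]
  rw [comp_appLE_apply _ _ (isFrame_twistFrame n r hD i).le]
  change (zeroSec _ _).appTop (twistVal n r hD i c) = 0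
  rw [hc, map_mul, zeroSec_appTop_coord, mul_zero]

/-- The coordinates which are given in a local frame by multiples of the standard coordinates. -/
theorem exists_twistVal_eq (i : PrincipalOpens D) (a : Γ(X, i.opens)) :
    ∃ c : Fin r → Γ(twistTotal n r hD, twistProj n r hD ⁻¹ᵁ i.opens),
      ∀ k, twistVal n r hD i (c k) = pull _ _ a * coord _ ⟨k⟩ :=
  ⟨fun _ => _, fun _ => ((twistVal_bijective n r hD i).2 _).choose_spec⟩

/-- The direct sum of `r` copies of the line bundle `𝒪(-nD)`. -/
def twistBundle [X.IsSeparated] : VectorBundle X r where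
  total := twistTotal n r hD
  proj := twistProj n r hD
  IsChart W c := ∃ (i : PrincipalOpens D) (h : i.opens = W),
    ∀ k, (twistFrame n r hD i).appLE (twistProj n r hD ⁻¹ᵁ W) ⊤
      (h ▸ (isFrame_twistFrame n r hD i).le) (c k) = coord _ ⟨k⟩
  isCoord := by
    rintro _ c ⟨i, rfl, h⟩
    exact (isFrame_twistFrame n r hD i).isCoord isUnit_one fun k => by
      rw [map_one, one_mul, h]
  exists_chart b := by
    obtain ⟨W, hW, h⟩ := hD b
    obtain ⟨c, hc⟩ := exists_twistVal_eq n r hD ⟨W, h⟩ 1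
    refine ⟨W, c, hW, ⟨W, h⟩, rfl, fun k => (hc k).trans ?_⟩
    rw [map_one, one_mul]
  linear := by
    rintro _ c _ c' ⟨i, rfl, h⟩ ⟨i', rfl, h'⟩
    refine isLinearChange_of_twistVal n r hD (i := i) (j := i') (a := 1) (b := 1) isUnit_one
      (fun k => (h k).trans ?_) (fun k => (h' k).trans ?_) <;> rw [map_one, one_mul]
  zero := twistZero n r hD
  zero_proj := twistZero_proj n r hD
  zero_coord := by
    rintro _ c ⟨i, rfl, h⟩ k
    exact twistZero_app_eq_zero n r hD (a := 1) ((h k).trans (by rw [map_one, one_mul]))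

/-- The canonical homomorphism from the twisted bundle to the trivial bundle in a local frame. -/
def twistFrameToTrivial (i : PrincipalOpens D) :
    𝔸(ULift.{u} (Fin r); i.opens) ⟶ 𝔸(ULift.{u} (Fin r); X) :=
  homOfVector (𝔸(ULift.{u} (Fin r); i.opens) ↘ i.opens.toScheme ≫ i.opens.ι) fun l =>
    pull _ _ (i.eqn ^ n) * coord _ l

omit [IsIntegral X] in
theorem twistMap_toTrivial (h : i ≤ j) :
    twistMap n r h ≫ twistFrameToTrivial n r j = twistFrameToTrivial n r i := by
  ext l
  · simp [twistFrameToTrivial, reassoc_of% (@twistMap_over)]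
  · rw [← appTop_comp_apply, twistFrameToTrivial, twistFrameToTrivial, homOfVector_appTop_coord,
      homOfVector_appTop_coord, map_mul,
      twistMap_coord, appTop_pull (opens_le h) (twistMap_over n r h), ← mul_assoc, ← map_mul,
      map_pow, map_eqn_pow]

/-- The canonical homomorphism from the twisted bundle to the trivial bundle. -/
def twistToTrivial : twistTotal n r hD ⟶ 𝔸(ULift.{u} (Fin r); X) :=
  twistDesc n r hD (twistFrameToTrivial n r) (twistMap_toTrivial n r)

theorem twistFrame_toTrivial (i : PrincipalOpens D) :
    twistFrame n r hD i ≫ twistToTrivial n r hD = twistFrameToTrivial n r i :=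
  twistFrame_desc n r hD _ (twistMap_toTrivial n r) i

theorem twistFrame_toTrivial_coord (i : PrincipalOpens D) (l) :
    (twistFrame n r hD i).appTop ((twistToTrivial n r hD).appTop (coord X l)) =
      pull _ _ (i.eqn ^ n) * coord _ l := by
  rw [appTop_comp_apply, twistFrame_toTrivial, twistFrameToTrivial, homOfVector_appTop_coord]

/-- A twist is tested against every generator of the ideal of `D`, not only the chosen equations. A
zero generator on a nonempty `W` would make the equation on a smaller principal open subset zero. -/
theorem exists_nonZeroDivisor_of_principal (hD : IsEffectiveDivisor D) {W : X.affineOpens}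
    {f : Γ(X, W)} (h : D.ideal W = Ideal.span {f}) : f ∈ nonZeroDivisors Γ(X, W) := by
  rcases (W.1 : Set X).eq_empty_or_nonempty with h' | ⟨z, hz⟩
  · have : Subsingleton Γ(X, W) := by
      rw [show W.1 = ⊥ from TopologicalSpace.Opens.ext h']; infer_instance
    exact mem_nonZeroDivisors_iff.mpr
      ⟨fun x _ => Subsingleton.elim _ _, fun x _ => Subsingleton.elim _ _⟩
  · have : Nonempty W.1 := ⟨⟨z, hz⟩⟩
    refine mem_nonZeroDivisors_of_ne_zero ?_
    rintro rfl
    obtain ⟨_, ⟨i, rfl⟩, hzi, hi⟩ := TopologicalSpace.Opens.isBasis_iff_nbhd.mp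
      (PrincipalOpens.isBasis hD) hz
    have : Nonempty i.opens := ⟨⟨z, hzi⟩⟩
    have h1 := i.eqn_mem
    have h2 := (D.map_ideal (U := i.1) (V := W) hi).symm.trans
      (congr_arg _ h)
    rw [Ideal.map_span, Set.image_singleton, map_zero, i.ideal_eq, Ideal.span_singleton_eq_span_singleton] at h2
    exact nonZeroDivisors.ne_zero h1 (associated_zero_iff_eq_zero _ |>.mp h2)

/-- Any other local equation is `f = v * eqn` with a unit `v`; the coordinates rescaled by `v ^
(-n)` turn multiplication by `eqn ^ n` into multiplication by `f ^ n`. -/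
theorem isTwist_twistBundle [X.IsSeparated] : IsTwist D n (twistBundle n r hD)
    fun k => (twistToTrivial n r hD).appTop (coord X ⟨k⟩) := by
  intro W f hf
  let i : PrincipalOpens D := ⟨W, f, exists_nonZeroDivisor_of_principal hD hf, hf⟩
  obtain ⟨v, hv⟩ := exists_unit i.eqn_mem (i.ideal_eq.symm.trans hf)
  obtain ⟨c, hc⟩ := exists_twistVal_eq n r hD i ((v⁻¹ ^ n : Γ(X, i.opens)ˣ) : Γ(X, i.opens))
  refine ⟨c, ⟨(isFrame_twistFrame n r hD i).isCoord (Units.isUnit _) hc, ?_⟩, fun k => ?_⟩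
  · rintro _ c' ⟨i', rfl, h'⟩
    refine isLinearChange_of_twistVal n r hD (i := i') (j := i) (a := 1) isUnit_one
      (fun k => (h' k).trans ?_) hc
    rw [map_one, one_mul]
  · refine (twistVal_bijective n r hD i).1 ?_
    refine Eq.trans ?_ ((map_mul (twistVal n r hD i) _ _).trans
      (congr_arg₂ _ ((map_pow (twistVal n r hD i) _ _).trans
        (congr_arg (· ^ n) (twistVal_app n r hD i f))) (hc k))).symm
    refine (appLE_map_apply (twistFrame n r hD i) _ _ _).trans ?_
    refine (appLE_top_apply (twistFrame n r hD i) _).trans ?_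
    rw [twistFrame_toTrivial_coord, ← map_pow, ← mul_assoc, ← map_mul]
    congr 2
    rw [show f = v * i.eqn from hv, mul_pow, mul_right_comm, ← Units.val_pow_eq_pow_val,
      ← Units.val_mul, ← mul_pow, mul_inv_cancel, one_pow, Units.val_one, one_mul]

end Sprays

/-! ### Extension of morphisms from dense open subschemes -/

namespace Sprays

/-- A morphism from a dense open subscheme to a separated scheme which extends locally extends. -/
theorem exists_extension {P X Y : Scheme.{u}} [IsReduced P] [X.IsSeparated] (w : Y ⟶ P)
    [IsOpenImmersion w] (hw : DenseRange w) (g : Y ⟶ X)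
    (H : ∀ x : P, ∃ (Y' : Scheme.{u}) (a : Y' ⟶ P) (g' : Y' ⟶ X), IsOpenImmersion a ∧
      x ∈ Set.range a ∧
      ∀ (T : Scheme.{u}) (t : T ⟶ Y') (t' : T ⟶ Y), t ≫ a = t' ≫ w → t ≫ g' = t' ≫ g) :
    ∃ G : P ⟶ X, w ≫ G = g := by
  choose Y' a g' ha hx hag using H
  let 𝒰 : P.OpenCover :=
    { I₀ := P
      X := Y'
      f := a
      mem₀ := by
        rw [Scheme.presieve₀_mem_precoverage_iff]
        exact ⟨fun x => ⟨x, hx x⟩, ha⟩ }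
  have hcompat : ∀ x y : P, pullback.fst (𝒰.f x) (𝒰.f y) ≫ g' x =
      pullback.snd (𝒰.f x) (𝒰.f y) ≫ g' y := by
    intro x y
    have hax : IsOpenImmersion (𝒰.f x) := ha x
    have hay : IsOpenImmersion (𝒰.f y) := ha y
    have hr : IsReduced (pullback (𝒰.f x) (𝒰.f y)) :=
      isReduced_of_isOpenImmersion (pullback.fst (𝒰.f x) (𝒰.f y) ≫ 𝒰.f x)
    set q := pullback.fst (𝒰.f x) (𝒰.f y) ≫ 𝒰.f x with hq
    -- The overlap of two local extensions is reduced and `Y` is dense in it. Since `X` is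
    -- separated, agreement over `Y` is enough.
    have hdom : IsDominant (pullback.fst q w) := by
      refine ⟨?_⟩
      rw [DenseRange, IsOpenImmersion.range_pullbackFst]
      change Dense (q ⁻¹' Set.range w)
      exact Dense.preimage hw q.isOpenEmbedding.isOpenMap
    refine ext_of_isDominant (pullback.fst q w) ?_
    have h1 := hag x _ (pullback.fst q w ≫ pullback.fst (𝒰.f x) (𝒰.f y)) (pullback.snd q w)
      (by rw [Category.assoc]; exact pullback.condition)
    have h2 := hag y _ (pullback.fst q w ≫ pullback.snd (𝒰.f x) (𝒰.f y)) (pullback.snd q w)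
      (by
        rw [Category.assoc]
        exact (congr_arg (_ ≫ ·) pullback.condition.symm).trans pullback.condition)
    rw [← Category.assoc, h1, ← Category.assoc, h2]
  refine ⟨𝒰.glueMorphisms g' hcompat, ?_⟩
  refine Scheme.Cover.hom_ext (𝒰.pullback₁ w) _ _ fun x => ?_
  have h := Scheme.Cover.ι_glueMorphisms 𝒰 g' hcompat x
  change pullback.fst w (𝒰.f x) ≫ w ≫ _ = pullback.fst w (𝒰.f x) ≫ g
  rw [pullback.condition_assoc, h]
  exact hag x _ _ _ pullback.condition.symm

end Sprays

/-- Clearing denominators: after the substitution `t ↦ f ^ n * c` the difference of a polynomial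
and its constant term becomes divisible by `f`. -/
theorem exists_map_mul_eq_sub_of_substitution {ι R R₀ A : Type*} {P : Type*} [CommRing R]
    [CommRing R₀] [CommRing A] [CommRing P] {f : R} (ρ : R →+* R₀)
    (hρ : ∀ s : R₀, ∃ (e : ℕ) (s' : R), s * ρ f ^ e = ρ s')
    (ιP : R →+* P) (ιA : R₀ →+* A) (c : ι → P) (t : ι → A) (T : ℕ → P →+* A)
    (hT : ∀ n a, T n (ιP a) = ιA (ρ a)) (hc : ∀ n k, ιA (ρ f) ^ n * T n (c k) = t k)
    (z : A →+* R₀) (hz : ∀ s, z (ιA s) = s) (hzt : ∀ k, z (t k) = 0)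
    (hsurj : Function.Surjective (MvPolynomial.eval₂Hom ιA t)) (a : A) :
    ∃ N, ∀ n ≥ N, ∃ p, T n (ιP f * p) = a - ιA (z a) := by
  have key : ∀ q : MvPolynomial ι R₀, ∃ N, ∀ n ≥ N, ∃ p,
      T n (ιP f * p) = ιA (ρ f) ^ n * MvPolynomial.eval₂Hom ιA t q := by
    intro q
    induction q using MvPolynomial.induction_on with
    | C s =>
      obtain ⟨e, s', h⟩ := hρ s
      -- One power more than the denominator needs: it is the factor `f` that has to remain.
      refine ⟨e + 1, fun n hn => ⟨ιP (s' * f ^ (n - (e + 1))), ?_⟩⟩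
      rw [MvPolynomial.coe_eval₂Hom, MvPolynomial.eval₂_C, ← map_mul, hT, map_mul ρ, map_mul ρ, ← h,
        ← map_pow ιA, ← map_mul ιA, map_pow]
      congr 1
      obtain ⟨m, rfl⟩ := Nat.exists_eq_add_of_le hn
      rw [Nat.add_sub_cancel_left]
      ring
    | add q q' h h' =>
      obtain ⟨N, h⟩ := h
      obtain ⟨N', h'⟩ := h'
      refine ⟨max N N', fun n hn => ?_⟩
      obtain ⟨p, hp⟩ := h n ((le_max_left _ _).trans hn)
      obtain ⟨p', hp'⟩ := h' n ((le_max_right _ _).trans hn)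
      exact ⟨p + p', by rw [mul_add, map_add, hp, hp', map_add, mul_add]⟩
    | mul_X q k h =>
      obtain ⟨N, h⟩ := h
      refine ⟨N, fun n hn => ?_⟩
      obtain ⟨p, hp⟩ := h n hn
      -- Further variables only contribute `f ^ n * c k`, so the bound is governed by the
      -- coefficients alone.
      refine ⟨p * (ιP f ^ n * c k), ?_⟩
      rw [← mul_assoc, map_mul, hp, map_mul, map_mul, map_pow, hT, hc, MvPolynomial.coe_eval₂Hom,
        MvPolynomial.eval₂_X, mul_assoc]
  obtain ⟨q, rfl⟩ := hsurj a
  induction q using MvPolynomial.induction_on with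
  | C s => exact ⟨0, fun n _ => ⟨0, by simp [hz]⟩⟩
  | add q q' h h' =>
    obtain ⟨N, h⟩ := h
    obtain ⟨N', h'⟩ := h'
    refine ⟨max N N', fun n hn => ?_⟩
    obtain ⟨p, hp⟩ := h n ((le_max_left _ _).trans hn)
    obtain ⟨p', hp'⟩ := h' n ((le_max_right _ _).trans hn)
    refine ⟨p + p', ?_⟩
    rw [mul_add, map_add, hp, hp', map_add, map_add, map_add]
    ring
  | mul_X q k _ =>
    -- The monomial contains the variable `t k = f ^ n * c k`, and its factor `f ^ n` clears the
    -- coefficients of `q`.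
    obtain ⟨N, h⟩ := key q
    refine ⟨N, fun n hn => ?_⟩
    obtain ⟨p, hp⟩ := h n hn
    refine ⟨p * c k, ?_⟩
    rw [← mul_assoc, map_mul, hp, map_mul, map_mul, MvPolynomial.coe_eval₂Hom,
      MvPolynomial.eval₂_X, hzt, mul_zero, map_zero, sub_zero, ← hc n k]
    ring

end

/-! ### Extension of the spray map across the divisor in one chart. -/

noncomputable section

namespace Sprays

open AffineSpace PrincipalOpens

theorem basicOpen_le_of_mem_span {Y : Scheme.{u}} {U O : Y.Opens} {s : Set Γ(Y, U)}
    (hs : ∀ g ∈ s, Y.basicOpen g ≤ O) {g : Γ(Y, U)} (hg : g ∈ Ideal.span s) :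
    Y.basicOpen g ≤ O := by
  induction hg using Submodule.span_induction with
  | mem g hg => exact hs g hg
  | zero => simp
  | add g g' _ _ h h' =>
    intro y hy
    have hyU := Y.basicOpen_le _ hy
    rw [Scheme.mem_basicOpen _ _ _ hyU, map_add] at hy
    rcases IsLocalRing.isUnit_or_isUnit_of_isUnit_add hy with hy | hy
    · exact h ((Scheme.mem_basicOpen _ _ _ hyU).mpr hy)
    · exact h' ((Scheme.mem_basicOpen _ _ _ hyU).mpr hy)
  | smul a g _ h =>
    rw [smul_eq_mul, Scheme.basicOpen_mul]
    exact inf_le_right.trans h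

/-- A neighbourhood of a section of affine schemes contains a basic open subset defined by
a function which is `1` on the section. -/
theorem exists_basicOpen_le {S Y : Scheme.{u}} [IsAffine S] [IsAffine Y] (z : S ⟶ Y) (q : Y ⟶ S)
    (h : z ≫ q = 𝟙 S) {O : Y.Opens} (hO : ∀ x, z x ∈ O) :
    ∃ g : Γ(Y, ⊤), z.appTop g = 1 ∧ Y.basicOpen g ≤ O := by
  set s : Set Γ(Y, ⊤) := {g | Y.basicOpen g ≤ O}
  have hsurj : Function.Surjective z.appTop.hom := fun a =>
    ⟨q.appTop a, by change z.appTop (q.appTop a) = a; rw [appTop_comp_apply, h]; simp⟩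
  -- The open subset contains the section, so the functions in `s`, restricted to the section, have
  -- no common zero; a combination restricting to `1` lifts.
  have htop : Ideal.map z.appTop.hom (Ideal.span s) = ⊤ := by
    rw [Ideal.map_span, ← IsAffineOpen.self_le_iSup_basicOpen_iff (isAffineOpen_top S)]
    intro x _
    obtain ⟨_, ⟨g, rfl⟩, hx, hg⟩ := TopologicalSpace.Opens.isBasis_iff_nbhd.mp
      (isBasis_basicOpen Y) (hO x)
    refine TopologicalSpace.Opens.mem_iSup.mpr ⟨⟨_, g, hg, rfl⟩, ?_⟩
    have := Scheme.preimage_basicOpen z g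
    exact this ▸ (show z x ∈ Y.basicOpen g from hx)
  obtain ⟨g, hg, hg1⟩ := (Ideal.mem_map_iff_of_surjective _ hsurj).mp
    (htop ▸ trivial : (1 : Γ(S, ⊤)) ∈ Ideal.map z.appTop.hom (Ideal.span s))
  exact ⟨g, hg1, basicOpen_le_of_mem_span (fun g hg => hg) hg⟩

theorem eval₂_pull_surjective {X : Scheme.{u}} (n : Type u) {W : X.Opens} (hW : IsAffineOpen W) :
    Function.Surjective (MvPolynomial.eval₂Hom (pull n W) (coord W.toScheme)) := by
  have : IsAffine W := hW
  have h : IsIso ((isoOfIsAffine n W).hom.appTop) :=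
    inferInstanceAs (IsIso ((isoOfIsAffine n W).hom.app ⊤))
  rw [isoOfIsAffine_hom_appTop] at h
  have h' : IsIso (CommRingCat.ofHom
    (MvPolynomial.eval₂Hom ((𝔸(n; W) ↘ W.toScheme).appTop).hom (coord W.toScheme))) :=
    IsIso.of_isIso_comp_left (Scheme.ΓSpecIso _).hom _
  intro a
  obtain ⟨q, rfl⟩ := (ConcreteCategory.bijective_of_isIso (CommRingCat.ofHom
    (MvPolynomial.eval₂Hom ((𝔸(n; W) ↘ W.toScheme).appTop).hom (coord W.toScheme)))).2 a
  refine ⟨MvPolynomial.map W.topIso.hom.hom q, ?_⟩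
  rw [MvPolynomial.coe_eval₂Hom, MvPolynomial.eval₂_map]
  congr 1
  ext b
  change (𝔸(n; W) ↘ W.toScheme).appTop (W.topIso.inv (W.topIso.hom b)) = _
  congr 1
  exact congr($(W.topIso.hom_inv_id).hom b)

variable {X : Scheme.{u}} {D : X.IdealSheafData} (n r : ℕ) {i j k : PrincipalOpens D}

theorem isOpenImmersion_twistMap (h : i ≤ j) : IsOpenImmersion (twistMap n r h) :=
  MorphismProperty.of_isPullback (isPullback_twistMap n r h).flip inferInstance

theorem opens_inf_compl (i : PrincipalOpens D) :
    i.opens ⊓ compl D = X.basicOpen i.eqn := by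
  ext x
  refine ⟨fun ⟨hi, hx⟩ => ?_, fun hx => ⟨X.basicOpen_le _ hx,
    basicOpen_le_compl (i.ideal_eq ▸ Ideal.mem_span_singleton_self _) hx⟩⟩
  obtain ⟨f, hf, hx⟩ := (mem_compl_iff hi).mp hx
  refine basicOpen_le_of_mem_span (s := {i.eqn}) ?_ (i.ideal_eq ▸ hf) hx
  rintro _ rfl
  exact le_rfl

theorem pull_eqn_pow_mul_twistMap_coord (h : k ≤ i) (hk : D.ideal k.1 = ⊤) (l) :
    pull _ _ (X.presheaf.map (homOfLE (opens_le h)).op i.eqn) ^ n *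
      (twistMap n r h).appTop (coord _ l) = coord _ l := by
  rw [twistMap_coord, ← mul_assoc, ← map_pow, ← map_mul, map_eqn_pow, eqn_eq_one hk, one_pow,
    map_one, one_mul]

theorem mem_range_twistMap (h : k ≤ i) (hki : k.opens = i.opens ⊓ compl D)
    {x : 𝔸(ULift.{u} (Fin r); i.opens)} (hx : x ∈ (Scheme.basicOpen _ (pull _ i.opens i.eqn))) :
    x ∈ Set.range (twistMap n r h) := by
  have hx' : i.opens.ι ((𝔸(ULift.{u} (Fin r); i.opens) ↘ i.opens.toScheme) x) ∈ i.opens ⊓ compl D := by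
    rw [pull_apply, ← Scheme.preimage_basicOpen_top, ← ι_appLE_self i.opens (by simp),
      Scheme.basicOpen_appLE] at hx
    rw [opens_inf_compl]
    exact hx.2
  rw [← hki] at hx'
  obtain ⟨p, hp, -⟩ := Scheme.exists_preimage_of_isPullback (isPullback_twistMap n r h) x
    ⟨_, hx'⟩ (i.opens.ι.isOpenEmbedding.injective (by
      exact congr($(X.homOfLE_ι (opens_le h)) ⟨_, hx'⟩).symm))
  exact ⟨p, hp⟩

/-- On the basic open subset of `H` the extension has to land in the affine `W`, so it is a ring
homomorphism. The range condition gives it as a map of sets, and injectivity of restriction makes it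
multiplicative and additive. The rest of `P` is covered by `Y`, where `ρ` itself serves. -/
theorem exists_extension_of_basicOpen {P X Y : Scheme.{u}} [IsAffine P] [IsAffine Y] [IsReduced P]
    [X.IsSeparated] (τ : Y ⟶ P) [IsOpenImmersion τ] (hτ : DenseRange τ) (ρ : Y ⟶ X) {W : X.Opens}
    (hW : IsAffineOpen W) {H : Γ(P, ⊤)} {h : Γ(Y, ⊤)} (e : Y.basicOpen h = τ ⁻¹ᵁ P.basicOpen H)
    (eW : Y.basicOpen h ≤ ρ ⁻¹ᵁ W) (hcov : ∀ x, x ∈ P.basicOpen H ∨ x ∈ Set.range τ)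
    (hinj : Function.Injective (τ.appLE (P.basicOpen H) (Y.basicOpen h) e.le))
    (hrange : ∀ a, ρ.appLE W (Y.basicOpen h) eW a ∈
      (τ.appLE (P.basicOpen H) (Y.basicOpen h) e.le).hom.range) :
    ∃ σ : P ⟶ X, τ ≫ σ = ρ := by
  choose θ₀ hθ₀ using hrange
  let θ : Γ(X, W) ⟶ Γ(P, P.basicOpen H) := CommRingCat.ofHom
    { toFun := θ₀
      map_one' := hinj ((hθ₀ 1).trans (by rw [map_one, map_one]))
      map_zero' := hinj ((hθ₀ 0).trans (by rw [map_zero, map_zero]))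
      map_mul' := fun a b => hinj ((hθ₀ _).trans
        (by rw [map_mul, map_mul]; exact congr_arg₂ _ (hθ₀ a).symm (hθ₀ b).symm))
      map_add' := fun a b => hinj ((hθ₀ _).trans
        (by rw [map_add, map_add]; exact congr_arg₂ _ (hθ₀ a).symm (hθ₀ b).symm)) }
  have hθ : θ ≫ τ.appLE (P.basicOpen H) (Y.basicOpen h) e.le = ρ.appLE W (Y.basicOpen h) eW := by
    ext a
    exact hθ₀ a
  have hO : IsAffineOpen (P.basicOpen H) := (isAffineOpen_top P).basicOpen H
  have hO' : IsAffineOpen (Y.basicOpen h) := (isAffineOpen_top Y).basicOpen h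
  refine exists_extension τ hτ ρ fun x => ?_
  rcases hcov x with hx | hx
  · refine ⟨_, hO.fromSpec, Spec.map θ ≫ hW.fromSpec, inferInstance, ?_, fun T t t' ht => ?_⟩
    · rwa [hO.range_fromSpec]
    · have hr : Set.range t' ⊆ Set.range hO'.fromSpec := by
        rw [hO'.range_fromSpec, e]
        rintro _ ⟨y, rfl⟩
        change τ (t' y) ∈ P.basicOpen H
        rw [← Scheme.Hom.comp_apply, ← ht, Scheme.Hom.comp_apply, ← SetLike.mem_coe,
          ← hO.range_fromSpec]
        exact ⟨_, rfl⟩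
      have h1 := IsOpenImmersion.lift_fac hO'.fromSpec t' hr
      have h2 : t = IsOpenImmersion.lift hO'.fromSpec t' hr ≫
          Spec.map (τ.appLE (P.basicOpen H) (Y.basicOpen h) e.le) := by
        rw [← cancel_mono hO.fromSpec, Category.assoc, IsAffineOpen.SpecMap_appLE_fromSpec _ hO hO',
          ← Category.assoc, h1, ht]
      rw [h2, Category.assoc, ← Spec.map_comp_assoc, hθ, IsAffineOpen.SpecMap_appLE_fromSpec _ hW hO',
        ← Category.assoc, h1]
  · refine ⟨_, τ, ρ, inferInstance, hx, fun T t t' ht => ?_⟩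
    rw [(cancel_mono τ).mp ht]

end Sprays

namespace Sprays

open AffineSpace PrincipalOpens

theorem exists_mul_pow_eq_map {X : Scheme.{u}} {U V : X.Opens} (hU : IsAffineOpen U)
    (f : Γ(X, U)) (h : V ≤ U) (hV : V = X.basicOpen f) (s : Γ(X, V)) :
    ∃ (e : ℕ) (s' : Γ(X, U)), s * X.presheaf.map (homOfLE h).op f ^ e =
      X.presheaf.map (homOfLE h).op s' := by
  subst hV
  obtain ⟨n, y, hy⟩ := exists_eq_pow_mul_of_isAffineOpen X U hU f s
  exact ⟨n, y, by rw [mul_comm]; exact hy.symm⟩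

theorem appLE_injective {Y P : Scheme.{u}} (τ : Y ⟶ P) [IsDominant τ] [IsReduced P]
    [QuasiCompact τ] {O : P.Opens} {U : Y.Opens} (h : U = τ ⁻¹ᵁ O) :
    Function.Injective (τ.appLE O U h.le) := by
  subst h
  have := IsSchemeTheoreticallyDominant.of_isDominant τ
  rw [Scheme.Hom.appLE_eq_app]
  exact τ.app_injective O

theorem zeroSec_appTop_pull {X : Scheme.{u}} (n : Type u) {W : X.Opens} (a : Γ(X, W)) :
    (zeroSec n W.toScheme).appTop (pull n W a) = W.topIso.inv a := by
  rw [pull_apply, appTop_comp_apply, zeroSec_over]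
  simp

variable {X : Scheme.{u}} {D : X.IdealSheafData} {r : ℕ} {i k : PrincipalOpens D}

/-- The difference of `b` and its value on the zero section has no constant term in the fibre
coordinates, so a high twist makes it divisible by the equation of `D`; the value itself extends
over `D` as `a`. -/
theorem exists_pull_mul_add (h : k ≤ i) (hki : k.opens = i.opens ⊓ compl D)
    (b : Γ(𝔸(ULift.{u} (Fin r); k.opens), ⊤)) (a : Γ(X, i.opens))
    (hab : (zeroSec _ k.opens.toScheme).appTop b =
      k.opens.topIso.inv (X.presheaf.map (homOfLE (opens_le h)).op a)) :
    ∃ N, ∀ n ≥ N, ∃ p, (twistMap n r h).appTop (pull _ _ i.eqn * p + pull _ _ a) = b := by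
  have hk : D.ideal k.1 = ⊤ := ideal_eq_top (hki.le.trans inf_le_right)
  obtain ⟨N, hN⟩ := exists_map_mul_eq_sub_of_substitution (f := i.eqn)
    (X.presheaf.map (homOfLE (opens_le h)).op).hom
    (exists_mul_pow_eq_map i.1.2 i.eqn (opens_le h) (hki.trans (opens_inf_compl i)))
    (pull (ULift.{u} (Fin r)) i.opens) (pull (ULift.{u} (Fin r)) k.opens) (coord _) (coord _)
    (fun n => (twistMap n r h).appTop.hom)
    (fun n a => appTop_pull (opens_le h) (twistMap_over n r h) a)
    (fun n l => pull_eqn_pow_mul_twistMap_coord n r h hk l)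
    (k.opens.topIso.hom.hom.comp (zeroSec _ k.opens.toScheme).appTop.hom)
    (fun s => by
      refine (congr_arg k.opens.topIso.hom (zeroSec_appTop_pull _ s)).trans ?_
      exact congr($(k.opens.topIso.inv_hom_id).hom s))
    (fun l => (congr_arg k.opens.topIso.hom (zeroSec_appTop_coord _ _)).trans (map_zero _))
    (eval₂_pull_surjective _ k.1.2) b
  refine ⟨N, fun n hn => ?_⟩
  obtain ⟨p, hp⟩ := hN n hn
  refine ⟨p, ?_⟩
  rw [map_add, appTop_pull (opens_le h) (twistMap_over n r h)]
  refine (congr_arg (· + _) hp).trans ?_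
  rw [RingHom.comp_apply, hab]
  rw [show k.opens.topIso.hom.hom (k.opens.topIso.inv
    (X.presheaf.map (homOfLE (opens_le h)).op a)) = X.presheaf.map (homOfLE (opens_le h)).op a from
    congr($(k.opens.topIso.inv_hom_id).hom _)]
  exact sub_add_cancel _ _

/-- Reduces regularity of the extension to finitely many functions, so that a single order of twist
suffices. -/
theorem range_eq_top_of_finiteType {K R A B : Type*} [CommRing K] [CommRing R] [CommRing A] [CommRing B]
    {φ : K →+* R} {s : Set R} (hs : letI := φ.toAlgebra; Algebra.adjoin K s = ⊤) (τ : A →+* B)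
    (ρ : R →+* B) (hc : ∀ c, ρ (φ c) ∈ τ.range) (h : ∀ a ∈ s, ρ a ∈ τ.range) (a : R) :
    ρ a ∈ τ.range := by
  let := φ.toAlgebra
  have ha : a ∈ Algebra.adjoin K s := hs ▸ trivial
  induction ha using Algebra.adjoin_induction with
  | mem a ha => exact h a ha
  | algebraMap c => exact hc c
  | add a b _ _ ha hb => rw [map_add]; exact add_mem ha hb
  | mul a b _ _ ha hb => rw [map_mul]; exact mul_mem ha hb

variable {K : Type u} [Field K] (π : X ⟶ Spec (.of K))

theorem appLE_const {Y : Scheme.{u}} (g : Y ⟶ X) {W : X.Opens} {U : Y.Opens} (e : U ≤ g ⁻¹ᵁ W)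
    (c : K) : g.appLE W U e (const π W c) = const (g ≫ π) U c := by
  have := Scheme.Hom.appLE_comp_appLE g π ⊤ W U le_top e
  exact congr($(this).hom ((Scheme.ΓSpecIso (.of K)).inv c))

/-- A morphism defined outside of a divisor extends, after substituting coordinates twisted by
a high multiple of the divisor. -/
theorem exists_twistMap_extension [IsIntegral X] [X.IsSeparated] [LocallyOfFiniteType π] (h : k ≤ i)
    (hki : k.opens = i.opens ⊓ compl D) (hne : Nonempty k.opens)
    (ρ : 𝔸(ULift.{u} (Fin r); k.opens) ⟶ X)
    (hπ : ρ ≫ π = 𝔸(ULift.{u} (Fin r); k.opens) ↘ k.opens.toScheme ≫ k.opens.ι ≫ π)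
    (h0 : zeroSec _ _ ≫ ρ = k.opens.ι) :
    ∃ N, ∀ n ≥ N, ∃ σ : 𝔸(ULift.{u} (Fin r); i.opens) ⟶ X, twistMap n r h ≫ σ = ρ := by
  have hnei : Nonempty i.opens := hne.map fun x => ⟨x.1, opens_le h x.2⟩
  have : IsAffine i.opens := i.1.2
  have : IsAffine k.opens := k.1.2
  -- Around the zero section, where `g = 1`, the map `ρ` lands in the chart; functions of the chart
  -- pull back there to fractions `b / g ^ e`.
  obtain ⟨g, hg1, hg⟩ := exists_basicOpen_le (zeroSec (ULift.{u} (Fin r)) k.opens.toScheme) _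
    (zeroSec_over _) (O := ρ ⁻¹ᵁ i.opens) (fun x => by
      change ρ (zeroSec _ _ x) ∈ i.opens
      rw [← Scheme.Hom.comp_apply, h0]
      exact opens_le h x.2)
  let Y := 𝔸(ULift.{u} (Fin r); k.opens)
  let U := Y.basicOpen g
  have hloc : ∀ a : Γ(X, i.opens), ∃ (e : ℕ) (b : Γ(Y, ⊤)),
      ρ.appLE i.opens U hg a * Y.presheaf.map (homOfLE le_top).op g ^ e =
        Y.presheaf.map (homOfLE le_top).op b :=
    fun a => exists_mul_pow_eq_map (isAffineOpen_top Y) g le_top rfl _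
  choose e b hb using hloc
  have hzU : ⊤ ≤ zeroSec _ _ ⁻¹ᵁ U := by
    rw [Scheme.preimage_basicOpen_top, hg1, Scheme.basicOpen_of_isUnit _ isUnit_one]
  have hz : ∀ a, (zeroSec _ k.opens.toScheme).appTop a =
      (zeroSec _ k.opens.toScheme).appLE U ⊤ hzU (Y.presheaf.map (homOfLE le_top).op a) := by
    intro a
    rw [appLE_map_apply _ _ hzU, appLE_top_apply]
  have hzb : ∀ a, (zeroSec _ k.opens.toScheme).appTop (b a) =
      k.opens.topIso.inv (X.presheaf.map (homOfLE (opens_le h)).op a) := by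
    intro a
    rw [hz, ← hb, map_mul, map_pow, ← hz, hg1, one_pow, mul_one, ← CommRingCat.comp_apply,
      Scheme.Hom.appLE_comp_appLE]
    simp only [h0]
    rw [← ι_appLE_self _ (by simp), appLE_map_apply]
  obtain ⟨N₁, hN₁⟩ := exists_pull_mul_add h hki g 1 (by rw [hg1, map_one, map_one])
  choose N hN using fun a => exists_pull_mul_add h hki (b a) a (hzb a)
  obtain ⟨s, hs⟩ := (finiteType_const π i.1.2).1
  -- Large enough for `g` and for the numerators of the finitely many generators `s`.
  refine ⟨N₁ ⊔ s.sup N, fun n hn => ?_⟩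
  obtain ⟨p, hp⟩ := hN₁ n (le_sup_left.trans hn)
  rw [map_one] at hp
  let P := 𝔸(ULift.{u} (Fin r); i.opens)
  -- After the twist `g` becomes `1 + f * p`, which equals `1` on the entire fibres over `D`. Hence
  -- the basic open subsets of `H` and of `f` cover, and over the second the twisted chart already
  -- comes from outside of `D`.
  let H : Γ(P, ⊤) := pull _ _ i.eqn * p + 1
  have hτ := isOpenImmersion_twistMap n r h
  have hd : IsDominant (twistMap n r h) :=
    ⟨((twistMap n r h).isOpenEmbedding.isOpen_range).dense (Set.range_nonempty _)⟩
  have hU' : U = twistMap n r h ⁻¹ᵁ P.basicOpen H := by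
    rw [Scheme.preimage_basicOpen_top, hp]
  refine exists_extension_of_basicOpen (twistMap n r h) hd.1 ρ i.1.2 (H := H) hU' hg ?_
    (appLE_injective _ hU') ?_
  · intro x
    have h1 : P.basicOpen (1 : Γ(P, ⊤)) ≤ P.basicOpen H ⊔ P.basicOpen (pull _ _ i.eqn) := by
      refine basicOpen_le_of_mem_span (s := {H, pull _ _ i.eqn}) ?_
        (Ideal.mem_span_pair.mpr ⟨1, -p, by simp only [H]; ring⟩)
      rintro _ (rfl | rfl)
      exacts [le_sup_left, le_sup_right]
    rw [Scheme.basicOpen_of_isUnit _ isUnit_one] at h1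
    exact (h1 (show x ∈ ⊤ from trivial)).imp id fun hx => mem_range_twistMap n r h hki hx
  · refine range_eq_top_of_finiteType hs _ (ρ.appLE i.opens U hg).hom (fun c => ?_) fun a ha => ?_
    · refine ⟨const (𝔸(ULift.{u} (Fin r); i.opens) ↘ i.opens.toScheme ≫ i.opens.ι ≫ π) _ c, ?_⟩
      refine (appLE_const _ _ _ c).trans ((appLE_const π ρ hg c).trans ?_).symm
      simp only [hπ, ← Scheme.homOfLE_ι X (opens_le h), Category.assoc,
        reassoc_of% twistMap_over n r h]
    · obtain ⟨q, hq⟩ := hN a n ((Finset.le_sup ha).trans (le_sup_right.trans hn))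
      have hr : ∀ c, (twistMap n r h).appLE (P.basicOpen H) U hU'.le
          (P.presheaf.map (homOfLE le_top).op c) =
          Y.presheaf.map (homOfLE le_top).op ((twistMap n r h).appTop c) := fun c =>
        appLE_map_apply _ _ _ c
      obtain ⟨v, hv⟩ := (RingedSpace.isUnit_res_basicOpen _ H).exists_right_inv
      -- The extended function is `(a + f * q) / H ^ e`, with `v` the inverse of `H`.
      refine ⟨P.presheaf.map (homOfLE le_top).op (pull _ _ i.eqn * q + pull _ _ a) * v ^ e a, ?_⟩
      have hv' := congr_arg ((twistMap n r h).appLE (P.basicOpen H) U hU'.le) hv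
      replace hv' := (((map_mul _ _ _).symm.trans hv').trans (map_one _))
      have hrH := hr H
      rw [show (twistMap n r h).appTop H = g from hp] at hrH
      have hrq := hr (pull _ _ i.eqn * q + pull _ _ a)
      rw [hq, ← hb] at hrq
      refine (map_mul _ _ _).trans ((congr_arg₂ (· * ·) hrq (map_pow _ _ _)).trans ?_)
      refine (mul_assoc _ _ _).trans ((congr_arg (_ * ·) (mul_pow _ _ _).symm).trans ?_)
      rw [← hrH]
      refine (congr_arg (fun t => _ * t ^ e a) hv').trans ?_
      rw [one_pow, mul_one]

end Sprays

/-! ### Gluing the extensions to a spray on the twisted bundle. -/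

namespace Sprays

open AffineSpace PrincipalOpens

section

variable {X : Scheme.{u}} {D : X.IdealSheafData} (n r : ℕ) {i j k : PrincipalOpens D}

theorem ratio_eq_one (h : i ≤ j) (hj : D.ideal j.1 = ⊤) : ratio h = 1 := by
  have hi : D.ideal i.1 = ⊤ := by
    rw [← D.map_ideal (show i.1 ≤ j.1 from h), hj, Ideal.map_top]
  refine Units.ext (eq_ratio h ?_).symm
  rw [eqn_eq_one hi, eqn_eq_one hj, map_one, Units.val_one, one_mul]

/-- Inside a chart that avoids `D` all equations are `1`, so no twist is visible. The spray map over
`V` can thus be restricted to charts before `n` is chosen. -/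
theorem twistMap_eq_twistMap_zero (h : i ≤ j) (hj : D.ideal j.1 = ⊤) :
    twistMap n r h = twistMap 0 r h := by
  simp only [twistMap, factor, ratio_eq_one h hj, inv_one, one_pow]

variable [IsIntegral X] (hD : IsEffectiveDivisor D)

instance isOpenImmersion_twistFrame (i : PrincipalOpens D) :
    IsOpenImmersion (twistFrame n r hD i) :=
  MorphismProperty.of_isPullback (isPullback_twistFrame n r hD i) inferInstance

theorem exists_mem_range_twistFrame (x : twistTotal n r hD) {i : PrincipalOpens D}
    (hx : twistProj n r hD x ∈ i.opens) : x ∈ Set.range (twistFrame n r hD i) := by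
  obtain ⟨p, -, hp⟩ := Scheme.exists_preimage_of_isPullback (isPullback_twistFrame n r hD i)
    ⟨_, hx⟩ x rfl
  exact ⟨p, hp⟩

omit [IsIntegral X] in
include hD in
theorem exists_principal_mem (x : X) : ∃ i : PrincipalOpens D, x ∈ i.opens := by
  obtain ⟨W, hW, h⟩ := hD x
  exact ⟨⟨W, h⟩, hW⟩

instance isReduced_twistTotal : IsReduced (twistTotal n r hD) := by
  choose i hi using fun x : twistTotal n r hD => exists_principal_mem hD (twistProj n r hD x)
  have hne (x) : Nonempty (i x).opens := ⟨⟨_, hi x⟩⟩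
  let 𝒰 : (twistTotal n r hD).OpenCover :=
    { I₀ := twistTotal n r hD
      X x := 𝔸(ULift.{u} (Fin r); (i x).opens)
      f x := twistFrame n r hD (i x)
      mem₀ := by
        rw [Scheme.presieve₀_mem_precoverage_iff]
        exact ⟨fun x => ⟨x, exists_mem_range_twistFrame n r hD x (hi x)⟩, inferInstance⟩ }
  have (x : 𝒰.I₀) : IsReduced (𝒰.X x) :=
    inferInstanceAs (IsReduced 𝔸(ULift.{u} (Fin r); (i x).opens))
  exact IsReduced.of_openCover _ 𝒰

/-- The intersection of a principal open subset with the complement of the divisor. -/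
def PrincipalOpens.inter (i : PrincipalOpens D) : PrincipalOpens D :=
  i.ofLE ⟨i.opens ⊓ compl D, opens_inf_compl i ▸ i.1.2.basicOpen _⟩
    fun _ h => h.1

theorem inter_opens (i : PrincipalOpens D) : i.inter.opens = i.opens ⊓ compl D := rfl

theorem inter_le (i : PrincipalOpens D) : i.inter ≤ i :=
  show i.opens ⊓ compl D ≤ i.opens from inf_le_left

theorem inter_le_of_opens_eq {v : PrincipalOpens D} (hv : v.opens = compl D)
    (i : PrincipalOpens D) : i.inter ≤ v :=
  show i.opens ⊓ compl D ≤ v.opens from inf_le_right.trans hv.ge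

theorem nonempty_inter {v : PrincipalOpens D} (hv : v.opens = compl D) [hne : Nonempty v.opens]
    (i : PrincipalOpens D) (hi : Nonempty i.opens) : Nonempty i.inter.opens := by
  obtain ⟨x, hx⟩ := nonempty_preirreducible_inter i.opens.isOpen v.opens.isOpen
    ⟨_, hi.some.2⟩ ⟨_, hne.some.2⟩
  exact ⟨⟨x, show x ∈ i.opens ⊓ compl D from ⟨hx.1, hv.le hx.2⟩⟩⟩

/-- Every nonempty chart is irreducible and meets the frame over the complement of `D` in a nonempty
open subset. -/
theorem isDominant_twistFrame {v : PrincipalOpens D} (hv : v.opens = compl D)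
    [Nonempty v.opens] : IsDominant (twistFrame n r hD v) := by
  refine ⟨dense_iff_inter_open.mpr ?_⟩
  rintro O hO ⟨x, hx⟩
  obtain ⟨i, hi⟩ := exists_principal_mem hD (twistProj n r hD x)
  obtain ⟨y, rfl⟩ := exists_mem_range_twistFrame n r hD x hi
  have hi' : Nonempty i.opens := ⟨⟨_, hi⟩⟩
  have hk := nonempty_inter hv i hi'
  have := isOpenImmersion_twistMap n r (inter_le i)
  obtain ⟨_, hy, z, rfl⟩ := nonempty_preirreducible_inter
    (hO.preimage (twistFrame n r hD i).continuous)
    ((twistMap n r (inter_le i)).isOpenEmbedding.isOpen_range) ⟨y, hx⟩ (Set.range_nonempty _)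
  refine ⟨_, hy, twistMap n r (inter_le_of_opens_eq hv i) z, ?_⟩
  rw [← Scheme.Hom.comp_apply, ← Scheme.Hom.comp_apply, twistMap_frame, twistMap_frame]

/-- The overlap of a local frame with the frame outside of the divisor. -/
theorem exists_eq_comp_twistMap {v : PrincipalOpens D} (hv : v.opens = compl D)
    (i : PrincipalOpens D) {T : Scheme.{u}} (t : T ⟶ 𝔸(ULift.{u} (Fin r); i.opens))
    (t' : T ⟶ 𝔸(ULift.{u} (Fin r); v.opens))
    (h : t ≫ twistFrame n r hD i = t' ≫ twistFrame n r hD v) :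
    ∃ u : T ⟶ 𝔸(ULift.{u} (Fin r); i.inter.opens), t = u ≫ twistMap n r (inter_le i) ∧
      t' = u ≫ twistMap n r (inter_le_of_opens_eq hv i) := by
  have hr : Set.range (t ≫ twistFrame n r hD i ≫ twistProj n r hD) ⊆
      Set.range i.inter.opens.ι := by
    rw [Scheme.Opens.range_ι, inter_opens]
    rintro _ ⟨x, rfl⟩
    refine ⟨?_, hv.le ?_⟩
    · rw [twistFrame_proj]
      exact ((𝔸(ULift.{u} (Fin r); i.opens) ↘ i.opens.toScheme) (t x)).2
    · rw [reassoc_of% h, twistFrame_proj]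
      exact ((𝔸(ULift.{u} (Fin r); v.opens) ↘ v.opens.toScheme) (t' x)).2
  have hP := isPullback_twistFrame n r hD i.inter
  have hu := hP.lift_snd (IsOpenImmersion.lift _ _ hr) (t ≫ twistFrame n r hD i)
    ((IsOpenImmersion.lift_fac _ _ hr).trans (Category.assoc _ _ _).symm)
  refine ⟨hP.lift (IsOpenImmersion.lift _ _ hr) (t ≫ twistFrame n r hD i)
    ((IsOpenImmersion.lift_fac _ _ hr).trans (Category.assoc _ _ _).symm), ?_, ?_⟩
  · rw [← cancel_mono (twistFrame n r hD i), Category.assoc, twistMap_frame, hu]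
  · rw [← cancel_mono (twistFrame n r hD v), Category.assoc, twistMap_frame, hu, h]

variable {K : Type u} [Field K] (π : X ⟶ Spec (.of K)) [IsSeparated π] [LocallyOfFiniteType π]
  [QuasiCompact π]

/-- A spray map on the trivial bundle outside of a divisor extends to the bundle twisted by
a high multiple of the divisor. -/
theorem exists_twistTotal_extension {v : PrincipalOpens D} (hv : v.opens = compl D)
    [Nonempty v.opens] (ρ : 𝔸(ULift.{u} (Fin r); v.opens) ⟶ X)
    (hπ : ρ ≫ π = 𝔸(ULift.{u} (Fin r); v.opens) ↘ v.opens.toScheme ≫ v.opens.ι ≫ π)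
    (h0 : zeroSec _ _ ≫ ρ = v.opens.ι) :
    ∃ N, ∀ n ≥ N, ∃ s : twistTotal n r hD ⟶ X, twistFrame n r hD v ≫ s = ρ := by
  have : X.IsSeparated := isSeparated_scheme π
  have : CompactSpace X := QuasiCompact.compactSpace_of_compactSpace π
  have hv1 : D.ideal v.1 = ⊤ := ideal_eq_top hv.le
  choose i hi using exists_principal_mem hD
  obtain ⟨s, hs⟩ := CompactSpace.elim_nhds_subcover (fun x => ((i x).opens : Set X))
    fun x => (i x).opens.isOpen.mem_nhds (hi x)
  -- The restriction uses the untwisted map `twistMap 0`, which does not depend on the order of the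
  -- twist still to be found.
  have key (x : X) := exists_twistMap_extension π (r := r) (inter_le (i x)) rfl
    (nonempty_inter hv (i x) ⟨⟨x, hi x⟩⟩)
    (twistMap 0 r (inter_le_of_opens_eq hv (i x)) ≫ ρ)
    (by rw [Category.assoc, hπ, reassoc_of% (@twistMap_over), Scheme.homOfLE_ι_assoc])
    (by rw [reassoc_of% (@zeroSec_twistMap), h0, Scheme.homOfLE_ι])
  choose N hN using key
  refine ⟨s.sup N, fun n hn => ?_⟩
  have := isDominant_twistFrame n r hD hv
  refine exists_extension (twistFrame n r hD v) this.1 ρ fun y => ?_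
  have hy : twistProj n r hD y ∈ ⋃ x ∈ s, ((i x).opens : Set X) := hs ▸ trivial
  simp only [Set.mem_iUnion] at hy
  obtain ⟨x, hxs, hx⟩ := hy
  obtain ⟨σ, hσ⟩ := hN x n ((Finset.le_sup hxs).trans hn)
  refine ⟨_, twistFrame n r hD (i x), σ, inferInstance,
    exists_mem_range_twistFrame n r hD y hx, fun T t t' ht => ?_⟩
  obtain ⟨u, rfl, rfl⟩ := exists_eq_comp_twistMap n r hD hv (i x) t t' ht
  rw [Category.assoc, hσ, Category.assoc, twistMap_eq_twistMap_zero n r _ hv1]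

/-- The spray on the twisted bundle. -/
def twistSpray [X.IsSeparated] {v : PrincipalOpens D} (hv : v.opens = compl D) [Nonempty v.opens]
    {ρ : 𝔸(ULift.{u} (Fin r); v.opens) ⟶ X}
    (hπ : ρ ≫ π = 𝔸(ULift.{u} (Fin r); v.opens) ↘ v.opens.toScheme ≫ v.opens.ι ≫ π)
    (h0 : zeroSec _ _ ≫ ρ = v.opens.ι) (s : twistTotal n r hD ⟶ X)
    (hs : twistFrame n r hD v ≫ s = ρ) : GlobalSpray π r where
  __ := twistBundle n r hD
  map := s
  map_over := by
    have := isDominant_twistFrame n r hD hv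
    -- The bundle is reduced and the target separated, so the identity need only be checked on the
    -- dense frame over the complement of `D`.
    have key : s ≫ π = twistProj n r hD ≫ π := by
      refine ext_of_isDominant (twistFrame n r hD v) ?_
      rw [reassoc_of% hs, hπ]
      exact ((reassoc_of% twistFrame_proj n r hD v) _).symm
    exact key.trans (congr_arg (twistProj n r hD ≫ ·) (Category.id_comp π).symm)
  zero_map := by
    have : IsDominant v.opens.ι :=
      ⟨(v.opens.ι.isOpenEmbedding.isOpen_range).dense (Set.range_nonempty _)⟩
    refine ext_of_isDominant v.opens.ι ?_
    refine ((reassoc_of% ι_twistZero n r hD v) s).trans ?_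
    rw [hs, h0, Category.comp_id]

end

end Sprays

namespace Sprays

open AffineSpace PrincipalOpens

/-! ### Restriction of trivializations -/

section Restrict

variable {E B : Scheme.{u}} {p : E ⟶ B} {W W' : B.Opens} {r : ℕ} {c : Fin r → Γ(E, p ⁻¹ᵁ W)}

theorem IsCoord.restrict (hc : IsCoord p W c) (h : W' ≤ W) :
    IsCoord p W' fun k => E.presheaf.map (homOfLE (p.preimage_mono h)).op (c k) := by
  obtain ⟨F, hF, hFc⟩ := hc.exists_isFrame
  have hF' : IsFrame p W' (map (ULift.{u} (Fin r)) (B.homOfLE h) ≫ F) := by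
    have := (isPullback_map (n := ULift.{u} (Fin r)) (B.homOfLE h)).flip.paste_vert hF
    rwa [B.homOfLE_ι] at this
  refine hF'.isCoord isUnit_one fun k => ?_
  rw [appLE_map_apply, comp_appLE_apply _ _ hF.le, hFc, map_appTop_coord, map_one, one_mul]

theorem IsLinearChange.restrict {W₀ : B.Opens} {c₀ : Fin r → Γ(E, p ⁻¹ᵁ W₀)}
    (hc : IsLinearChange p c₀ c) (h : W' ≤ W) :
    IsLinearChange p c₀ fun k => E.presheaf.map (homOfLE (p.preimage_mono h)).op (c k) := by
  obtain ⟨M, hM⟩ := hc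
  have hle : W₀ ⊓ W' ≤ W₀ ⊓ W := inf_le_inf_left _ h
  refine ⟨M.map (B.presheaf.map (homOfLE hle).op), fun k => ?_⟩
  have := congr_arg (E.presheaf.map (homOfLE (p.preimage_mono hle)).op) (hM k)
  rw [map_sum] at this
  simp only [map_mul, ← CommRingCat.comp_apply, ← Functor.map_comp] at this ⊢
  refine this.trans (Finset.sum_congr rfl fun l _ => congr_arg (· * _) ?_)
  exact congr($(p.naturality (homOfLE hle).op).hom (M k l)).symm

end Restrict

/-! ### Functoriality of the differential. -/

section Tangent

variable {K : Type u} [Field K]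

theorem germMap_germ {X Y : Scheme.{u}} (f : Y ⟶ X) {y : Spec (.of K) ⟶ Y}
    {x : Spec (.of K) ⟶ X} (h : y ≫ f = x) {U : X.Opens} (hx : pt x ∈ U) (hy : pt y ∈ f ⁻¹ᵁ U)
    (s : Γ(X, U)) :
    germMap f h (X.presheaf.germ U (pt x) hx s) = Y.presheaf.germ (f ⁻¹ᵁ U) (pt y) hy (f.app U s) := by
  have h1 := X.presheaf.germ_stalkSpecializes (U := U) hx
    (specializes_of_eq (by rw [← h]; rfl) : f (pt y) ⤳ pt x)
  have h2 := f.germ_stalkMap U (pt y) hy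
  rw [← h1, Category.assoc] at h2
  exact congr($(h2).hom s)

theorem germMap_comp {X Y Z : Scheme.{u}} (f : Z ⟶ Y) (g : Y ⟶ X) {z : Spec (.of K) ⟶ Z}
    {y : Spec (.of K) ⟶ Y} {x : Spec (.of K) ⟶ X} (hf : z ≫ f = y) (hg : y ≫ g = x)
    (h : z ≫ f ≫ g = x) (a) : germMap (f ≫ g) h a = germMap f hf (germMap g hg a) := by
  obtain ⟨U, hU, s, rfl⟩ := X.presheaf.exists_germ_eq a
  have hy : pt y ∈ g ⁻¹ᵁ U := by
    have : pt x = g (pt y) := by rw [← hg]; rfl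
    exact show g (pt y) ∈ U from this ▸ hU
  have hz : pt z ∈ f ⁻¹ᵁ g ⁻¹ᵁ U := by
    have : pt y = f (pt z) := by rw [← hf]; rfl
    exact show f (pt z) ∈ g ⁻¹ᵁ U from this ▸ hy
  rw [germMap_germ g hg hU hy, germMap_germ f hf hy hz, germMap_germ (f ≫ g) h hU hz,
    Scheme.Hom.comp_app]
  rfl

theorem tangentMap_comp {X Y Z : Scheme.{u}} {π : X ⟶ Spec (.of K)} {π' : Y ⟶ Spec (.of K)}
    {π'' : Z ⟶ Spec (.of K)} (f : Z ⟶ Y) (g : Y ⟶ X) (hfπ : f ≫ π' = π'') (hgπ : g ≫ π = π')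
    {z : Spec (.of K) ⟶ Z} {y : Spec (.of K) ⟶ Y} {x : Spec (.of K) ⟶ X} (hf : z ≫ f = y)
    (hg : y ≫ g = x) {q : Z ⟶ X} (hq : f ≫ g = q) (hqπ : q ≫ π = π'') (h : z ≫ q = x)
    (δ : tangentSpace π'' z) :
    tangentMap q hqπ h δ = tangentMap g hgπ hg (tangentMap f hfπ hf δ) := by
  subst hq
  exact Subtype.ext (funext fun a => congr_arg δ.1 (germMap_comp f g hf hg h a))

variable {X B B' : Scheme.{u}} {π : X ⟶ Spec (.of K)} {j : B ⟶ X} {j' : B' ⟶ X} {r r' : ℕ}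

/-- The chain rule: a map of fibres compatible with origins and spray maps carries tangent vectors
along. It need not be an isomorphism. -/
theorem Spray.tangentImage_le (S : Spray π j r) (T : Spray π j' r') {b : Spec (.of K) ⟶ B}
    {b' : Spec (.of K) ⟶ B'} {x : KPoint π} (h : b ≫ j = x.1) (h' : b' ≫ j' = x.1)
    (m : S.fiber b ⟶ T.fiber b') (hm : m ≫ pullback.snd _ _ = pullback.snd _ _)
    (hmap : m ≫ T.fiberMap b' = S.fiberMap b) (h0 : S.origin b ≫ m = T.origin b') :
    S.tangentImage b x h ≤ T.tangentImage b' x h' := by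
  rintro _ ⟨δ, rfl⟩
  exact ⟨_, (tangentMap_comp m (T.fiberMap b') hm (T.fiberMap_over b' x h') h0
    (T.origin_fiberMap b' h') hmap (S.fiberMap_over b x h) (S.origin_fiberMap b h) δ).symm⟩

end Tangent

/-! ### The extension of a local spray -/

section Extension

variable {X : Scheme.{u}} {U V : X.Opens} {r : ℕ}

/-- The trivial bundle over `V` defined by coordinates over `V ⊆ U` on a bundle over `U`. -/
theorem IsCoord.exists_isPullback (hVU : V ≤ U) {E : Scheme.{u}} {p : E ⟶ U.toScheme}
    {e : Fin r → Γ(E, p ⁻¹ᵁ U.ι ⁻¹ᵁ V)} (he : IsCoord p (U.ι ⁻¹ᵁ V) e) :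
    ∃ (F : 𝔸(ULift.{u} (Fin r); V) ⟶ E)
      (_ : IsPullback (𝔸(ULift.{u} (Fin r); V) ↘ V.toScheme) F (X.homOfLE hVU) p)
      (hle : ⊤ ≤ F ⁻¹ᵁ p ⁻¹ᵁ U.ι ⁻¹ᵁ V), ∀ k, F.appLE (p ⁻¹ᵁ U.ι ⁻¹ᵁ V) ⊤ hle (e k) = coord _ ⟨k⟩ := by
  obtain ⟨F, hF, hFe⟩ := he.exists_isFrame
  let κ : V.toScheme ≅ (U.ι ⁻¹ᵁ V).toScheme :=
    IsOpenImmersion.isoOfRangeEq (X.homOfLE hVU) (U.ι ⁻¹ᵁ V).ι (by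
      rw [Scheme.Opens.range_ι, ← X.opensRange_homOfLE hVU]
      rfl)
  have hκ : κ.hom ≫ (U.ι ⁻¹ᵁ V).ι = X.homOfLE hVU :=
    IsOpenImmersion.isoOfRangeEq_hom_fac _ _ _
  have h1 := (isPullback_map (n := ULift.{u} (Fin r)) κ.hom).flip.paste_vert hF
  rw [hκ] at h1
  have hle : ⊤ ≤ (AffineSpace.map (ULift.{u} (Fin r)) κ.hom ≫ F) ⁻¹ᵁ p ⁻¹ᵁ U.ι ⁻¹ᵁ V :=
    fun y _ => hF.le (show AffineSpace.map (ULift.{u} (Fin r)) κ.hom y ∈ ⊤ from trivial)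
  refine ⟨_, h1, hle, fun k => ?_⟩
  rw [comp_appLE_apply _ _ hF.le, hFe, map_appTop_coord]

theorem VectorBundle.zero_app_restrict {B : Scheme.{u}} (S : VectorBundle B r) {W W' : B.Opens}
    (h : W' ≤ W) {c : Fin r → Γ(S.total, S.proj ⁻¹ᵁ W)} (hc : S.IsChart W c) (k : Fin r) :
    S.zero.app _ (S.total.presheaf.map (homOfLE (S.proj.preimage_mono h)).op (c k)) = 0 := by
  have := congr($(S.zero.naturality (homOfLE (S.proj.preimage_mono h)).op).hom (c k))
  exact this.trans ((congr_arg (B.presheaf.map _) (S.zero_coord W c hc k)).trans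
    (map_zero (B.presheaf.map _).hom))

/-- The section of the pulled back bundle induced by the zero section has vanishing coordinates, and
this characterizes the zero section of affine space. -/
theorem VectorBundle.zeroSec_comp {B : Scheme.{u}} (S : VectorBundle B r) {W : B.Opens}
    {e : Fin r → Γ(S.total, S.proj ⁻¹ᵁ W)} (he : ∀ k, S.zero.app _ (e k) = 0) {Y : Scheme.{u}}
    {q : Y ⟶ B} {F : 𝔸(ULift.{u} (Fin r); Y) ⟶ S.total}
    (hF : IsPullback (𝔸(ULift.{u} (Fin r); Y) ↘ Y) F q S.proj) (hle : ⊤ ≤ F ⁻¹ᵁ S.proj ⁻¹ᵁ W)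
    (hFe : ∀ k, F.appLE (S.proj ⁻¹ᵁ W) ⊤ hle (e k) = coord _ ⟨k⟩) :
    zeroSec _ _ ≫ F = q ≫ S.zero := by
  have hw : (𝟙 Y) ≫ q = (q ≫ S.zero) ≫ S.proj := by
    rw [Category.assoc, S.zero_proj, Category.id_comp, Category.comp_id]
  have h1 : hF.lift (𝟙 Y) (q ≫ S.zero) hw = zeroSec _ _ := by
    have h2 := hF.lift_snd (𝟙 Y) (q ≫ S.zero) hw
    refine AffineSpace.hom_ext ?_ fun k => ?_
    · rw [hF.lift_fst, zeroSec_over]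
    · rw [zeroSec_appTop_coord, ← hFe k.down]
      have hle' : ⊤ ≤ (q ≫ S.zero) ⁻¹ᵁ S.proj ⁻¹ᵁ W := by
        rw [← h2]
        exact fun y _ => hle (show hF.lift (𝟙 Y) (q ≫ S.zero) hw y ∈ ⊤ from trivial)
      rw [← comp_appLE_apply _ _ hle (by rwa [h2])]
      simp only [h2]
      rw [Scheme.Hom.comp_appLE, CommRingCat.comp_apply, he, map_zero]
  rw [← h1, hF.lift_snd]

end Extension

end Sprays

/-! ### The extended spray and its domination. -/

namespace Sprays

open AffineSpace PrincipalOpens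

variable {X : Scheme.{u}} {r : ℕ} {K : Type u} [Field K] {π : X ⟶ Spec (.of K)}

theorem appLE_top_injective {P Q : Scheme.{u}} (κ : P ≅ Q) {O : Q.Opens} (hO : O = ⊤)
    (h : ⊤ ≤ κ.hom ⁻¹ᵁ O) : Function.Injective (κ.hom.appLE O ⊤ h) := by
  subst hO
  rw [show κ.hom.appLE ⊤ ⊤ h = κ.hom.appTop from Scheme.Hom.appLE_eq_app κ.hom]
  have : IsIso κ.hom.appTop := inferInstanceAs (IsIso (κ.hom.app ⊤))
  exact (ConcreteCategory.bijective_of_isIso κ.hom.appTop).1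

/-- The homomorphism `φ` is the frame of `T` inverted, followed by the frame of `S`. -/
theorem isTwistedExtension_of_iso {U : X.Opens} (S : LocalSpray π U r) (D : X.IdealSheafData)
    (n : ℕ) (T : GlobalSpray π r) {ψ : Fin r → Γ(T.total, ⊤)}
    (hψ : IsTwist D n T.toVectorBundle ψ) {e : Fin r → Γ(S.total, S.proj ⁻¹ᵁ (U.ι ⁻¹ᵁ compl D))}
    (he : S.IsTrivialization (U.ι ⁻¹ᵁ compl D) e) {F : 𝔸(ULift.{u} (Fin r); compl D) ⟶ S.total}
    (hF : F ≫ S.proj ≫ U.ι = 𝔸(ULift.{u} (Fin r); compl D) ↘ (compl D).toScheme ≫ (compl D).ι)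
    (hle : ⊤ ≤ F ⁻¹ᵁ S.proj ⁻¹ᵁ U.ι ⁻¹ᵁ compl D)
    (hFe : ∀ k, F.appLE (S.proj ⁻¹ᵁ U.ι ⁻¹ᵁ compl D) ⊤ hle (e k) = coord _ ⟨k⟩)
    {t : 𝔸(ULift.{u} (Fin r); compl D) ⟶ T.total}
    (κ : 𝔸(ULift.{u} (Fin r); compl D) ≅ (T.proj ⁻¹ᵁ compl D).toScheme)
    (hκ : κ.hom ≫ (T.proj ⁻¹ᵁ compl D).ι = t)
    (ht : t ≫ T.proj = 𝔸(ULift.{u} (Fin r); compl D) ↘ (compl D).toScheme ≫ (compl D).ι)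
    (htψ : ∀ k, t.appTop (ψ k) = coord _ ⟨k⟩) (hmap : t ≫ T.map = F ≫ S.map) :
    IsTwistedExtension S D n T := by
  subst hκ
  refine ⟨ψ, e, κ.inv ≫ F, hψ, he, ?_, fun k => ?_, ?_⟩
  · rw [← cancel_epi κ.hom, Category.assoc, κ.hom_inv_id_assoc, hF, ← ht, Category.assoc]
  · have hφ : κ.hom ≫ κ.inv ≫ F = F := κ.hom_inv_id_assoc F
    have h1 : (κ.inv ≫ F) ⁻¹ᵁ S.proj ⁻¹ᵁ U.ι ⁻¹ᵁ compl D = ⊤ :=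
      top_le_iff.mp fun y _ => hle (show κ.inv y ∈ ⊤ from trivial)
    have h2 : ⊤ ≤ κ.hom ⁻¹ᵁ (κ.inv ≫ F) ⁻¹ᵁ S.proj ⁻¹ᵁ U.ι ⁻¹ᵁ compl D := by
      rw [h1]; exact le_rfl
    refine appLE_top_injective κ h1 h2 ?_
    rw [appLE_map_apply, appLE_top_apply, appTop_comp_apply, htψ, appLE_app_apply]
    simp only [hφ]
    exact hFe k
  · rw [← cancel_epi κ.hom, Category.assoc, κ.hom_inv_id_assoc, ← hmap, Category.assoc]

/-- Both bundles have frames over `V` by the same affine space, with the same spray map in them. The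
frame of `S` is cartesian, so the fibre of `S` at the point lifts to that affine space and from
there maps to the fibre of `T`; the chain rule applies. -/
theorem Spray.DominatingAt.of_isPullback {U V : X.Opens} (hVU : V ≤ U) (S : LocalSpray π U r)
    {r' : ℕ} (T : GlobalSpray π r') {F : 𝔸(ULift.{u} (Fin r); V) ⟶ S.total}
    (hF : IsPullback (𝔸(ULift.{u} (Fin r); V) ↘ V.toScheme) F (X.homOfLE hVU) S.proj)
    (hF0 : zeroSec _ _ ≫ F = X.homOfLE hVU ≫ S.zero)
    {t : 𝔸(ULift.{u} (Fin r); V) ⟶ T.total}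
    (ht : t ≫ T.proj = 𝔸(ULift.{u} (Fin r); V) ↘ V.toScheme ≫ V.ι)
    (ht0 : zeroSec _ _ ≫ t = V.ι ≫ T.zero) (hmap : t ≫ T.map = F ≫ S.map) {x : KPoint π}
    (hx : pt x.1 ∈ V) (hS : S.DominatingAt x) : T.DominatingAt x := by
  obtain ⟨b, hb, htop⟩ := hS
  have hr : Set.range x.1 ⊆ Set.range V.ι := by
    rw [Scheme.Opens.range_ι]
    rintro _ ⟨y, rfl⟩
    rwa [Subsingleton.elim y (IsLocalRing.closedPoint K)]
  obtain ⟨b', hb'⟩ : ∃ b' : Spec (.of K) ⟶ V.toScheme, b' ≫ V.ι = x.1 :=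
    ⟨_, IsOpenImmersion.lift_fac V.ι x.1 hr⟩
  have hbb' : b' ≫ X.homOfLE hVU = b := by
    rw [← cancel_mono U.ι, Category.assoc, X.homOfLE_ι, hb', hb]
  obtain ⟨q, hq1, hq2⟩ : ∃ q : S.fiber b ⟶ 𝔸(ULift.{u} (Fin r); V),
      q ≫ 𝔸(ULift.{u} (Fin r); V) ↘ V.toScheme = pullback.snd S.proj b ≫ b' ∧
        q ≫ F = pullback.fst S.proj b :=
    have hw : (pullback.snd S.proj b ≫ b') ≫ X.homOfLE hVU = pullback.fst S.proj b ≫ S.proj := by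
      rw [Category.assoc, hbb', pullback.condition]
    ⟨_, hF.lift_fst _ _ hw, hF.lift_snd _ _ hw⟩
  have hm : (q ≫ t) ≫ T.proj = pullback.snd S.proj b ≫ x.1 := by
    rw [Category.assoc, ht, reassoc_of% hq1, hb']
  have hq0 : S.origin b ≫ q = b' ≫ zeroSec _ _ := by
    refine hF.hom_ext ?_ ?_
    · rw [Category.assoc, hq1, Category.assoc, zeroSec_over, Spray.origin,
        pullback.lift_snd_assoc, Category.id_comp, Category.comp_id]
    · rw [Category.assoc, hq2, Category.assoc, hF0, reassoc_of% hbb', Spray.origin,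
        pullback.lift_fst]
  refine ⟨x.1, Category.comp_id _, top_le_iff.mp (htop.symm.le.trans ?_)⟩
  refine S.tangentImage_le T hb (Category.comp_id _)
    (pullback.lift (q ≫ t) (pullback.snd S.proj b) hm) (pullback.lift_snd _ _ _) ?_ ?_
  · rw [Spray.fiberMap, pullback.lift_fst_assoc, Category.assoc, hmap, reassoc_of% hq2,
      Spray.fiberMap]
  · refine pullback.hom_ext ?_ ?_
    · rw [Category.assoc, pullback.lift_fst, reassoc_of% hq0, ht0, reassoc_of% hb',
        Spray.origin, pullback.lift_fst]
    · rw [Category.assoc, pullback.lift_snd, Spray.origin, Spray.origin, pullback.lift_snd,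
        pullback.lift_snd]

/-- A local spray which is dominating at a point extends, after twisting its bundle along
the boundary of a neighbourhood of the point, to a spray which is dominating at the point. -/
theorem exists_twistedExtension [IsAlgClosed K] [CharZero K] [IsIntegral X] [IsSeparated π]
    [LocallyOfFiniteType π] [QuasiCompact π] [Smooth π] {U : X.Opens} (S : LocalSpray π U r)
    (x : KPoint π) (hxU : pt x.1 ∈ U) (hS : S.DominatingAt x) :
    ∃ D : X.IdealSheafData, IsEffectiveDivisor D ∧ D.radical = D ∧ compl D ≤ U ∧
      pt x.1 ∈ compl D ∧ ∃ N : ℕ, ∀ n ≥ N, ∃ T : GlobalSpray π r,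
        IsTwistedExtension S D n T ∧ T.DominatingAt x := by
  have : X.IsSeparated := isSeparated_scheme π
  obtain ⟨W, c, hxW, hc⟩ := S.exists_chart ⟨pt x.1, hxU⟩
  obtain ⟨_, ⟨V, hV, rfl⟩, hxV, hle⟩ := X.isBasis_affineOpens.exists_subset_of_mem_open
    (show pt x.1 ∈ U.ι ''ᵁ W from ⟨_, hxW, rfl⟩) (U.ι ''ᵁ W).isOpen
  have hVU : V ≤ U := by
    rintro y hy
    obtain ⟨z, -, rfl⟩ := hle hy
    exact z.2
  have hVW : U.ι ⁻¹ᵁ V ≤ W := by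
    rintro y hy
    obtain ⟨z, hz, hzy⟩ := hle hy
    exact (Subtype.ext hzy : z = y) ▸ hz
  have hD := isEffectiveDivisor_boundary π hV ⟨_, hxV⟩
  have hrad := radical_boundary V
  -- From here on `V` is `compl D` itself, which avoids transport along an equality of open subsets.
  generalize hD' : boundary V = D at hD hrad
  obtain rfl : compl D = V := hD' ▸ compl_boundary V
  -- The complement of `D` is itself a chart of the twisted bundle, with equation `1`; in it the
  -- canonical homomorphism is the identity.
  let v : PrincipalOpens D := ⟨⟨compl D, hV⟩, 1, one_mem _, by
    rw [ideal_eq_top (W := ⟨compl D, hV⟩) le_rfl, Ideal.span_singleton_one]⟩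
  have hv : v.opens = compl D := rfl
  have : Nonempty v.opens := ⟨⟨_, hxV⟩⟩
  have he : S.IsTrivialization (U.ι ⁻¹ᵁ v.opens)
      fun k => S.total.presheaf.map (homOfLE (S.proj.preimage_mono hVW)).op (c k) :=
    ⟨(S.isCoord W c hc).restrict hVW, fun W' c' hc' => (S.linear W' c' W c hc' hc).restrict hVW⟩
  obtain ⟨F, hF, hFle, hFe⟩ := he.1.exists_isPullback hVU
  have hF0 := S.zeroSec_comp (S.zero_app_restrict hVW hc) hF hFle hFe
  have hπ : (F ≫ S.map) ≫ π =
      𝔸(ULift.{u} (Fin r); v.opens) ↘ v.opens.toScheme ≫ v.opens.ι ≫ π := by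
    rw [Category.assoc, S.map_over, ← reassoc_of% hF.w, X.homOfLE_ι_assoc]
  have h0 : zeroSec _ _ ≫ F ≫ S.map = v.opens.ι := by
    rw [reassoc_of% hF0, S.zero_map, X.homOfLE_ι]
  refine ⟨D, hD, hrad, hVU, hxV, ?_⟩
  obtain ⟨N, hN⟩ := exists_twistTotal_extension r hD π hv _ hπ h0
  refine ⟨N, fun n hn => ?_⟩
  obtain ⟨s, hs⟩ := hN n hn
  obtain ⟨κ, hκ, -⟩ := (isFrame_twistFrame n r hD v).exists_iso
  refine ⟨twistSpray n r hD π hv hπ h0 s hs, ?_, ?_⟩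
  · refine isTwistedExtension_of_iso S D n _ (isTwist_twistBundle n r hD) he ?_ hFle hFe κ hκ
      (twistFrame_proj n r hD v) (fun k => ?_) hs
    · rw [← reassoc_of% hF.w, X.homOfLE_ι]
    · refine (twistFrame_toTrivial_coord n r hD v ⟨k⟩).trans ?_
      rw [eqn_eq_one (ideal_eq_top hv.le), one_pow, map_one, one_mul]
  · exact .of_isPullback hVU S _ hF hF0 (twistFrame_proj n r hD v) (ι_twistZero n r hD v).symm hs
      hxV hS

end Sprays

/-! ### Openness of the locus where derivations span the tangent space -/

namespace Sprays

/-- A point derivation `R → K` at the `K`-point `y` of the `K`-algebra `R`. -/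
structure IsPointDerivation {K R : Type*} [Field K] [CommRing R] [Algebra K R] (y : R →ₐ[K] K)
    (d : R → K) : Prop where
  map_add : ∀ a b, d (a + b) = d a + d b
  map_mul : ∀ a b, d (a * b) = y a * d b + y b * d a
  map_algebraMap : ∀ c, d (algebraMap K R c) = 0

variable {K R : Type*} [Field K] [CommRing R] [Algebra K R]

theorem IsPointDerivation.comp (y : R →ₐ[K] K) (D : Derivation K R R) :
    IsPointDerivation y fun a => y (D a) where
  map_add a b := by simp
  map_mul a b := by simp
  map_algebraMap c := by simp

/-- A point derivation factors through the Kähler differentials. Expanding `D a` in the dual basis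
expresses it by the functionals `e i`, with coefficients its values on the `ω i`. -/
theorem IsPointDerivation.mem_span {y : R →ₐ[K] K} {d : R → K} (hd : IsPointDerivation y d)
    {ι : Type*} [Fintype ι] {ω : ι → Ω[R⁄K]} {e : ι → Ω[R⁄K] →ₗ[R] R}
    (h : ∀ η, ∑ i, e i η • ω i = η) :
    d ∈ Submodule.span K (Set.range fun i a => y (e i (KaehlerDifferential.D K R a))) := by
  let := y.toRingHom.toAlgebra
  have hsm (a : R) (c : K) : a • c = y a * c := rfl
  have : IsScalarTower K R K := .of_algebraMap_eq fun c => (y.commutes c).symm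
  let d' : Derivation K R K := Derivation.mk'
    { toFun := d
      map_add' := hd.map_add
      map_smul' := fun c a => by
        rw [Algebra.smul_def, hd.map_mul, hd.map_algebraMap, mul_zero, add_zero, y.commutes]; rfl }
    hd.map_mul
  have hd' : d = ∑ i, d'.liftKaehlerDifferential (ω i) •
      fun a => y (e i (KaehlerDifferential.D K R a)) := by
    ext a
    have h1 : d a = d'.liftKaehlerDifferential (KaehlerDifferential.D K R a) :=
      (d'.liftKaehlerDifferential_comp_D a).symm
    rw [h1]
    conv_lhs => rw [← h (KaehlerDifferential.D K R a)]
    rw [map_sum, Finset.sum_apply]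
    refine Finset.sum_congr rfl fun i _ => ?_
    rw [map_smul, hsm, Pi.smul_apply, smul_eq_mul, mul_comm]
  rw [hd']
  exact Submodule.sum_mem _ fun i _ => Submodule.smul_mem _ _ (Submodule.subset_span ⟨i, rfl⟩)

theorem exists_dual_basis (M : Type*) [AddCommGroup M] [Module R M] [Module.Finite R M]
    [Module.Projective R M] :
    ∃ (n : ℕ) (ω : Fin n → M) (e : Fin n → M →ₗ[R] R), ∀ η, ∑ i, e i η • ω i = η := by
  obtain ⟨n, f, hf⟩ := Module.Finite.exists_fin' R M
  obtain ⟨g, hg⟩ := Module.projective_lifting_property f LinearMap.id hf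
  refine ⟨n, fun i => f (Pi.single i 1), fun i => LinearMap.proj i ∘ₗ g, fun η => ?_⟩
  conv_rhs => rw [← LinearMap.id_apply (R := R) η, ← hg, LinearMap.comp_apply,
    ← LinearMap.sum_single_apply (φ := fun _ => R) (g η)]
  rw [map_sum]
  refine Finset.sum_congr rfl fun i _ => ?_
  rw [← map_smul]
  congr 1
  ext j
  simp [Pi.single_apply]

/-- If derivations of a smooth algebra span the tangent space at a point, then also at all
points of a neighbourhood. -/
theorem exists_forall_mem_span [Algebra.Smooth K R] {r : ℕ} (E : Fin r → Derivation K R R)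
    (x : R →ₐ[K] K)
    (hx : ∀ d, IsPointDerivation x d → d ∈ Submodule.span K (Set.range fun k a => x (E k a))) :
    ∃ h : R, x h ≠ 0 ∧ ∀ y : R →ₐ[K] K, y h ≠ 0 → ∀ d, IsPointDerivation y d →
      d ∈ Submodule.span K (Set.range fun k a => y (E k a)) := by
  -- For a smooth algebra the differentials are projective, so finitely many derivations `e i ∘ D`
  -- span the point derivations at every point.
  obtain ⟨n, ω, e, h⟩ := exists_dual_basis (R := R) Ω[R⁄K]
  have hspan (i : Fin n) : ∃ l : Fin r → K,
      ∑ k, l k • (fun a => x (E k a)) = fun a => x (e i (KaehlerDifferential.D K R a)) :=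
    (Submodule.mem_span_range_iff_exists_fun K).mp
      (hx _ (.comp x ((e i).compDer (KaehlerDifferential.D K R))))
  choose l hl using hspan
  -- The error of writing `e i` as a constant combination of the `E k`; it vanishes at `x`.
  let e' (i : Fin n) : Ω[R⁄K] →ₗ[R] R := e i - ∑ k, l i k • (E k).liftKaehlerDifferential
  have he' (i a) : e' i (KaehlerDifferential.D K R a) =
      e i (KaehlerDifferential.D K R a) - ∑ k, l i k • E k a := by
    simp [e']
  have hxe' (i η) : x (e' i η) = 0 := by
    have hη : η ∈ Submodule.span R (Set.range (KaehlerDifferential.D K R)) := by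
      rw [KaehlerDifferential.span_range_derivation]; trivial
    induction hη using Submodule.span_induction with
    | mem η hη =>
      obtain ⟨a, rfl⟩ := hη
      have := congr_fun (hl i) a
      simp only [Finset.sum_apply, Pi.smul_apply] at this
      rw [he', map_sub, ← this, map_sum]
      simp
    | zero => simp
    | add η η' _ _ h h' => rw [map_add, map_add, h, h', add_zero]
    | smul a η _ h => rw [map_smul, smul_eq_mul, map_mul, h, mul_zero]
  -- Expanding the error in the dual basis gives `M * e = l * E` with `M` the identity at `x`.
  -- Wherever `det M ≠ 0`, the `e i` are therefore combinations of the `E k`.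
  let M : Matrix (Fin n) (Fin n) R := 1 - Matrix.of fun i j => e' i (ω j)
  have hMx : x M.det = 1 := by
    have : x.toRingHom.mapMatrix M = 1 := by
      ext i j
      simp [M, hxe', Matrix.one_apply, apply_ite x]
    exact (x.toRingHom.map_det M).trans (by rw [this, Matrix.det_one])
  refine ⟨M.det, by rw [hMx]; exact one_ne_zero, fun y hy d hd => ?_⟩
  have hM (i a) : ∑ j, M i j * e j (KaehlerDifferential.D K R a) = ∑ k, l i k • E k a := by
    have h1 : e' i (KaehlerDifferential.D K R a) =
        ∑ j, e' i (ω j) * e j (KaehlerDifferential.D K R a) := by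
      conv_lhs => rw [← h (KaehlerDifferential.D K R a)]
      rw [map_sum]
      exact Finset.sum_congr rfl fun j _ => by rw [map_smul, smul_eq_mul, mul_comm]
    simp only [M, Matrix.sub_apply, Matrix.of_apply, sub_mul, Finset.sum_sub_distrib, ← h1, he']
    simp [Matrix.one_apply]
  have hdet : IsUnit (y.toRingHom.mapMatrix M).det :=
    isUnit_iff_ne_zero.mpr fun h0 => hy ((y.toRingHom.map_det M).trans h0)
  refine Submodule.span_le.mpr ?_ (hd.mem_span h)
  rintro _ ⟨i, rfl⟩
  have hinv : (fun a => y (e i (KaehlerDifferential.D K R a))) =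
      ∑ j, (y.toRingHom.mapMatrix M)⁻¹ i j • ∑ k, l j k • fun a => y (E k a) := by
    ext a
    have h2 : (y.toRingHom.mapMatrix M).mulVec (fun j => y (e j (KaehlerDifferential.D K R a))) =
        fun j => ∑ k, l j k • y (E k a) := by
      ext j
      have := congr_arg y (hM j a)
      rw [map_sum, map_sum] at this
      simpa [Matrix.mulVec, dotProduct] using this
    have h3 := congr_arg ((y.toRingHom.mapMatrix M)⁻¹.mulVec) h2
    rw [Matrix.mulVec_mulVec, Matrix.nonsing_inv_mul _ hdet, Matrix.one_mulVec] at h3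
    refine (congr_fun h3 i).trans ?_
    simp [Matrix.mulVec, dotProduct]
  change (fun a => y (e i (KaehlerDifferential.D K R a))) ∈ _
  rw [hinv]
  exact Submodule.sum_mem _ fun j _ => Submodule.smul_mem _ _
    (Submodule.sum_mem _ fun k _ => Submodule.smul_mem _ _ (Submodule.subset_span ⟨k, rfl⟩))

end Sprays

/-! ### Tangent vectors as morphisms from the spectrum of the dual numbers -/

namespace Sprays

section EvalOn

variable {A B : CommRingCat.{u}} {X Z : Scheme.{u}}

/-- The evaluation of functions on `U` along a morphism from an affine scheme to `U`. -/
def evalOn (w : Spec A ⟶ Z) (U : Z.Opens) (h : ⊤ ≤ w ⁻¹ᵁ U) : Γ(Z, U) →+* A :=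
  (w.appLE U ⊤ h ≫ (Scheme.ΓSpecIso A).hom).hom

theorem evalOn_apply (w : Spec A ⟶ Z) {U : Z.Opens} (h : ⊤ ≤ w ⁻¹ᵁ U) (s : Γ(Z, U)) :
    evalOn w U h s = (Scheme.ΓSpecIso A).hom (w.appLE U ⊤ h s) := rfl

theorem evalOn_SpecMap_comp (φ : A ⟶ B) (w : Spec A ⟶ Z) {U : Z.Opens} (h : ⊤ ≤ w ⁻¹ᵁ U)
    (h' : ⊤ ≤ (Spec.map φ ≫ w) ⁻¹ᵁ U) (s : Γ(Z, U)) :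
    evalOn (Spec.map φ ≫ w) U h' s = φ (evalOn w U h s) := by
  rw [evalOn_apply, comp_appLE_apply _ _ h]
  exact congr($(Scheme.ΓSpecIso_naturality φ).hom _)

theorem evalOn_comp (w : Spec A ⟶ Z) (f : Z ⟶ X) {U : X.Opens} (h : ⊤ ≤ w ⁻¹ᵁ f ⁻¹ᵁ U)
    (h' : ⊤ ≤ (w ≫ f) ⁻¹ᵁ U) (s : Γ(X, U)) :
    evalOn (w ≫ f) U h' s = evalOn w (f ⁻¹ᵁ U) h (f.app U s) := by
  rw [evalOn_apply, evalOn_apply, appLE_app_apply]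

variable {K : Type u} [Field K]

theorem evalOn_const {π : Z ⟶ Spec (.of K)} (φ : .of K ⟶ A) (w : Spec A ⟶ Z)
    (hw : w ≫ π = Spec.map φ) {U : Z.Opens} (h : ⊤ ≤ w ⁻¹ᵁ U) (c : K) :
    evalOn w U h (const π U c) = φ c := by
  rw [evalOn_apply, appLE_const, const]
  simp only [hw]
  have h1 := Scheme.ΓSpecIso_naturality φ
  have h2 : (Spec.map φ).appLE ⊤ ⊤ le_top = (Spec.map φ).appTop :=
    Scheme.Hom.appLE_eq_app (Spec.map φ)
  rw [h2]
  refine congr($(h1).hom ((Scheme.ΓSpecIso (.of K)).inv c)).trans ?_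
  exact congr_arg φ congr($((Scheme.ΓSpecIso (.of K)).inv_hom_id).hom c)

theorem isAffineOpen_top_fromSpec (h : IsAffineOpen (⊤ : (Spec A).Opens)) :
    h.fromSpec = Spec.map (Scheme.ΓSpecIso A).inv :=
  IsAffineOpen.fromSpec_top.trans (Scheme.isoSpec_Spec_inv A)

theorem SpecMap_evalOn_fromSpec (w : Spec A ⟶ Z) {U : Z.Opens} (hU : IsAffineOpen U)
    (h : ⊤ ≤ w ⁻¹ᵁ U) : Spec.map (CommRingCat.ofHom (evalOn w U h)) ≫ hU.fromSpec = w := by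
  have h1 := IsAffineOpen.SpecMap_appLE_fromSpec w hU (isAffineOpen_top _) h
  rw [isAffineOpen_top_fromSpec] at h1
  change Spec.map (w.appLE U ⊤ h ≫ (Scheme.ΓSpecIso A).hom) ≫ _ = _
  rw [Spec.map_comp, Category.assoc, h1, ← Spec.map_comp_assoc, Iso.inv_hom_id, Spec.map_id,
    Category.id_comp]

theorem fromSpec_comp_eq (π : Z ⟶ Spec (.of K)) {U : Z.Opens} (hU : IsAffineOpen U) :
    hU.fromSpec ≫ π = Spec.map (CommRingCat.ofHom (const π U)) := by
  have h1 := IsAffineOpen.SpecMap_appLE_fromSpec π (isAffineOpen_top _) hU le_top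
  rw [← h1, isAffineOpen_top_fromSpec, ← Spec.map_comp]
  rfl

theorem evalOn_fromSpec {U : Z.Opens} (hU : IsAffineOpen U) (h : ⊤ ≤ hU.fromSpec ⁻¹ᵁ U)
    (s : Γ(Z, U)) : evalOn hU.fromSpec U h s = s := by
  have h1 : Spec.map (CommRingCat.ofHom (evalOn hU.fromSpec U h)) = 𝟙 _ := by
    rw [← cancel_mono hU.fromSpec, SpecMap_evalOn_fromSpec, Category.id_comp]
  rw [← Spec.map_id, Spec.map_injective.eq_iff] at h1
  exact congr($(h1).hom s)

theorem stalkClosedPointTo_germ [IsLocalRing A] (w : Spec A ⟶ Z) {U : Z.Opens}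
    (hU : w (IsLocalRing.closedPoint A) ∈ U) (h : ⊤ ≤ w ⁻¹ᵁ U) (s : Γ(Z, U)) :
    (Scheme.stalkClosedPointTo w).hom (Z.presheaf.germ U _ hU s) = evalOn w U h s :=
  congr($(Scheme.germ_stalkClosedPointTo w U hU).hom s)

theorem evalAt_germ (z : Spec (.of K) ⟶ Z) {U : Z.Opens} (hU : pt z ∈ U) (h : ⊤ ≤ z ⁻¹ᵁ U)
    (s : Γ(Z, U)) : evalAt z (Z.presheaf.germ U _ hU s) = evalOn z U h s :=
  stalkClosedPointTo_germ (A := .of K) z hU h s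

theorem constGerm_eq_germ_const (π : Z ⟶ Spec (.of K)) {x : Z} {U : Z.Opens} (hU : x ∈ U) (c : K) :
    constGerm π x c = Z.presheaf.germ U x hU (const π U c) :=
  (Z.presheaf.germ_res_apply (homOfLE (le_top : U ≤ ⊤)) x hU _).symm

theorem top_le_preimage (z : Spec (.of K) ⟶ Z) {U : Z.Opens} (hU : pt z ∈ U) : ⊤ ≤ z ⁻¹ᵁ U :=
  (Scheme.preimage_eq_top_of_closedPoint_mem (R := .of K) z hU).ge

end EvalOn

section DualNumber

variable {K : Type u} [Field K] {X Z : Scheme.{u}} {π : X ⟶ Spec (.of K)} {π' : Z ⟶ Spec (.of K)}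

/-- The projection from the dual numbers. -/
def dualFst (R : Type u) [CommRing R] : CommRingCat.of (DualNumber R) ⟶ .of R :=
  CommRingCat.ofHom (TrivSqZeroExt.fstHom R R R).toRingHom

instance (R : Type u) [CommRing R] : IsLocalHom (dualFst R).hom :=
  ⟨fun _ h => TrivSqZeroExt.isUnit_iff_isUnit_fst.mpr h⟩

/-- The structure map of the dual numbers. -/
def dualInl (R : Type u) [CommRing R] : CommRingCat.of R ⟶ .of (DualNumber R) :=
  CommRingCat.ofHom (algebraMap R (DualNumber R))

theorem dualInl_dualFst (R : Type u) [CommRing R] : dualInl R ≫ dualFst R = 𝟙 _ := rfl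

/-- The map of dual numbers induced by a ring homomorphism. -/
def dualMap {R S : Type u} [CommRing R] [CommRing S] (f : R →+* S) :
    CommRingCat.of (DualNumber R) ⟶ .of (DualNumber S) :=
  CommRingCat.ofHom
    { toFun x := (f x.fst, f x.snd)
      map_one' := TrivSqZeroExt.ext (map_one f) (map_zero f)
      map_zero' := TrivSqZeroExt.ext (map_zero f) (map_zero f)
      map_add' x y := TrivSqZeroExt.ext (map_add f _ _) (map_add f _ _)
      map_mul' x y := TrivSqZeroExt.ext (map_mul f _ _) (by
        rw [TrivSqZeroExt.snd_mul]
        change f _ = f _ * f _ + f _ * f _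
        simp [mul_comm]) }

theorem dualMap_dualFst {R S : Type u} [CommRing R] [CommRing S] (f : R →+* S) :
    dualMap f ≫ dualFst S = dualFst R ≫ CommRingCat.ofHom f := rfl

theorem dualInl_dualMap {R S : Type u} [CommRing R] [CommRing S] (f : R →+* S) :
    dualInl R ≫ dualMap f = CommRingCat.ofHom f ≫ dualInl S := by
  ext a
  · rfl
  · exact map_zero f

theorem surjective_SpecMap_dualFst (R : Type u) [CommRing R] :
    Function.Surjective (Spec.map (dualFst R)) := by
  intro p
  refine ⟨Spec.map (dualInl R) p, PrimeSpectrum.ext (Ideal.ext fun a => ?_)⟩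
  change TrivSqZeroExt.inl a.fst ∈ p.asIdeal ↔ a ∈ p.asIdeal
  have h : TrivSqZeroExt.inr a.snd ∈ p.asIdeal :=
    p.2.mem_of_pow_mem 2 (by rw [pow_two, TrivSqZeroExt.inr_mul_inr]; exact zero_mem _)
  conv_rhs => rw [← TrivSqZeroExt.inl_fst_add_inr_snd_eq a]
  exact (p.asIdeal.add_mem_iff_left h).symm

variable {w : Spec (.of (DualNumber K)) ⟶ Z} {z : Spec (.of K) ⟶ Z}

theorem dual_closedPoint (hz : Spec.map (dualFst K) ≫ w = z) :
    w (IsLocalRing.closedPoint (DualNumber K)) = pt z := by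
  rw [← hz]
  exact congr_arg w (Spec_closedPoint (f := dualFst K)).symm

/-- Germs at a point evaluated in the dual numbers. -/
def dualEval (hz : Spec.map (dualFst K) ≫ w = z) : Z.presheaf.stalk (pt z) →+* DualNumber K :=
  (Z.presheaf.stalkSpecializes (specializes_of_eq (dual_closedPoint hz)) ≫
    Scheme.stalkClosedPointTo (R := .of (DualNumber K)) w).hom

theorem dual_top_le (hz : Spec.map (dualFst K) ≫ w = z) {U : Z.Opens} (hU : pt z ∈ U) :
    ⊤ ≤ w ⁻¹ᵁ U :=
  (Scheme.preimage_eq_top_of_closedPoint_mem (R := .of (DualNumber K)) w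
    (dual_closedPoint hz ▸ hU)).ge

theorem dualEval_germ (hz : Spec.map (dualFst K) ≫ w = z) {U : Z.Opens} (hU : pt z ∈ U)
    (s : Γ(Z, U)) :
    dualEval hz (Z.presheaf.germ U _ hU s) = evalOn w U (dual_top_le hz hU) s := by
  have h1 := Z.presheaf.germ_stalkSpecializes hU (specializes_of_eq (dual_closedPoint hz))
  refine (congr_arg (Scheme.stalkClosedPointTo (R := .of (DualNumber K)) w).hom
    congr($(h1).hom s)).trans ?_
  exact stalkClosedPointTo_germ (A := .of (DualNumber K)) w _ _ s

theorem fst_dualEval (hz : Spec.map (dualFst K) ≫ w = z) (a) :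
    (dualEval hz a).fst = evalAt z a := by
  obtain ⟨U, hU, s, rfl⟩ := Z.presheaf.exists_germ_eq a
  rw [dualEval_germ, evalAt_germ z hU (top_le_preimage z hU)]
  subst hz
  exact (evalOn_SpecMap_comp (dualFst K) w (dual_top_le rfl hU) _ s).symm

/-- The tangent vector defined by a morphism from the spectrum of the dual numbers. -/
def tangentOf (hw : w ≫ π' = Spec.map (dualInl K)) (hz : Spec.map (dualFst K) ≫ w = z) :
    tangentSpace π' z :=
  ⟨fun a => (dualEval hz a).snd, by
    refine ⟨fun a b => ?_, fun a b => ?_, fun c => ?_⟩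
    · simp
    · simp [fst_dualEval, mul_comm]
    · rw [constGerm_eq_germ_const π' (show pt z ∈ (⊤ : Z.Opens) from trivial)]
      refine (congr_arg TrivSqZeroExt.snd ((dualEval_germ hz _ _).trans
        (evalOn_const _ w hw _ c))).trans ?_
      rfl⟩

theorem tangentOf_germ (hw : w ≫ π' = Spec.map (dualInl K)) (hz : Spec.map (dualFst K) ≫ w = z)
    {U : Z.Opens} (hU : pt z ∈ U) (s : Γ(Z, U)) :
    (tangentOf hw hz).1 (Z.presheaf.germ U _ hU s) = (evalOn w U (dual_top_le hz hU) s).snd :=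
  congr_arg TrivSqZeroExt.snd (dualEval_germ hz hU s)

/-- The differential is composition of morphisms from the dual numbers, which allows it to be
computed on functions of a chart instead of germs. -/
theorem tangentMap_tangentOf (hw : w ≫ π' = Spec.map (dualInl K))
    (hz : Spec.map (dualFst K) ≫ w = z) (f : Z ⟶ X) (hf : f ≫ π = π') {x : Spec (.of K) ⟶ X}
    (h : z ≫ f = x) {U : X.Opens} (hU : pt x ∈ U) (h' : ⊤ ≤ (w ≫ f) ⁻¹ᵁ U) (s : Γ(X, U)) :
    (tangentMap f hf h (tangentOf hw hz)).1 (X.presheaf.germ U _ hU s) =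
      (evalOn (w ≫ f) U h' s).snd := by
  have hz' : pt z ∈ f ⁻¹ᵁ U := by
    have : pt x = f (pt z) := by rw [← h]; rfl
    exact show f (pt z) ∈ U from this ▸ hU
  refine (congr_arg (tangentOf hw hz).1 (germMap_germ f h hU hz' s)).trans ?_
  rw [tangentOf_germ, evalOn_comp w f (dual_top_le hz hz')]

/-- Tangent vectors are determined by their values on the functions on an affine neighbourhood. -/
theorem tangentSpace_ext {U : Z.Opens} (hU : IsAffineOpen U) (hz : pt z ∈ U)
    {δ δ' : tangentSpace π' z}
    (h : ∀ s : Γ(Z, U), δ.1 (Z.presheaf.germ U _ hz s) = δ'.1 (Z.presheaf.germ U _ hz s)) :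
    δ = δ' := by
  refine Subtype.ext (funext fun a => ?_)
  let := Z.presheaf.algebra_section_stalk (⟨pt z, hz⟩ : U)
  have := hU.isLocalization_stalk ⟨pt z, hz⟩
  obtain ⟨⟨s, v⟩, hs⟩ := IsLocalization.surj (hU.primeIdealOf ⟨pt z, hz⟩).asIdeal.primeCompl a
  have hv := IsLocalization.map_units (Z.presheaf.stalk (pt z)) v
  change a * Z.presheaf.germ U _ hz v.1 = Z.presheaf.germ U _ hz s at hs
  change IsUnit (Z.presheaf.germ U _ hz v.1) at hv
  have h1 := δ.2.2.1 a (Z.presheaf.germ U _ hz v.1)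
  have h2 := δ'.2.2.1 a (Z.presheaf.germ U _ hz v.1)
  rw [hs, h] at h1
  rw [hs, h1, h] at h2
  exact mul_left_cancel₀ (hv.map (evalAt z)).ne_zero (add_left_cancel h2)

end DualNumber

end Sprays

/-! ### The differential of a spray along the zero section -/

namespace Sprays

open AffineSpace

variable {K : Type u} [Field K] {X : Scheme.{u}} {π : X ⟶ Spec (.of K)} {W : X.Opens}
  (hW : IsAffineOpen W) {r : ℕ}

/-- The tangent vector along the zero section in the direction of the `k`-th coordinate. -/
def thickSec (k : Fin r) : Spec (.of (DualNumber Γ(X, W))) ⟶ 𝔸(ULift.{u} (Fin r); W) :=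
  homOfVector (Spec.map (dualInl Γ(X, W)) ≫ hW.isoSpec.inv) fun l =>
    (Scheme.ΓSpecIso (.of (DualNumber Γ(X, W)))).inv (TrivSqZeroExt.inr (if l.down = k then 1 else 0))

theorem thickSec_over (k : Fin r) :
    thickSec hW k ≫ 𝔸(ULift.{u} (Fin r); W) ↘ W.toScheme =
      Spec.map (dualInl Γ(X, W)) ≫ hW.isoSpec.inv :=
  homOfVector_over _ _

theorem evalOn_thickSec_coord (k : Fin r) (h : ⊤ ≤ thickSec hW k ⁻¹ᵁ ⊤) (l) :
    evalOn (thickSec hW k) ⊤ h (coord _ l) =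
      TrivSqZeroExt.inr (if l.down = k then 1 else 0) := by
  rw [evalOn_apply, appLE_top_apply, thickSec, homOfVector_appTop_coord]
  exact congr($((Scheme.ΓSpecIso (.of (DualNumber Γ(X, W)))).inv_hom_id).hom _)

theorem evalOn_isoSpec_inv (h : ⊤ ≤ hW.isoSpec.inv ⁻¹ᵁ ⊤) (a : Γ(X, W)) :
    evalOn hW.isoSpec.inv ⊤ h (W.topIso.inv a) = a := by
  have h1 : ⊤ ≤ W.ι ⁻¹ᵁ W := (Scheme.Opens.ι_preimage_self W).ge
  have h2 : ⊤ ≤ (hW.isoSpec.inv ≫ W.ι) ⁻¹ᵁ W := by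
    rw [Scheme.Hom.comp_preimage, Scheme.Opens.ι_preimage_self]; exact le_rfl
  have h3 : evalOn (hW.isoSpec.inv ≫ W.ι) W h2 a = a := by
    have h4 := hW.isoSpec_inv_ι
    revert h2
    rw [h4]
    exact fun h2 => evalOn_fromSpec hW h2 a
  refine Eq.trans ?_ h3
  rw [evalOn_apply, evalOn_apply, comp_appLE_apply _ _ h1, ι_appLE_self, ← appLE_top_apply]

theorem evalOn_thickSec_pull (k : Fin r) (h : ⊤ ≤ thickSec (r := r) hW k ⁻¹ᵁ ⊤) (a : Γ(X, W)) :
    evalOn (thickSec hW k) ⊤ h (pull _ W a) = TrivSqZeroExt.inl a := by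
  rw [evalOn_apply, appLE_top_apply, pull_apply, appTop_comp_apply, thickSec_over,
    ← appLE_top_apply]
  refine (evalOn_SpecMap_comp (dualInl Γ(X, W)) hW.isoSpec.inv le_top le_top _).trans ?_
  exact congr_arg (dualInl Γ(X, W)) (evalOn_isoSpec_inv hW _ a)

theorem dualFst_thickSec (k : Fin r) :
    Spec.map (dualFst Γ(X, W)) ≫ thickSec hW k = hW.isoSpec.inv ≫ zeroSec _ _ := by
  refine AffineSpace.hom_ext ?_ fun l => ?_
  · rw [Category.assoc, thickSec_over, Category.assoc, zeroSec_over, Category.comp_id,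
      ← Spec.map_comp_assoc, dualInl_dualFst, Spec.map_id, Category.id_comp]
  · rw [← appTop_comp_apply, ← appTop_comp_apply, zeroSec_appTop_coord, map_zero, thickSec,
      homOfVector_appTop_coord]
    refine congr($(Scheme.ΓSpecIso_inv_naturality (dualFst Γ(X, W))).hom _).symm.trans ?_
    exact map_zero (Scheme.ΓSpecIso (.of Γ(X, W))).inv.hom

variable {σ : 𝔸(ULift.{u} (Fin r); W) ⟶ X}

section

variable (hσ : zeroSec _ _ ≫ σ = W.ι)

include hσ

theorem dualFst_thickSec_comp (k : Fin r) :
    Spec.map (dualFst Γ(X, W)) ≫ thickSec hW k ≫ σ = hW.fromSpec := by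
  rw [reassoc_of% dualFst_thickSec hW k, hσ, hW.isoSpec_inv_ι]

/-- A nilpotent thickening has no new points, and on the zero section itself the map is the
inclusion of `W`. -/
theorem thickSec_comp_le (k : Fin r) : ⊤ ≤ (thickSec hW k ≫ σ) ⁻¹ᵁ W := by
  intro y _
  obtain ⟨y, rfl⟩ := surjective_SpecMap_dualFst _ y
  change (thickSec hW k ≫ σ) (Spec.map (dualFst Γ(X, W)) y) ∈ W
  rw [← Scheme.Hom.comp_apply, dualFst_thickSec_comp hW hσ, ← SetLike.mem_coe, ← hW.range_fromSpec]
  exact ⟨y, rfl⟩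

theorem fst_evalOn_thickSec (k : Fin r) (a : Γ(X, W)) :
    (evalOn (thickSec hW k ≫ σ) W (thickSec_comp_le hW hσ k) a).fst = a := by
  have h := dualFst_thickSec_comp hW hσ k
  have h1 : ⊤ ≤ (Spec.map (dualFst Γ(X, W)) ≫ thickSec hW k ≫ σ) ⁻¹ᵁ W := by
    rw [h, hW.fromSpec_preimage_self]
  refine (evalOn_SpecMap_comp (dualFst Γ(X, W)) _ (thickSec_comp_le hW hσ k) h1 a).symm.trans ?_
  revert h1
  rw [h]
  exact fun h1 => evalOn_fromSpec hW h1 a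

end

/-- The derivation defined by a section of the projection from the dual numbers. -/
def derivationOfDual {k R : Type u} [CommRing k] [CommRing R] [Algebra k R]
    (ψ : R →+* DualNumber R) (h : ∀ a, (ψ a).fst = a) (h' : ∀ c, (ψ (algebraMap k R c)).snd = 0) :
    Derivation k R R :=
  .mk'
    { toFun a := (ψ a).snd
      map_add' a b := by simp
      map_smul' c a := by
        rw [Algebra.smul_def, map_mul, TrivSqZeroExt.snd_mul, h, h', h]
        simp [Algebra.smul_def] }
    fun a b => by
      simp [h, mul_comm]

/-- The derivations of the ring of functions given by the differential of `σ` along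
the zero section. -/
def sprayDer (π : X ⟶ Spec (.of K)) (hσ : zeroSec _ _ ≫ σ = W.ι)
    (hσπ : σ ≫ π = 𝔸(ULift.{u} (Fin r); W) ↘ W.toScheme ≫ W.ι ≫ π) (k : Fin r) :
    letI := (const π W).toAlgebra
    Derivation K Γ(X, W) Γ(X, W) :=
  letI := (const π W).toAlgebra
  derivationOfDual (evalOn (thickSec hW k ≫ σ) W (thickSec_comp_le hW hσ k))
    (fst_evalOn_thickSec hW hσ k) fun c => by
      refine (congr_arg TrivSqZeroExt.snd (evalOn_const (CommRingCat.ofHom (const π W) ≫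
        dualInl Γ(X, W)) _ ?_ (thickSec_comp_le hW hσ k) c)).trans rfl
      rw [Category.assoc, hσπ, reassoc_of% thickSec_over hW k, reassoc_of% hW.isoSpec_inv_ι,
        fromSpec_comp_eq, Spec.map_comp]

section Point

variable (y : KPoint π) (hy : pt y.1 ∈ W)

/-- Evaluation of functions on `W` at a `K`-point. -/
def evalPoint : Γ(X, W) →+* K := evalOn y.1 W (top_le_preimage y.1 hy)

theorem evalPoint_const (c : K) : evalPoint y hy (const π W c) = c :=
  evalOn_const (𝟙 _) y.1 (y.2.trans (Spec.map_id _).symm) (top_le_preimage y.1 hy) c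

/-- The `K`-point of the affine open subset `W`. -/
def affinePoint : Spec (.of K) ⟶ W.toScheme :=
  Spec.map (CommRingCat.ofHom (evalPoint y hy)) ≫ hW.isoSpec.inv

theorem affinePoint_ι : affinePoint hW y hy ≫ W.ι = y.1 := by
  rw [affinePoint, Category.assoc, hW.isoSpec_inv_ι]
  exact SpecMap_evalOn_fromSpec y.1 hW _

/-- The tangent vector at the origin of the fibre over `y` in the direction of the `k`-th
coordinate. -/
def thickPoint (k : Fin r) : Spec (.of (DualNumber K)) ⟶ 𝔸(ULift.{u} (Fin r); W) :=
  Spec.map (dualMap (evalPoint y hy)) ≫ thickSec hW k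

theorem dualFst_thickPoint (k : Fin r) :
    Spec.map (dualFst K) ≫ thickPoint hW y hy k = affinePoint hW y hy ≫ zeroSec _ _ := by
  rw [thickPoint, ← Spec.map_comp_assoc, dualMap_dualFst, Spec.map_comp_assoc, dualFst_thickSec,
    affinePoint, Category.assoc]

theorem thickPoint_over (k : Fin r) :
    thickPoint hW y hy k ≫ 𝔸(ULift.{u} (Fin r); W) ↘ W.toScheme =
      Spec.map (dualInl K) ≫ affinePoint hW y hy := by
  rw [thickPoint, Category.assoc, thickSec_over, ← Spec.map_comp_assoc, dualInl_dualMap,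
    Spec.map_comp_assoc, affinePoint]

theorem thickPoint_over_base (k : Fin r) :
    thickPoint hW y hy k ≫ 𝔸(ULift.{u} (Fin r); W) ↘ W.toScheme ≫ W.ι ≫ π =
      Spec.map (dualInl K) := by
  rw [reassoc_of% thickPoint_over hW y hy k, reassoc_of% affinePoint_ι hW y hy, y.2,
    Category.comp_id]

/-- The tangent vector at `y` is the base change of the thickened section along evaluation at `y`.
So as `y` varies, the vectors are the values of one derivation, as the openness argument requires.
-/
theorem snd_evalOn_thickPoint (hσ : zeroSec _ _ ≫ σ = W.ι)
    (hσπ : σ ≫ π = 𝔸(ULift.{u} (Fin r); W) ↘ W.toScheme ≫ W.ι ≫ π) (k : Fin r)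
    (h : ⊤ ≤ (thickPoint hW y hy k ≫ σ) ⁻¹ᵁ W) (a : Γ(X, W)) :
    letI := (const π W).toAlgebra
    (evalOn (thickPoint hW y hy k ≫ σ) W h a).snd =
      evalPoint y hy (sprayDer hW π hσ hσπ k a) := by
  have h1 : thickPoint hW y hy k ≫ σ =
      Spec.map (dualMap (evalPoint y hy)) ≫ thickSec hW k ≫ σ := by
    rw [thickPoint, Category.assoc]
  revert h
  rw [h1]
  intro h
  rw [evalOn_SpecMap_comp _ _ (thickSec_comp_le hW hσ k)]
  rfl

/-- The coordinate directions span the tangent vectors at the origin of the fibre. -/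
theorem eq_sum_tangentOf_thickPoint
    (u : tangentSpace (𝔸(ULift.{u} (Fin r); W) ↘ W.toScheme ≫ W.ι ≫ π)
      (affinePoint hW y hy ≫ zeroSec _ _))
    (hu : ∀ a, u.1 ((𝔸(ULift.{u} (Fin r); W)).presheaf.germ ⊤ _ trivial (pull _ W a)) = 0) :
    ∃ μ : Fin r → K, u = ∑ k, μ k •
      tangentOf (thickPoint_over_base hW y hy k) (dualFst_thickPoint hW y hy k) := by
  have : IsAffine W := hW
  let P := 𝔸(ULift.{u} (Fin r); W)
  have hz0 : pt (affinePoint hW y hy ≫ zeroSec (ULift.{u} (Fin r)) _) ∈ (⊤ : P.Opens) := trivial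
  have ht (k : Fin r) : ⊤ ≤ thickSec hW k ⁻¹ᵁ ⊤ := le_top
  let g : Γ(P, ⊤) → P.presheaf.stalk (pt (affinePoint hW y hy ≫ zeroSec _ _)) :=
    P.presheaf.germ ⊤ _ hz0
  let δ (k : Fin r) := tangentOf (thickPoint_over_base hW y hy k) (dualFst_thickPoint hW y hy k)
  have hδ (k : Fin r) (s : Γ(P, ⊤)) : (δ k).1 (g s) =
      (dualMap (evalPoint y hy) (evalOn (thickSec hW k) ⊤ (ht k) s)).snd :=
    (tangentOf_germ _ _ hz0 s).trans
      (congr_arg TrivSqZeroExt.snd (evalOn_SpecMap_comp _ _ (ht k) _ s))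
  -- The components of `u` are its values on the coordinates; the two sides then agree on functions
  -- from the base and on coordinates, which generate.
  let μ (k : Fin r) : K := u.1 (g (coord _ ⟨k⟩))
  have hsum (a) : (∑ k, μ k • δ k).1 a = ∑ k, μ k * (δ k).1 a := by
    simp [Finset.sum_apply]
  refine ⟨μ, tangentSpace_ext (isAffineOpen_top P) hz0 fun s => ?_⟩
  change u.1 (g s) = (∑ k, μ k • δ k).1 (g s)
  have hpull (a : Γ(X, W)) : u.1 (g (pull _ W a)) = (∑ k, μ k • δ k).1 (g (pull _ W a)) := by
    rw [hsum, hu]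
    refine (Finset.sum_eq_zero fun k _ => ?_).symm
    rw [hδ, evalOn_thickSec_pull]
    exact (congr_arg (μ k * ·) (map_zero (evalPoint y hy))).trans (mul_zero _)
  have hcoord (l) : u.1 (g (coord _ l)) = (∑ k, μ k • δ k).1 (g (coord _ l)) := by
    rw [hsum]
    have (k : Fin r) : (δ k).1 (g (coord _ l)) = if l.down = k then 1 else 0 := by
      rw [hδ, evalOn_thickSec_coord]
      change evalPoint y hy (if l.down = k then 1 else 0) = _
      split_ifs <;> simp
    simp only [this, mul_ite, mul_one, mul_zero, Finset.sum_ite_eq, Finset.mem_univ, if_true]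
    rfl
  obtain ⟨q, rfl⟩ := eval₂_pull_surjective (ULift.{u} (Fin r)) hW s
  induction q using MvPolynomial.induction_on with
  | C a => simpa using hpull a
  | add p q hp hq =>
    have hg : g (MvPolynomial.eval₂Hom (pull _ W) (coord _) (p + q)) = _ + _ :=
      congr_arg g (map_add _ p q) |>.trans (map_add (P.presheaf.germ ⊤ _ hz0).hom _ _)
    rw [hg, u.2.1, (∑ k, μ k • δ k).2.1]
    exact congr_arg₂ _ hp hq
  | mul_X p l hp =>
    have hX : MvPolynomial.eval₂Hom (pull _ W) (coord _) (p * MvPolynomial.X l) =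
        MvPolynomial.eval₂Hom (pull _ W) (coord _) p * coord _ l := by
      rw [map_mul]; simp
    have hg : g (MvPolynomial.eval₂Hom (pull _ W) (coord _) (p * MvPolynomial.X l)) =
        g (MvPolynomial.eval₂Hom (pull _ W) (coord _) p) * g (coord _ l) :=
      congr_arg g hX |>.trans (map_mul (P.presheaf.germ ⊤ _ hz0).hom _ _)
    rw [hg, u.2.2.1, (∑ k, μ k • δ k).2.2.1, hcoord l]
    exact congr_arg₂ _ rfl (congr_arg _ hp)

end Point

end Sprays

/-! ### Openness of domination -/

namespace Sprays

open AffineSpace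

variable {K : Type u} [Field K] {X : Scheme.{u}} {π : X ⟶ Spec (.of K)} {r : ℕ}

theorem VectorBundle.exists_affine_frame (T : VectorBundle X r) (x : X) :
    ∃ (W : X.Opens) (_ : IsAffineOpen W) (F : 𝔸(ULift.{u} (Fin r); W) ⟶ T.total),
      x ∈ W ∧ IsFrame T.proj W F ∧ zeroSec _ _ ≫ F = W.ι ≫ T.zero := by
  obtain ⟨W₀, c, hx, hc⟩ := T.exists_chart x
  obtain ⟨_, ⟨W, hW, rfl⟩, hxW, hle⟩ := X.isBasis_affineOpens.exists_subset_of_mem_open hx W₀.isOpen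
  obtain ⟨F, hF, hFe⟩ := ((T.isCoord W₀ c hc).restrict hle).exists_isFrame
  exact ⟨W, hW, F, hxW, hF, T.zeroSec_comp (T.zero_app_restrict hle hc) hF hF.le hFe⟩

section Frame

variable (T : GlobalSpray π r) {W : X.Opens} (hW : IsAffineOpen W)
  {F : 𝔸(ULift.{u} (Fin r); W) ⟶ T.total}

theorem Spray.zeroSec_comp_map (hF0 : zeroSec _ _ ≫ F = W.ι ≫ T.zero) :
    zeroSec _ _ ≫ F ≫ T.map = W.ι := by
  rw [reassoc_of% hF0, T.zero_map, Category.comp_id]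

theorem Spray.comp_map_over (hF : IsFrame T.proj W F) :
    (F ≫ T.map) ≫ π = 𝔸(ULift.{u} (Fin r); W) ↘ W.toScheme ≫ W.ι ≫ π := by
  rw [Category.assoc, T.map_over, Category.id_comp, ← reassoc_of% hF.w]

variable (hF : IsFrame T.proj W F) (hF0 : zeroSec _ _ ≫ F = W.ι ≫ T.zero) (y : KPoint π)
  (hy : pt y.1 ∈ W)

include hF in
-- The vector is the image of the `k`-th coordinate direction, moved from the frame into the fibre
-- by the universal property of the pullback.
theorem Spray.exists_mem_tangentImage (k : Fin r) :
    letI := (const π W).toAlgebra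
    ∃ δ ∈ T.tangentImage y.1 y (Category.comp_id _), ∀ a,
      δ.1 (X.presheaf.germ W _ hy a) = evalPoint y hy
        (sprayDer hW π (T.zeroSec_comp_map hF0) (T.comp_map_over hF) k a) := by
  have hw : (thickPoint hW y hy k ≫ F) ≫ T.proj = Spec.map (dualInl K) ≫ y.1 := by
    rw [Category.assoc, ← hF.w, reassoc_of% thickPoint_over hW y hy k, affinePoint_ι]
  let w : Spec (.of (DualNumber K)) ⟶ T.fiber y.1 := pullback.lift _ _ hw
  have hw1 : w ≫ pullback.fst T.proj y.1 = thickPoint hW y hy k ≫ F := pullback.lift_fst _ _ _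
  have hw2 : w ≫ pullback.snd T.proj y.1 = Spec.map (dualInl K) := pullback.lift_snd _ _ _
  have hw0 : Spec.map (dualFst K) ≫ w = T.origin y.1 := by
    refine pullback.hom_ext ?_ ?_
    · rw [Category.assoc, hw1, reassoc_of% dualFst_thickPoint hW y hy k, hF0,
        reassoc_of% affinePoint_ι hW y hy, Spray.origin, pullback.lift_fst]
    · rw [Category.assoc, hw2, ← Spec.map_comp, dualInl_dualFst, Spec.map_id, Spray.origin,
        pullback.lift_snd]
  have hwσ : w ≫ T.fiberMap y.1 = thickPoint hW y hy k ≫ F ≫ T.map := by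
    rw [Spray.fiberMap, reassoc_of% hw1]
  refine ⟨_, ⟨tangentOf hw2 hw0, rfl⟩, fun a => ?_⟩
  have hle : ⊤ ≤ (w ≫ T.fiberMap y.1) ⁻¹ᵁ W :=
    dual_top_le (z := y.1) (by
      rw [reassoc_of% hw0]; exact T.origin_fiberMap y.1 (Category.comp_id _)) hy
  rw [tangentMap_tangentOf hw2 hw0 _ _ _ hy hle]
  revert hle
  rw [hwσ]
  exact fun hle => snd_evalOn_thickPoint hW y hy (T.zeroSec_comp_map hF0) (T.comp_map_over hF) k
    hle a

include hF in
-- Functions from the base are constant on the fibre, so a tangent vector of the fibre kills them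
-- and is a combination of the coordinate directions in the frame.
theorem Spray.mem_span_of_mem_tangentImage {δ : tangentSpace π y.1}
    (hδ : δ ∈ T.tangentImage y.1 y (Category.comp_id _)) :
    letI := (const π W).toAlgebra
    (fun a => δ.1 (X.presheaf.germ W _ hy a)) ∈ Submodule.span K (Set.range fun k a =>
      evalPoint y hy (sprayDer hW π (T.zeroSec_comp_map hF0) (T.comp_map_over hF) k a)) := by
  obtain ⟨v, rfl⟩ := hδ
  have hw : (pullback.snd T.proj y.1 ≫ affinePoint hW y hy) ≫ W.ι =
      pullback.fst T.proj y.1 ≫ T.proj := by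
    rw [Category.assoc, affinePoint_ι, pullback.condition]
  obtain ⟨q, hq1, hq2⟩ : ∃ q : T.fiber y.1 ⟶ 𝔸(ULift.{u} (Fin r); W),
      q ≫ 𝔸(ULift.{u} (Fin r); W) ↘ W.toScheme =
        pullback.snd T.proj y.1 ≫ affinePoint hW y hy ∧ q ≫ F = pullback.fst T.proj y.1 :=
    ⟨_, hF.lift_fst _ _ hw, hF.lift_snd _ _ hw⟩
  have hqπ : q ≫ 𝔸(ULift.{u} (Fin r); W) ↘ W.toScheme ≫ W.ι ≫ π = pullback.snd T.proj y.1 := by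
    rw [reassoc_of% hq1, reassoc_of% affinePoint_ι hW y hy, y.2, Category.comp_id]
  have hq0 : T.origin y.1 ≫ q = affinePoint hW y hy ≫ zeroSec _ _ := by
    refine hF.hom_ext ?_ ?_
    · rw [Category.assoc, hq1, Category.assoc, zeroSec_over, Spray.origin,
        pullback.lift_snd_assoc, Category.id_comp, Category.comp_id]
    · rw [Category.assoc, hq2, Category.assoc, hF0, reassoc_of% affinePoint_ι hW y hy, Spray.origin,
        pullback.lift_fst]
  have hσ0 : (affinePoint hW y hy ≫ zeroSec _ _) ≫ F ≫ T.map = y.1 := by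
    rw [Category.assoc, T.zeroSec_comp_map hF0, affinePoint_ι]
  have hqσ : q ≫ F ≫ T.map = T.fiberMap y.1 := by
    rw [reassoc_of% hq2, Spray.fiberMap]
  have hcomp := tangentMap_comp q (F ≫ T.map) hqπ (T.comp_map_over hF) hq0 hσ0 hqσ
    (T.fiberMap_over y.1 y (Category.comp_id _)) (T.origin_fiberMap y.1 (Category.comp_id _)) v
  obtain ⟨μ, hμ⟩ := eq_sum_tangentOf_thickPoint hW y hy (tangentMap q hqπ hq0 v) fun a => by
    have hyq : pt (T.origin y.1) ∈ q ⁻¹ᵁ ⊤ := trivial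
    refine (congr_arg v.1 (germMap_germ q hq0 (U := ⊤) trivial hyq (pull _ W a))).trans ?_
    obtain ⟨c, hc⟩ := (ConcreteCategory.bijective_of_isIso (Scheme.ΓSpecIso (.of K)).inv).2
      ((affinePoint hW y hy).appTop (W.topIso.inv a))
    have h1 : q.appTop (pull _ W a) = (pullback.snd T.proj y.1).appTop
        ((Scheme.ΓSpecIso (.of K)).inv c) := by
      rw [hc, pull_apply, appTop_comp_apply, hq1, appTop_comp_apply]
    exact (congr_arg (fun s => v.1 ((T.fiber y.1).presheaf.germ ⊤ _ trivial s)) h1).trans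
      (v.2.2.2 c)
  rw [hcomp, hμ]
  have hsum : (fun a => (tangentMap (F ≫ T.map) (T.comp_map_over hF) hσ0 (∑ k, μ k •
      tangentOf (thickPoint_over_base hW y hy k) (dualFst_thickPoint hW y hy k))).1
        (X.presheaf.germ W _ hy a)) = ∑ k, μ k • fun a => evalPoint y hy
      (sprayDer hW π (T.zeroSec_comp_map hF0) (T.comp_map_over hF) k a) := by
    ext a
    rw [map_sum]
    simp only [map_smul, Submodule.coe_sum, Submodule.coe_smul, Finset.sum_apply, Pi.smul_apply]
    refine Finset.sum_congr rfl fun k _ => congr_arg (μ k • ·) ?_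
    have hle : ⊤ ≤ (thickPoint hW y hy k ≫ F ≫ T.map) ⁻¹ᵁ W :=
      dual_top_le (z := y.1) (by
        rw [reassoc_of% dualFst_thickPoint hW y hy k, ← Category.assoc]
        exact hσ0) hy
    rw [tangentMap_tangentOf _ _ _ _ _ hy hle]
    exact snd_evalOn_thickPoint hW y hy (T.zeroSec_comp_map hF0) (T.comp_map_over hF) k hle a
  rw [hsum]
  exact Submodule.sum_mem _ fun k _ => Submodule.smul_mem _ _ (Submodule.subset_span ⟨k, rfl⟩)

end Frame

/-- A point derivation of the ring of functions on an affine neighbourhood is a tangent vector. -/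
theorem exists_tangentSpace_eq {W : X.Opens} (hW : IsAffineOpen W) (y : KPoint π)
    (hy : pt y.1 ∈ W) :
    letI := (const π W).toAlgebra
    ∀ e : Γ(X, W) →ₐ[K] K, e.toRingHom = evalPoint y hy → ∀ d, IsPointDerivation e d →
      ∃ δ : tangentSpace π y.1, ∀ a, δ.1 (X.presheaf.germ W _ hy a) = d a := by
  let := (const π W).toAlgebra
  intro e he d hd
  have he' (a) : e a = evalPoint y hy a := congr($he a)
  have h0 : d 0 = 0 := by simpa using hd.map_algebraMap 0
  have h1 : d 1 = 0 := by simpa using hd.map_algebraMap 1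
  let ψ : CommRingCat.of Γ(X, W) ⟶ .of (DualNumber K) := CommRingCat.ofHom
    { toFun a := (e a, d a)
      map_one' := TrivSqZeroExt.ext (map_one e) h1
      map_zero' := TrivSqZeroExt.ext (map_zero e) h0
      map_add' a b := TrivSqZeroExt.ext (map_add e a b) (hd.map_add a b)
      map_mul' a b := TrivSqZeroExt.ext (map_mul e a b) (by
        refine (hd.map_mul a b).trans ?_
        exact congr_arg (e a * d b + ·) (mul_comm (e b) (d a))) }
  have hw : (Spec.map ψ ≫ hW.fromSpec) ≫ π = Spec.map (dualInl K) := by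
    rw [Category.assoc, fromSpec_comp_eq, ← Spec.map_comp]
    congr 1
    ext c
    · exact e.commutes c
    · exact hd.map_algebraMap c
  have hz : Spec.map (dualFst K) ≫ Spec.map ψ ≫ hW.fromSpec = y.1 := by
    have hψ : ψ ≫ dualFst K = CommRingCat.ofHom (evalPoint y hy) := by
      ext a
      exact he' a
    rw [← Spec.map_comp_assoc, hψ]
    exact SpecMap_evalOn_fromSpec y.1 hW _
  refine ⟨tangentOf hw hz, fun a => ?_⟩
  rw [tangentOf_germ, evalOn_SpecMap_comp _ _ hW.fromSpec_preimage_self.ge, evalOn_fromSpec]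
  rfl

/-- A spray which is dominating at a point is dominating in a neighbourhood of the point. -/
theorem Spray.exists_forall_tangentImage_eq_top [Smooth π] (T : GlobalSpray π r) (x : KPoint π)
    (hT : T.DominatingAt x) : ∃ O : X.Opens, pt x.1 ∈ O ∧ ∀ y : KPoint π, pt y.1 ∈ O →
      T.tangentImage y.1 y (Category.comp_id _) = ⊤ := by
  obtain ⟨b, hb, htop⟩ := hT
  obtain rfl : b = x.1 := (Category.comp_id b).symm.trans hb
  obtain ⟨W, hW, F, hx, hF, hF0⟩ := T.exists_affine_frame (pt x.1)
  let := (const π W).toAlgebra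
  have : Algebra.Smooth K Γ(X, W) := smooth_const π hW
  let e (y : KPoint π) (hy : pt y.1 ∈ W) : Γ(X, W) →ₐ[K] K :=
    { evalPoint y hy with commutes' := evalPoint_const y hy }
  let E := sprayDer hW π (T.zeroSec_comp_map hF0) (T.comp_map_over hF)
  -- At every point of the chart the derivations `E k` take values in the image of the differential,
  -- and at `x` they span since the spray dominates there; spanning persists where `h ≠ 0`.
  obtain ⟨h, hxh, H⟩ := exists_forall_mem_span E (e x hx) fun d hd => by
    obtain ⟨δ, hδ⟩ := exists_tangentSpace_eq hW x hx (e x hx) rfl d hd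
    have := T.mem_span_of_mem_tangentImage hW hF hF0 x hx (δ := δ) (htop ▸ trivial)
    rwa [funext hδ] at this
  have hbasic (y : KPoint π) (hy : pt y.1 ∈ W) : e y hy h ≠ 0 ↔ pt y.1 ∈ X.basicOpen h := by
    have : IsLocalHom (evalAt y.1) := Scheme.isLocalHom_stalkClosedPointTo' (R := K) y.1
    rw [Scheme.mem_basicOpen X h _ hy, ← isUnit_map_iff (evalAt y.1),
      evalAt_germ y.1 hy (top_le_preimage y.1 hy), isUnit_iff_ne_zero]
    rfl
  refine ⟨X.basicOpen h, (hbasic x hx).mp hxh, fun y hyh => ?_⟩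
  have hy := X.basicOpen_le h hyh
  refine top_le_iff.mp fun δ _ => ?_
  have hd : IsPointDerivation (e y hy) fun a => δ.1 (X.presheaf.germ W _ hy a) :=
    { map_add := fun a b => by rw [map_add, δ.2.1]
      map_mul := fun a b => by
        rw [map_mul, δ.2.2.1, evalAt_germ y.1 hy (top_le_preimage y.1 hy),
          evalAt_germ y.1 hy (top_le_preimage y.1 hy)]
        rfl
      map_algebraMap := fun c =>
        (congr_arg δ.1 (constGerm_eq_germ_const π hy c).symm).trans (δ.2.2.2 c) }
  obtain ⟨μ, hμ⟩ := (Submodule.mem_span_range_iff_exists_fun K).mp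
    (H (e y hy) ((hbasic y hy).mpr hyh) _ hd)
  choose v hv hva using fun k => T.exists_mem_tangentImage hW hF hF0 y hy k
  have : δ = ∑ k, μ k • v k := tangentSpace_ext hW hy fun s => by
    refine (congr_fun hμ s).symm.trans ?_
    simp only [Submodule.coe_sum, Submodule.coe_smul, Finset.sum_apply, Pi.smul_apply, hva]
    rfl
  rw [this]
  exact Submodule.sum_mem _ fun k _ => Submodule.smul_mem _ _ (hv k)

end Sprays

/-! ### From local ellipticity to subellipticity. -/

namespace Sprays

variable {K : Type u} [Field K] {X : Scheme.{u}} {π : X ⟶ Spec (.of K)}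

/-- A locally elliptic variety is subelliptic. -/
theorem LocallyElliptic.subelliptic [IsAlgClosed K] [CharZero K] [IsIntegral X] [IsSeparated π]
    [LocallyOfFiniteType π] [QuasiCompact π] [Smooth π] (h : LocallyElliptic π) :
    Subelliptic π := by
  have hspray (x : KPoint π) : ∃ (r : ℕ) (T : GlobalSpray π r) (O : X.Opens), pt x.1 ∈ O ∧
      ∀ y : KPoint π, pt y.1 ∈ O → T.tangentImage y.1 y (Category.comp_id _) = ⊤ := by
    obtain ⟨U, r, S, hxU, hS⟩ := h x
    obtain ⟨D, -, -, -, -, N, hN⟩ := exists_twistedExtension S x hxU hS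
    obtain ⟨T, -, hT⟩ := hN N le_rfl
    obtain ⟨O, hO⟩ := T.exists_forall_tangentImage_eq_top x hT
    exact ⟨r, T, O, hO⟩
  choose r T O hxO hO using hspray
  have htop : ⨆ x, O x = ⊤ := eq_top_of_closedPoints_subset π fun x hx =>
    TopologicalSpace.Opens.mem_iSup.mpr <| by
      let x' : KPoint π := ⟨pointOfClosedPoint π x hx, pointOfClosedPoint_comp π x hx⟩
      have hx' : pt x'.1 = x := pointOfClosedPoint_apply π x hx _
      exact ⟨x', hx' ▸ hxO x'⟩
  have : CompactSpace X := QuasiCompact.compactSpace_of_compactSpace π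
  obtain ⟨t, ht⟩ := isCompact_univ.elim_finite_subcover (fun x => (O x : Set X))
    (fun x => (O x).isOpen) (by
      rw [← TopologicalSpace.Opens.coe_iSup, htop, TopologicalSpace.Opens.coe_top])
  refine ⟨t.card, fun i => r (t.equivFin.symm i), fun i => T (t.equivFin.symm i), fun y => ?_⟩
  obtain ⟨x, hx, hyx⟩ := Set.mem_iUnion₂.mp (ht (Set.mem_univ (pt y.1)))
  -- At each point one member of the family already has surjective differential, so the sum is
  -- everything.
  have hle := le_iSup (fun i => (T (t.equivFin.symm i)).tangentImage y.1 y (Category.comp_id _))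
    (t.equivFin ⟨x, hx⟩)
  refine top_le_iff.mp (le_trans (hO _ y ?_).ge hle)
  rwa [Equiv.symm_apply_apply]

end Sprays

end

theorem mainTheorem5 {K : Type u} [Field K] [IsAlgClosed K] [CharZero K] {X : Scheme.{u}}
    (π : X ⟶ Spec (.of K)) [IsIntegral X] [IsSeparated π] [LocallyOfFiniteType π]
    [QuasiCompact π] [Smooth π] :
    (∀ (U : X.Opens) (r : ℕ) (S : Sprays.LocalSpray π U r) (x : Sprays.KPoint π),
      Dense (U : Set X) → Sprays.pt x.1 ∈ U → S.DominatingAt x →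
      ∃ D : X.IdealSheafData,
        Sprays.IsEffectiveDivisor D ∧ D.radical = D ∧
        Sprays.compl D ≤ U ∧ Sprays.pt x.1 ∈ Sprays.compl D ∧
        ∃ N : ℕ, ∀ n ≥ N, ∃ T : Sprays.GlobalSpray π r,
          Sprays.IsTwistedExtension S D n T ∧ T.DominatingAt x) ∧
    (Sprays.LocallyElliptic π → Sprays.Subelliptic π) :=
  ⟨fun _ _ S x _ hxU hS => Sprays.exists_twistedExtension S x hxU hS,
    Sprays.LocallyElliptic.subelliptic⟩
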